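/- Notation. For sequences, $a_n\asymp b_n$ means that $|a_n|\le c\,|b_n|$ and $|b_n|\le c\,|a_n|$ for some constant $c>0$ and all large $n$; $a\vee b=\max(a,b)$, $a\wedge b=\min(a,b)$. Wavelets. Let $N\ge 1$ be an integer and let $\varphi,\psi:\mathbb R\to\mathbb R$ be measurable and vanish outside $[-A,A]$. Put $\varphi_{jk}(x)=2^{j/2}\varphi(2^jx-k)$, $\psi_{jk}(x)=2^{j/2}\psi(2^jx-k)$. Assume that the father wavelet $\varphi$ generates a multiresolution analysis $(V_j)_{j\in\mathbb Z}$ of $L^2(\mathbb R)$ (that is, $\{\varphi_{0k}\}_k$ is orthonormal, the closed spans $V_j$ of $\{\varphi_{jk}\}_k$ satisfy $V_j\subseteq V_{j+1}$, and $\bigcup_jV_j$ is dense), that $\varphi$ is $N+1$ times weakly differentiable with $\operatorname{ess\,sup}_x\sum_{k\in\mathbb Z}|\varphi^{(N+1)}(x-k)|<\infty$, and that $|\varphi(u)|\le\Phi(|u|)$ for a bounded non-increasing $\Phi$ on $\mathbb R_+$ with $\int\Phi(|u|)\,du<\infty$ and $\int\Phi(|u|)|u|^N\,du<\infty$. Let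 $\psi$ be an associated mother wavelet: $\{\psi_{0k}\}_k$ is an orthonormal basis of the orthogonal complement of $V_0$ in $V_1$. Densities. Let $T>0$. For $s>0$, $1\le p,q<\infty$, $L>0$ let $\mathcal D^s_{pq}(L,T)$ be the set of probability densities $f$ with support in $[-T,T]$ and $$\Big(\sum_{k\in\mathbb Z}|\alpha_{0k}|^p\Big)^{1/p}+\Big(\sum_{j\ge0}\Big(2^{j(s+1/2-1/p)}\Big(\sum_{k\in\mathbb Z}|\beta_{jk}|^p\Big)^{1/p}\Big)^q\Big)^{1/q}\le L,\qquad \alpha_{0k}=\int f\varphi_{0k},\quad \beta_{jk}=\int f\psi_{jk}.$$ Privacy mechanism. Let $\nu>1$, let $\alpha=\alpha_n>0$ be privacy parameters with $n\alpha_n^2\to\infty$ (for instance $\alpha$ constant), put $c_A=2\lceil A\rceil+1$, $\sigma=4c_A\|\psi\|_\infty\frac{2\nu-1}{\nu-1}$, and let $\mathcal N_j=\{k\in\mathbb Z:|k|\le 2^jT+A\}$. Given independent $X_1,\dots,X_n$ with density $f$ and, independently of them, independent standard (parameter $1$) Laplace variables $W_{ijk}$, the private views are $$Z_{i,j_0-1,k}=\varphi_{j_0k}(X_i)+\frac{4c_A\|\varphi\|_\infty}{\alpha}2^{j_0/2}\,W_{i,j_0-1,k}\quad(k\in\mathcal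 N_{j_0}),$$ $$Z_{ijk}=\psi_{jk}(X_i)+\frac{\sigma}{\alpha}(j\vee1)^\nu2^{j/2}\,W_{ijk}\quad(j_0\le j\le j_1,\ k\in\mathcal N_j).$$ Estimator. Let $r\ge1$, $0<\underline L\le\overline L<\infty$, $\gamma\ge r(N+1)$, $K=4(\overline L+\sigma)$ and $$t_{j,n,\alpha}=\gamma\,\frac{j^{\nu+1/2}}{\sqrt n}\Big(1\vee\frac{2^{j/2}}{\alpha}\Big).$$ Let $j_0,j_1',j_1''\in\mathbb N$ depend on $n$ such that $$2^{j_0}\asymp(n\alpha^2)^{\frac1{2(N+1)+2}}\wedge n^{\frac1{2(N+1)+1}},\qquad 2^{j_1'}\asymp\frac n{\log n},\qquad 2^{2j_1''}\asymp\frac{n\alpha^2}{\log(n\alpha^2)},$$ and put $j_1=j_1'\wedge j_1''$. With $\widehat\alpha_{j_0k}=\frac1n\sum_iZ_{i,j_0-1,k}$ and $\widehat\beta_{jk}=\frac1n\sum_iZ_{ijk}$ let $$\widetilde f_n=\sum_{k\in\mathcal N_{j_0}}\widehat\alpha_{j_0k}\varphi_{j_0k}+\sum_{j=j_0}^{j_1}\sum_{k\in\mathcal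 N_j}\widehat\beta_{jk}\,\mathbf 1_{\{|\widehat\beta_{jk}|\ge Kt_{j,n,\alpha}\}}\psi_{jk}.$$ Neither the mechanism nor the estimator depends on $s,p,q,L$. Theorem. There is a constant $C$ such that for every $\varepsilon>0$ there are $C_0$ and $n_0$ with the following property. For all $n\ge n_0$, all $p,q\in[1,\infty)$, all $s\in(1/p,N+1)$ with $s\ge\varepsilon$, and all $L\in[\underline L,\overline L]$, $$\sup_{f\in\mathcal D^s_{pq}(L,T)}\mathbb E\|\widetilde f_n-f\|_r^r\le C_0(\log n)^C\,\mathfrak R^\star_{n,\alpha}(s,p),$$ where $$\mathfrak R^\star_{n,\alpha}(s,p)=\begin{cases}n^{-\frac{rs}{2s+1}}\vee(n\alpha^2)^{-\frac{rs}{2s+2}},&p>\frac r{s+1},\\[2pt] n^{-\frac{rs}{2s+1}}\vee\Big(\frac{n\alpha^2}{\log(n\alpha^2)}\Big)^{-\frac{r(s-1/p+1/r)}{2(s-1/p)+2}},&\frac r{2s+1}<p\le\frac r{s+1},\\[2pt] \Big(\frac n{\log n}\Big)^{-\frac{r(s-1/p+1/r)}{2(s-1/p)+1}}\vee\Big(\frac{n\alpha^2}{\log(n\alpha^2)}\Big)^{-\frac{r(s-1/p+1/r)}{2(s-1/p)+2}},&p\le\frac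 r{2s+1}.\end{cases}$$ -/

import Mathlib

open MeasureTheory Filter Topology Asymptotics
open scoped ENNReal ContDiff

namespace PrivateWavelet

noncomputable section

/-! ### Wavelets -/

/-- The dilated and translated function `x ↦ 2^{j/2} g(2^j x - k)`. -/
def atom (g : ℝ → ℝ) (j k : ℤ) (x : ℝ) : ℝ :=
  (2 : ℝ) ^ ((j : ℝ) / 2) * g ((2 : ℝ) ^ j * x - k)

/-- The closed subspace of `L²(ℝ)` generated by the functions `atom g j k`, `k ∈ ℤ`. -/
def levelSpace (g : ℝ → ℝ) (j : ℤ) : Submodule ℝ (Lp ℝ 2 (volume : Measure ℝ)) :=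
  (Submodule.span ℝ {u : Lp ℝ 2 (volume : Measure ℝ) |
    ∃ k : ℤ, (u : ℝ → ℝ) =ᵐ[volume] atom g j k}).topologicalClosure

/-- `g` is square integrable and its integer translates are orthonormal in `L²(ℝ)`. -/
structure OrthonormalTranslates (g : ℝ → ℝ) : Prop where
  memLp : MemLp g 2 volume
  orthonormal : ∀ k l : ℤ, ∫ x, g (x - k) * g (x - l) = if k = l then 1 else 0

/-- The father wavelet `φ` generates a multiresolution analysis of `L²(ℝ)`. -/
structure GeneratesMRA (φ : ℝ → ℝ) : Prop extends OrthonormalTranslates φ where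
  nested : ∀ j : ℤ, levelSpace φ j ≤ levelSpace φ (j + 1)
  dense : (⨆ j : ℤ, levelSpace φ j).topologicalClosure = ⊤

/-- `ψ` is a mother wavelet associated with `φ`: its integer translates are an orthonormal basis
of the orthogonal complement of `V₀` in `V₁`. -/
structure IsMotherWavelet (φ ψ : ℝ → ℝ) : Prop extends OrthonormalTranslates ψ where
  detail : levelSpace ψ 0 = levelSpace φ 1 ⊓ (levelSpace φ 0)ᗮ

/-- `h` is the weak derivative of order `m` of `g` on the real line. -/
def HasWeakDeriv (m : ℕ) (g h : ℝ → ℝ) : Prop :=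
  LocallyIntegrable g ∧ LocallyIntegrable h ∧
    ∀ η : ℝ → ℝ, ContDiff ℝ ∞ η → HasCompactSupport η →
      ∫ x, g x * iteratedDeriv m η x = (-1) ^ m * ∫ x, h x * η x

/-- The standing assumption on the father wavelet, with regularity index `N`. -/
structure FatherWavelet (φ : ℝ → ℝ) (N : ℕ) : Prop where
  mra : GeneratesMRA φ
  weaklyDiff : ∀ m ≤ N, ∃ h, HasWeakDeriv m φ h
  topDeriv : ∃ h, HasWeakDeriv (N + 1) φ h ∧
    ∃ M : ℝ, ∀ᵐ x : ℝ, ∑' k : ℤ, ‖h (x - k)‖ₑ ≤ ENNReal.ofReal M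
  envelope : ∃ Φ : ℝ → ℝ, (∃ M : ℝ, ∀ u, 0 ≤ u → |Φ u| ≤ M) ∧ AntitoneOn Φ (Set.Ici 0) ∧
    (∀ u, |φ u| ≤ Φ |u|) ∧ Integrable (fun u : ℝ => Φ |u|) ∧
    Integrable (fun u : ℝ => Φ |u| * |u| ^ N)

/-- The `L^∞(ℝ)` norm. -/
def supNorm (g : ℝ → ℝ) : ℝ := (eLpNorm g ⊤ volume).toReal

/-! ### Besov classes of densities -/

/-- The `ℓ^p` norm of a sequence indexed by `ℤ`, for `1 ≤ p < ∞`. -/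
def seqNorm (p : ℝ) (a : ℤ → ℝ) : ℝ≥0∞ := (∑' k : ℤ, ‖a k‖ₑ ^ p) ^ (1 / p)

/-- The wavelet Besov norm `J_{spq}(f)`, for `1 ≤ p, q < ∞`, based on the coefficients
`α_{0k} = ∫ f φ_{0k}` and `β_{jk} = ∫ f ψ_{jk}`, `j ≥ 0`. -/
def besovNorm (φ ψ : ℝ → ℝ) (s p q : ℝ) (f : ℝ → ℝ) : ℝ≥0∞ :=
  seqNorm p (fun k => ∫ x, f x * atom φ 0 k x) +
    (∑' j : ℕ, (ENNReal.ofReal ((2 : ℝ) ^ ((j : ℝ) * (s + 1 / 2 - 1 / p))) *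
      seqNorm p (fun k => ∫ x, f x * atom ψ j k x)) ^ q) ^ (1 / q)

/-- The probability densities supported in `[-T, T]` with Besov norm at most `L`. -/
def densityClass (φ ψ : ℝ → ℝ) (s p q L T : ℝ) : Set (ℝ → ℝ) :=
  {f | (∀ x, 0 ≤ f x) ∧ Integrable f ∧ ∫ x, f x = 1 ∧ Function.support f ⊆ Set.Icc (-T) T ∧
    besovNorm φ ψ s p q f ≤ ENNReal.ofReal L}

/-- The law on the real line with density `f`. -/
def law (f : ℝ → ℝ) : Measure ℝ := volume.withDensity fun x => ENNReal.ofReal (f x)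

/-! ### The Laplace distribution with parameter `1` -/

/-- The centred Laplace distribution with parameter `1`. -/
def laplace : Measure ℝ := law fun x => 1 / 2 * Real.exp (-|x|)

instance : IsProbabilityMeasure laplace := by
  constructor
  have h1 : ∫ x : ℝ, 1 / 2 * Real.exp (-|x|) = 1 := by
    rw [integral_const_mul, integral_comp_abs (f := fun x => Real.exp (-x)),
      integral_exp_neg_Ioi_zero]
    norm_num
  rw [laplace, law, withDensity_apply _ MeasurableSet.univ, Measure.restrict_univ,
    ← ofReal_integral_eq_lintegral_ofReal (integrable_of_integral_eq_one h1)
      (Eventually.of_forall fun x => by positivity), h1, ENNReal.ofReal_one]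

/-- The noise of one data holder: independent standard Laplace variables `W_{jk}`. -/
def noise : Measure (ℤ × ℤ → ℝ) := Measure.infinitePi fun _ => laplace

/-! ### The privacy mechanism -/

/-- The indices `k` for which the wavelet at `(j, k)`, built from a parent that vanishes outside
`[-A, A]`, can be non-zero at a point of `[-T, T]`, that is, `|k| ≤ 2^j T + A`. -/
def indexSet (A T : ℝ) (j : ℤ) : Finset ℤ :=
  Finset.Icc ⌈-((2 : ℝ) ^ j * T + A)⌉ ⌊(2 : ℝ) ^ j * T + A⌋

/-- `c_A = 2⌈A⌉ + 1`. -/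
def overlap (A : ℝ) : ℝ := 2 * (⌈A⌉ : ℝ) + 1

/-- The noise scale of the coarse coefficients. -/
def coarseScale (φ : ℝ → ℝ) (A α : ℝ) (j₀ : ℕ) : ℝ :=
  4 * overlap A * supNorm φ / α * (2 : ℝ) ^ ((j₀ : ℝ) / 2)

/-- `σ = 4 c_A ‖ψ‖_∞ (2ν - 1) / (ν - 1)`. -/
def noiseConst (ψ : ℝ → ℝ) (A ν : ℝ) : ℝ :=
  4 * overlap A * supNorm ψ * ((2 * ν - 1) / (ν - 1))

/-- The noise scale `σ_j = (σ / α) (j ∨ 1)^ν 2^{j/2}` of the detail coefficients at level `j`. -/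
def detailScale (ψ : ℝ → ℝ) (A ν α : ℝ) (j : ℤ) : ℝ :=
  noiseConst ψ A ν / α * (max (j : ℝ) 1) ^ ν * (2 : ℝ) ^ ((j : ℝ) / 2)

/-- The private view `(Z_{jk})` released by a data holder with observation `x` and noise `w`.
The coarse coefficients carry the level `j₀ - 1`. Only the levels `j₀ - 1, …, j₁` and the indices
in the corresponding finite sets are released; the other entries are `0`. -/
def privateView (φ ψ : ℝ → ℝ) (A T ν α : ℝ) (j₀ j₁ : ℕ) (x : ℝ) (w : ℤ × ℤ → ℝ)
    (j k : ℤ) : ℝ :=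
  if j = (j₀ : ℤ) - 1 ∧ k ∈ indexSet A T j₀ then
    atom φ j₀ k x + coarseScale φ A α j₀ * w (j, k)
  else if (j₀ : ℤ) ≤ j ∧ j ≤ j₁ ∧ k ∈ indexSet A T j then
    atom ψ j k x + detailScale ψ A ν α j * w (j, k)
  else 0

/-! ### The hard thresholding estimator -/

/-- The empirical mean of the released coefficients with index `(j, k)`. -/
def empMean {n : ℕ} (z : Fin n → ℤ → ℤ → ℝ) (j k : ℤ) : ℝ := 1 / (n : ℝ) * ∑ i, z i j k

/-- The threshold function `t_{j,n,α} = γ j^{ν+1/2} n^{-1/2} (1 ∨ 2^{j/2}/α)`. -/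
def thresh (γ ν α : ℝ) (n j : ℕ) : ℝ :=
  γ * ((j : ℝ) ^ (ν + 1 / 2) / Real.sqrt n) * max 1 ((2 : ℝ) ^ ((j : ℝ) / 2) / α)

/-- The wavelet estimator built from the private views `z`, in which the detail coefficients of
level `j` are kept when they are at least `τ j` in absolute value and replaced by `0` otherwise. -/
def estimator (φ ψ : ℝ → ℝ) (A T : ℝ) (j₀ j₁ : ℕ) (τ : ℕ → ℝ) {n : ℕ}
    (z : Fin n → ℤ → ℤ → ℝ) (x : ℝ) : ℝ :=
  ∑ k ∈ indexSet A T j₀, empMean z ((j₀ : ℤ) - 1) k * atom φ j₀ k x +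
    ∑ j ∈ Finset.Icc j₀ j₁, ∑ k ∈ indexSet A T j,
      (if τ j ≤ |empMean z j k| then empMean z j k else 0) * atom ψ j k x

/-- The risk `E ‖f̃ₙ - f‖_r^r`, where the pairs (observation, noise) of the `n` data holders are
independent, the observation has density `f` and is independent of the noise. -/
def risk (φ ψ : ℝ → ℝ) (A T ν α : ℝ) (j₀ j₁ : ℕ) (τ : ℕ → ℝ) (n : ℕ) (r : ℝ) (f : ℝ → ℝ) :
    ℝ≥0∞ :=
  ∫⁻ y : Fin n → ℝ × (ℤ × ℤ → ℝ),
    (∫⁻ x : ℝ, ‖estimator φ ψ A T j₀ j₁ τ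
      (fun i => privateView φ ψ A T ν α j₀ j₁ (y i).1 (y i).2) x - f x‖ₑ ^ r)
    ∂(Measure.pi fun _ : Fin n => (law f).prod noise)

/-! ### The rate -/

/-- The three-regime rate, with `n` observations and effective private sample size
`m = n α²`. -/
def rate (r s p n m : ℝ) : ℝ :=
  if r / (s + 1) < p then
    max (n ^ (-(r * s / (2 * s + 1)))) (m ^ (-(r * s / (2 * s + 2))))
  else if r / (2 * s + 1) < p then
    max (n ^ (-(r * s / (2 * s + 1))))
      ((m / Real.log m) ^ (-(r * (s - 1 / p + 1 / r) / (2 * (s - 1 / p) + 2))))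
  else
    max ((n / Real.log n) ^ (-(r * (s - 1 / p + 1 / r) / (2 * (s - 1 / p) + 1))))
      ((m / Real.log m) ^ (-(r * (s - 1 / p + 1 / r) / (2 * (s - 1 / p) + 2))))

end

end PrivateWavelet

/-! The error of the estimator splits into three pieces: the stochastic error of the coarse
coefficients, the errors of the thresholded coefficients at the levels `j₀, …, j₁`, and the bias of
the projection of `f` on the level `max j₀ (j₁ + 1)` (`ae_estimator_sub_eq`, `risk_le_sum`). Only
boundedly many atoms of one level overlap at a point, so the `L^r` norm of a wavelet sum is
controlled by the `ℓ^r` norm of its coefficients.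

Stochastic part. An empirical coefficient is a mean of `n` independent copies of a bounded variable
plus Laplace noise. A Bernstein argument with exponential moments gives an error of order `j^ν δ_j`,
where `δ_j = n^{-1/2} (1 ∨ 2^{j/2}/α)` is `noiseLevel`, and shows that the part of the error beyond
half the threshold has an `r`-th moment smaller by a factor `2^{-rj}`. The variance enters through
the second moments of the atoms under `f`. A bound on `sup f` that is uniform as `s` approaches
`1/p` is not at hand, but an interval of length of order `2^{-j}` has mass at most `C (1 + j)
2^{-j}`, where `C` depends on the smoothness only through `ε` (`setLIntegral_density_le`), and
logarithms are harmless. Hence thresholding a coefficient `β` at `τ` costs a constant times `min(τ,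
|β|)^r`, up to a negligible term (`lintegral_hardThreshold_le`).

Rate. Put `x = 2^j`, `P = min p r` and `D = 2^{j/2} δ_j`. Up to logarithms, the contribution of
level `j` is bounded by each of `D^r`, `D^{r-P} x^{-Ps}` and `x^{-r(s-1/P+1/r)}`. Moreover `D` is
the larger of `x^{e/2} M^{-1/2}` for `(e, M) = (1, n)` (sampling) and `(2, nα²)` (privacy). A
geometric mean of the first two bounds (dense case) or of the last two (sparse case), weighted so
that `j` cancels, equals `M` to the power `-rateExponent e s p r` (`log_level_le`, `level_sum_le`).
The two pairs pass from dense to sparse at different values of `p`, namely `r/(2s+1)` and `r/(s+1)`,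
whence three regimes. Every level obeys the same bound and there are `O(log n)` levels, so no
critical level has to be singled out.

Bias. The decomposition `V₁ = V₀ ⊕ W₀` holds in `L²` and is carried by truncation to integrable
densities. The projections converge to `f` in `L¹`, so the bias is a sum of details, each controlled
by the Besov norm (`lintegral_sub_waveletProj_rpow_le`). At the cut-off, `2^{-j₁}` is at most
`n^{-1} ∨ (nα²)^{-1/2}` up to a logarithm, and `rateExponent_le_reducedSmoothness` says that the
bias is then within the rate. -/

namespace PrivateWavelet

/-! ### Atoms of bounded, compactly supported generators -/

/-- `g` is measurable, vanishes outside `[-A, A]` and is essentially bounded by `b`. -/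
structure BoundedGenerator (g : ℝ → ℝ) (A b : ℝ) : Prop where
  measurable : Measurable g
  support : Function.support g ⊆ Set.Icc (-A) A
  bound : ∀ᵐ x, |g x| ≤ b
  width_nonneg : 0 ≤ A

/-- The maximal number of translates whose supports contain a given point. -/
noncomputable def multiplicity (A : ℝ) : ℕ := ⌊2 * A⌋₊ + 1

lemma multiplicity_pos (A : ℝ) : 0 < multiplicity A := Nat.succ_pos _

lemma two_zpow_eq_rpow (j : ℤ) : (2 : ℝ) ^ j = (2 : ℝ) ^ (j : ℝ) := (Real.rpow_intCast 2 j).symm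

lemma measurable_atom {g : ℝ → ℝ} (hg : Measurable g) (j k : ℤ) : Measurable (atom g j k) := by
  unfold atom
  fun_prop

lemma atom_eq_zero {g : ℝ → ℝ} {A : ℝ} (hg : Function.support g ⊆ Set.Icc (-A) A) {j k : ℤ} {x : ℝ}
    (h : A < |(2 : ℝ) ^ j * x - k|) : atom g j k x = 0 := by
  have : g ((2 : ℝ) ^ j * x - k) = 0 := by
    by_contra h0
    exact absurd (abs_le.2 (hg h0)) (not_le.2 h)
  simp [atom, this]

lemma atom_eq_zero_of_notMem_indexSet {g : ℝ → ℝ} {A T : ℝ}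
    (hg : Function.support g ⊆ Set.Icc (-A) A) {j k : ℤ} (hk : k ∉ indexSet A T j) {x : ℝ}
    (hx : x ∈ Set.Icc (-T) T) : atom g j k x = 0 := by
  apply atom_eq_zero hg
  by_contra! h
  apply hk
  obtain ⟨h1, h2⟩ := abs_le.1 h
  have h3 : (2 : ℝ) ^ j * x ≤ (2 : ℝ) ^ j * T := by gcongr; exact hx.2
  have h4 : (2 : ℝ) ^ j * (-T) ≤ (2 : ℝ) ^ j * x := by gcongr; exact hx.1
  rw [indexSet, Finset.mem_Icc, Int.ceil_le, Int.le_floor]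
  constructor <;> linarith

lemma integral_mul_atom_eq_zero {f g : ℝ → ℝ} {A T : ℝ}
    (hf : Function.support f ⊆ Set.Icc (-T) T)
    (hg : Function.support g ⊆ Set.Icc (-A) A) {j k : ℤ} (hk : k ∉ indexSet A T j) :
    ∫ x, f x * atom g j k x = 0 := by
  rw [← integral_zero ℝ ℝ (μ := volume)]
  congr 1 with x
  by_cases hx : x ∈ Set.Icc (-T) T
  · simp [atom_eq_zero_of_notMem_indexSet hg hk hx]
  · simp [Function.notMem_support.1 fun h => hx (hf h)]

/-- A non-vanishing atom at `x` forces `|2^j x - k| ≤ A`, and an interval of length `2A` contains at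
most `⌊2A⌋ + 1` integers. -/
lemma card_filter_atom_ne_zero_le {g : ℝ → ℝ} {A : ℝ} (hA : 0 ≤ A)
    (hg : Function.support g ⊆ Set.Icc (-A) A) (j : ℤ) (x : ℝ) (F : Finset ℤ) :
    (F.filter fun k => atom g j k x ≠ 0).card ≤ multiplicity A := by
  set y := (2 : ℝ) ^ j * x
  have h1 : (F.filter fun k => atom g j k x ≠ 0) ⊆ Finset.Icc ⌈y - A⌉ ⌊y + A⌋ := by
    intro k hk
    have h0 := (Finset.mem_filter.1 hk).2
    have h2 : |y - k| ≤ A := by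
      by_contra! h
      exact h0 (atom_eq_zero hg h)
    obtain ⟨h3, h4⟩ := abs_le.1 h2
    rw [Finset.mem_Icc, Int.ceil_le, Int.le_floor]
    constructor <;> linarith
  refine (Finset.card_le_card h1).trans ?_
  rw [Int.card_Icc, multiplicity, Int.toNat_le]
  have h2 : (⌊y + A⌋ - ⌈y - A⌉ : ℤ) ≤ ⌊2 * A⌋ := by
    rw [Int.le_floor]
    push_cast
    linarith [Int.floor_le (y + A), Int.le_ceil (y - A)]
  have h3 : (⌊2 * A⌋₊ : ℤ) = ⌊2 * A⌋ := Int.natCast_floor_eq_floor (by positivity)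
  push_cast
  rw [h3]
  linarith

lemma card_indexSet_le {A T : ℝ} (hA : 0 ≤ A) (hT : 0 < T) (j : ℕ) :
    ((indexSet A T j).card : ℝ) ≤ (2 * T + 2 * A + 1) * 2 ^ j := by
  have h1 : (1 : ℝ) ≤ 2 ^ j := one_le_pow₀ (by norm_num)
  set y := (2 : ℝ) ^ (j : ℤ) * T + A with hy
  have hy0 : 0 ≤ y := by positivity
  have hc : ((indexSet A T j).card : ℤ) = ⌊y⌋ + 1 - ⌈-y⌉ := by
    rw [indexSet, Int.card_Icc, Int.toNat_of_nonneg]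
    have : ⌈-y⌉ ≤ 0 := Int.ceil_le.2 (by simpa using hy0)
    have : 0 ≤ ⌊y⌋ := Int.floor_nonneg.2 hy0
    linarith
  have hc' : ((indexSet A T j).card : ℝ) = ⌊y⌋ + 1 - ⌈-y⌉ := by exact_mod_cast hc
  rw [hc']
  have : (⌊y⌋ : ℝ) + 1 - ⌈-y⌉ ≤ 2 * y + 1 := by
    linarith [Int.floor_le y, Int.le_ceil (-y)]
  refine this.trans ?_
  rw [hy, zpow_natCast]
  nlinarith [mul_nonneg hA (sub_nonneg.2 h1)]

/-- The affine map `x ↦ a x - c` preserves null sets. -/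
lemma quasiMeasurePreserving_affine {a : ℝ} (ha : a ≠ 0) (c : ℝ) :
    Measure.QuasiMeasurePreserving (fun x : ℝ => a * x - c) volume volume := by
  have h1 : Measure.QuasiMeasurePreserving (fun x : ℝ => a * x) volume volume := by
    refine ⟨by fun_prop, ?_⟩
    rw [Real.map_volume_mul_left ha]
    exact Measure.smul_absolutelyContinuous
  have h2 : Measure.QuasiMeasurePreserving (fun x : ℝ => x - c) volume volume :=
    (measurePreserving_sub_right volume c).quasiMeasurePreserving
  exact h2.comp h1

namespace BoundedGenerator

variable {g : ℝ → ℝ} {A b : ℝ}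

lemma bound_nonneg (hg : BoundedGenerator g A b) : 0 ≤ b := by
  obtain ⟨x, hx⟩ := hg.bound.exists
  exact (abs_nonneg _).trans hx

lemma ae_abs_atom_le (hg : BoundedGenerator g A b) (j : ℤ) :
    ∀ᵐ x, ∀ k : ℤ, |atom g j k x| ≤ (2 : ℝ) ^ ((j : ℝ) / 2) * b := by
  rw [ae_all_iff]
  intro k
  have h := (quasiMeasurePreserving_affine (a := (2 : ℝ) ^ j) (by positivity) k).ae hg.bound
  filter_upwards [h] with x hx
  rw [atom, abs_mul, abs_of_nonneg (by positivity)]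
  gcongr

/-- The interval that carries `atom g j k`. -/
def _root_.PrivateWavelet.atomInterval (A : ℝ) (j k : ℤ) : Set ℝ :=
  Set.Icc (((k : ℝ) - A) / 2 ^ j) ((k + A) / 2 ^ j)

lemma _root_.PrivateWavelet.volume_atomInterval (A : ℝ) (j k : ℤ) :
    volume (atomInterval A j k) = ENNReal.ofReal (2 * A * (2 : ℝ) ^ (-(j : ℝ))) := by
  rw [atomInterval, Real.volume_Icc, Real.rpow_neg (by norm_num), ← two_zpow_eq_rpow]
  congr 1
  field_simp
  ring

lemma atom_eq_zero_of_notMem (hg : BoundedGenerator g A b) {j k : ℤ} {x : ℝ}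
    (hx : x ∉ atomInterval A j k) : atom g j k x = 0 := by
  apply atom_eq_zero hg.support
  by_contra! h
  apply hx
  obtain ⟨h1, h2⟩ := abs_le.1 h
  rw [atomInterval, Set.mem_Icc, div_le_iff₀ (by positivity), le_div_iff₀ (by positivity)]
  constructor <;> linarith

lemma lintegral_atom_rpow_le (hg : BoundedGenerator g A b) (j k : ℤ) {r : ℝ} (hr : 0 < r) :
    ∫⁻ x, ‖atom g j k x‖ₑ ^ r ≤
      ENNReal.ofReal (2 * A * b ^ r * (2 : ℝ) ^ ((j : ℝ) * (r / 2 - 1))) := by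
  have hb := hg.bound_nonneg
  have hA := hg.width_nonneg
  have h1 : ∀ᵐ x, ‖atom g j k x‖ₑ ^ r ≤
      (atomInterval A j k).indicator
        (fun _ => ENNReal.ofReal (((2 : ℝ) ^ ((j : ℝ) / 2) * b) ^ r)) x := by
    filter_upwards [hg.ae_abs_atom_le j] with x hx
    by_cases hI : x ∈ atomInterval A j k
    · rw [Set.indicator_of_mem hI, ← ENNReal.ofReal_rpow_of_nonneg (by positivity) hr.le,
        Real.enorm_eq_ofReal_abs]
      gcongr
      exact hx k
    · simp [hg.atom_eq_zero_of_notMem hI, hr]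
  refine (lintegral_mono_ae h1).trans ?_
  rw [lintegral_indicator_const (s := atomInterval A j k) measurableSet_Icc, volume_atomInterval,
    ← ENNReal.ofReal_mul (by positivity)]
  apply ENNReal.ofReal_le_ofReal
  rw [Real.mul_rpow (by positivity) hb, ← Real.rpow_mul (by norm_num)]
  apply le_of_eq
  have : (j : ℝ) * (r / 2 - 1) = (j : ℝ) / 2 * r + (-(j : ℝ)) := by ring
  rw [this, Real.rpow_add (by norm_num)]
  ring

/-- Because of the bounded overlap, the power mean inequality is applied to at most `multiplicity A`
terms, and the constant does not depend on the size of `F`. -/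
lemma sum_atom_enorm_rpow_le (hg : BoundedGenerator g A b) (j : ℤ) {r : ℝ} (hr : 1 ≤ r)
    (F : Finset ℤ) (c : ℤ → ℝ) (x : ℝ) :
    ‖∑ k ∈ F, c k * atom g j k x‖ₑ ^ r ≤
      ENNReal.ofReal ((multiplicity A : ℝ) ^ (r - 1)) *
        ∑ k ∈ F, ‖c k‖ₑ ^ r * ‖atom g j k x‖ₑ ^ r := by
  have hr0 : 0 < r := by linarith
  set G := F.filter fun k => atom g j k x ≠ 0 with hG
  have h1 : ∑ k ∈ F, c k * atom g j k x = ∑ k ∈ G, c k * atom g j k x := by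
    rw [hG, Finset.sum_filter]
    refine Finset.sum_congr rfl fun k _ => ?_
    by_cases h : atom g j k x = 0 <;> simp [h]
  have h2 : ‖∑ k ∈ G, c k * atom g j k x‖ₑ ≤ ∑ k ∈ G, ‖c k‖ₑ * ‖atom g j k x‖ₑ := by
    refine (enorm_sum_le _ _).trans (le_of_eq ?_)
    simp [enorm_mul]
  rw [h1]
  calc ‖∑ k ∈ G, c k * atom g j k x‖ₑ ^ r
      ≤ (∑ k ∈ G, ‖c k‖ₑ * ‖atom g j k x‖ₑ) ^ r := by gcongr
    _ ≤ (G.card : ℝ≥0∞) ^ (r - 1) * ∑ k ∈ G, (‖c k‖ₑ * ‖atom g j k x‖ₑ) ^ r :=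
        ENNReal.rpow_sum_le_const_mul_sum_rpow _ _ hr
    _ ≤ ENNReal.ofReal ((multiplicity A : ℝ) ^ (r - 1)) *
          ∑ k ∈ F, ‖c k‖ₑ ^ r * ‖atom g j k x‖ₑ ^ r := by
        rw [← ENNReal.ofReal_rpow_of_nonneg (by positivity) (by linarith), ENNReal.ofReal_natCast]
        gcongr
        · exact card_filter_atom_ne_zero_le hg.width_nonneg hg.support j x F
        · refine (Finset.sum_le_sum_of_subset (Finset.filter_subset _ _)).trans (le_of_eq ?_)
          refine Finset.sum_congr rfl fun k _ => ?_
          rw [ENNReal.mul_rpow_of_nonneg _ _ hr0.le]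

/-- The constant in the comparison of the `L^r` norm of a wavelet sum with its coefficients. -/
noncomputable def _root_.PrivateWavelet.sumConst (A b r : ℝ) : ℝ :=
  (multiplicity A : ℝ) ^ (r - 1) * (2 * A * b ^ r)

lemma sumConst_nonneg (hg : BoundedGenerator g A b) (r : ℝ) : 0 ≤ sumConst A b r := by
  have := hg.bound_nonneg
  have := hg.width_nonneg
  unfold sumConst
  positivity

lemma lintegral_sum_atom_rpow_le (hg : BoundedGenerator g A b) (j : ℤ) {r : ℝ} (hr : 1 ≤ r)
    (F : Finset ℤ) (c : ℤ → ℝ) :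
    ∫⁻ x, ‖∑ k ∈ F, c k * atom g j k x‖ₑ ^ r ≤
      ENNReal.ofReal (sumConst A b r * (2 : ℝ) ^ ((j : ℝ) * (r / 2 - 1))) *
        ∑ k ∈ F, ‖c k‖ₑ ^ r := by
  have hb := hg.bound_nonneg
  have hA := hg.width_nonneg
  have hm : ∀ k, Measurable fun x => ‖atom g j k x‖ₑ ^ r := fun k =>
    (measurable_atom hg.measurable j k).enorm.pow_const r
  refine (lintegral_mono fun x => hg.sum_atom_enorm_rpow_le j hr F c x).trans ?_
  rw [lintegral_const_mul _ (Finset.measurable_fun_sum _ fun k _ => (hm k).const_mul _),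
    lintegral_finsetSum _ fun k _ => (hm k).const_mul _, sumConst, mul_assoc,
    ENNReal.ofReal_mul (by positivity), mul_assoc]
  gcongr
  rw [Finset.mul_sum]
  gcongr with k
  rw [lintegral_const_mul _ (hm k), mul_comm]
  gcongr
  exact hg.lintegral_atom_rpow_le j k (by linarith)

lemma ae_abs_sum_atom_le (hg : BoundedGenerator g A b) (j : ℤ) (F : Finset ℤ) (c : ℤ → ℝ) {B : ℝ}
    (hB : 0 ≤ B) (hc : ∀ k ∈ F, |c k| ≤ B) :
    ∀ᵐ x, |∑ k ∈ F, c k * atom g j k x| ≤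
      multiplicity A * b * (B * (2 : ℝ) ^ ((j : ℝ) / 2)) := by
  have hb := hg.bound_nonneg
  filter_upwards [hg.ae_abs_atom_le j] with x hx
  set G := F.filter fun k => atom g j k x ≠ 0 with hG
  have h1 : ∑ k ∈ F, c k * atom g j k x = ∑ k ∈ G, c k * atom g j k x := by
    rw [hG, Finset.sum_filter]
    refine Finset.sum_congr rfl fun k _ => ?_
    by_cases h : atom g j k x = 0 <;> simp [h]
  rw [h1]
  calc |∑ k ∈ G, c k * atom g j k x| ≤ ∑ k ∈ G, |c k * atom g j k x| :=
        Finset.abs_sum_le_sum_abs _ _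
    _ ≤ ∑ k ∈ G, B * ((2 : ℝ) ^ ((j : ℝ) / 2) * b) := by
        gcongr with k hk
        rw [abs_mul]
        gcongr
        · exact hc k (Finset.mem_filter.1 hk).1
        · exact hx k
    _ = G.card * (B * ((2 : ℝ) ^ ((j : ℝ) / 2) * b)) := by rw [Finset.sum_const, nsmul_eq_mul]
    _ ≤ multiplicity A * (B * ((2 : ℝ) ^ ((j : ℝ) / 2) * b)) := by
        gcongr
        exact card_filter_atom_ne_zero_le hg.width_nonneg hg.support j x F
    _ = _ := by ring

end BoundedGenerator

/-! ### Orthonormal expansions -/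

section Abstract

variable {E : Type*} [NormedAddCommGroup E] [InnerProductSpace ℝ E]

/-- Outside a finite set the coefficients are assumed to vanish, which is the case for compactly
supported functions and atoms. The finite sum is then the projection, because the residual is
orthogonal to every `v k`; no infinite expansion is involved. -/
lemma starProjection_span_eq_sum {ι : Type*} {v : ι → E} (hv : Orthonormal ℝ v)
    [((Submodule.span ℝ (Set.range v)).topologicalClosure).HasOrthogonalProjection] {u : E}
    {F : Finset ι} (hF : ∀ k, k ∉ F → inner ℝ (v k) u = 0) :
    ((Submodule.span ℝ (Set.range v)).topologicalClosure).starProjection u =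
      ∑ k ∈ F, inner ℝ (v k) u • v k := by
  classical
  apply Submodule.eq_starProjection_of_mem_orthogonal
  · refine Submodule.sum_mem _ fun k _ => Submodule.smul_mem _ _ ?_
    exact Submodule.le_topologicalClosure _ (Submodule.subset_span ⟨k, rfl⟩)
  · rw [Submodule.orthogonal_closure, Submodule.mem_orthogonal]
    intro w hw
    induction hw using Submodule.span_induction with
    | mem x hx =>
      obtain ⟨l, rfl⟩ := hx
      rw [inner_sub_right, inner_sum]
      simp only [inner_smul_right, orthonormal_iff_ite.1 hv, mul_ite, mul_one, mul_zero,
        Finset.sum_ite_eq]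
      split_ifs with h
      · simp
      · simp [hF l h]
    | zero => simp
    | add x y _ _ hx hy => rw [inner_add_left, hx, hy, add_zero]
    | smul a x _ hx => rw [inner_smul_left, hx, mul_zero]

/-- A test vector of `V` is the sum of its component in `U` and a remainder in `W`. Each part is
orthogonal to the corresponding residual of `x` and to the other subspace. -/
lemma starProjection_eq_add_of_eq_inf_orthogonal {U V W : Submodule ℝ E}
    [U.HasOrthogonalProjection] [V.HasOrthogonalProjection] [W.HasOrthogonalProjection]
    (hUV : U ≤ V) (hW : W = V ⊓ Uᗮ) (x : E) :
    V.starProjection x = U.starProjection x + W.starProjection x := by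
  have hWV : W ≤ V := hW ▸ inf_le_left
  have hWU : ∀ w ∈ W, ∀ u ∈ U, inner ℝ u w = 0 := fun w hw u hu =>
    (Submodule.mem_orthogonal _ _).1 (hW ▸ hw : w ∈ V ⊓ Uᗮ).2 u hu
  apply Submodule.eq_starProjection_of_mem_orthogonal
  · exact V.add_mem (hUV (U.starProjection_apply_mem x)) (hWV (W.starProjection_apply_mem x))
  · rw [Submodule.mem_orthogonal]
    intro y hy
    have hy0 := U.starProjection_apply_mem y
    have hy1 : y - U.starProjection y ∈ W := by
      rw [hW]
      exact ⟨V.sub_mem hy (hUV hy0), U.sub_starProjection_mem_orthogonal y⟩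
    have e1 : inner ℝ (U.starProjection y) (x - U.starProjection x) = 0 :=
      (Submodule.mem_orthogonal _ _).1 (U.sub_starProjection_mem_orthogonal x) _ hy0
    have e2 : inner ℝ (y - U.starProjection y) (x - W.starProjection x) = 0 :=
      (Submodule.mem_orthogonal _ _).1 (W.sub_starProjection_mem_orthogonal x) _ hy1
    have e3 := hWU _ (W.starProjection_apply_mem x) _ hy0
    have e4 := hWU _ hy1 _ (U.starProjection_apply_mem x)
    rw [real_inner_comm] at e4
    have : y = U.starProjection y + (y - U.starProjection y) := by abel
    rw [this, inner_add_left]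
    have f1 : x - (U.starProjection x + W.starProjection x)
      = (x - U.starProjection x) - W.starProjection x := by abel
    have f2 : x - (U.starProjection x + W.starProjection x)
      = (x - W.starProjection x) - U.starProjection x := by abel
    nth_rewrite 1 [f1]
    rw [f2, inner_sub_right, inner_sub_right _ (x - W.starProjection x), e1, e2, e3, e4]
    simp

end Abstract

/-! ### Atoms in `L²` -/

lemma atom_mul_atom_integral {g : ℝ → ℝ} (hg : OrthonormalTranslates g) (j k l : ℤ) :
    ∫ x, atom g j k x * atom g j l x = if k = l then 1 else 0 := by
  have h := Measure.integral_comp_mul_left (fun y => g (y - k) * g (y - l)) ((2 : ℝ) ^ j)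
  have e : ∀ x, atom g j k x * atom g j l x =
      (2 : ℝ) ^ j * (g ((2 : ℝ) ^ j * x - k) * g ((2 : ℝ) ^ j * x - l)) := by
    intro x
    have : (2 : ℝ) ^ j = (2 : ℝ) ^ ((j : ℝ) / 2) * (2 : ℝ) ^ ((j : ℝ) / 2) := by
      rw [← Real.rpow_add (by norm_num), two_zpow_eq_rpow]
      congr 1
      ring
    unfold atom
    nth_rewrite 3 [this]
    ring
  simp_rw [e]
  rw [integral_const_mul, h, hg.orthonormal, abs_of_pos (by positivity), smul_eq_mul,
    mul_inv_cancel_left₀ (by positivity)]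

lemma memLp_atom {g : ℝ → ℝ} (hg : OrthonormalTranslates g) (j k : ℤ) :
    MemLp (atom g j k) 2 volume := by
  have ha : ((2 : ℝ) ^ j) ≠ 0 := by positivity
  have hm : AEStronglyMeasurable (atom g j k) volume := by
    have := hg.memLp.1.comp_quasiMeasurePreserving (quasiMeasurePreserving_affine ha k)
    exact this.const_mul _
  rw [memLp_two_iff_integrable_sq hm]
  have h1 := (memLp_two_iff_integrable_sq hg.memLp.1).1 hg.memLp
  have h2 := ((h1.comp_sub_right (k : ℝ)).comp_mul_left' ha).const_mul
    (((2 : ℝ) ^ ((j : ℝ) / 2)) ^ 2)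
  refine h2.congr (Eventually.of_forall fun x => ?_)
  simp only [atom, mul_pow]

/-- The class of `atom g j k` in `L²(ℝ)`. -/
noncomputable def atomLp {g : ℝ → ℝ} (hg : OrthonormalTranslates g) (j k : ℤ) :
    Lp ℝ 2 (volume : Measure ℝ) := (memLp_atom hg j k).toLp

lemma inner_toLp {f g : ℝ → ℝ} (hf : MemLp f 2 volume) (hg : MemLp g 2 volume) :
    inner ℝ (hf.toLp f) (hg.toLp g) = ∫ x, f x * g x := by
  rw [L2.inner_def]
  apply integral_congr_ae
  filter_upwards [hf.coeFn_toLp, hg.coeFn_toLp] with x h1 h2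
  rw [h1, h2]
  simp [mul_comm]

lemma orthonormal_atomLp {g : ℝ → ℝ} (hg : OrthonormalTranslates g) (j : ℤ) :
    Orthonormal ℝ (atomLp hg j) := by
  rw [orthonormal_iff_ite]
  intro k l
  rw [atomLp, atomLp, inner_toLp, atom_mul_atom_integral hg]

lemma levelSpace_eq {g : ℝ → ℝ} (hg : OrthonormalTranslates g) (j : ℤ) :
    levelSpace g j = (Submodule.span ℝ (Set.range (atomLp hg j))).topologicalClosure := by
  unfold levelSpace
  congr 2
  ext u
  simp only [Set.mem_ofPred_eq, Set.mem_range]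
  refine exists_congr fun k => ⟨fun h => ?_, fun h => ?_⟩
  · exact Lp.ext ((MemLp.coeFn_toLp _).trans h.symm)
  · rw [← h]
    exact MemLp.coeFn_toLp _

instance (g : ℝ → ℝ) (j : ℤ) : (levelSpace g j).HasOrthogonalProjection := by
  have : CompleteSpace (levelSpace g j) :=
    (Submodule.isClosed_topologicalClosure _).completeSpace_coe
  infer_instance

/-- The projection on the level `j`, for functions supported in `[-T, T]`. -/
noncomputable def waveletProj (g : ℝ → ℝ) (A T : ℝ) (j : ℤ) (f : ℝ → ℝ) (x : ℝ) : ℝ :=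
  ∑ k ∈ indexSet A T j, (∫ y, f y * atom g j k y) * atom g j k x

lemma memLp_waveletProj {g : ℝ → ℝ} (hg : OrthonormalTranslates g) (A T : ℝ) (j : ℤ)
    (f : ℝ → ℝ) : MemLp (waveletProj g A T j f) 2 volume :=
  memLp_finsetSum _ fun k _ => (memLp_atom hg j k).const_mul _

/-- The bridge between the Hilbert space projection and an explicit finite sum. The sum makes sense
for every integrable `f`, which is what allows leaving `L²` later. -/
lemma starProjection_levelSpace {g : ℝ → ℝ} (hg : OrthonormalTranslates g) {A T : ℝ}
    (hgA : Function.support g ⊆ Set.Icc (-A) A) (j : ℤ) {f : ℝ → ℝ} (hf : MemLp f 2 volume)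
    (hfs : Function.support f ⊆ Set.Icc (-T) T) :
    (levelSpace g j).starProjection (hf.toLp f) =
      (memLp_waveletProj hg A T j f).toLp (waveletProj g A T j f) := by
  have hin : ∀ k, inner ℝ (atomLp hg j k) (hf.toLp f) = ∫ y, f y * atom g j k y := by
    intro k
    rw [atomLp, inner_toLp]
    simp_rw [mul_comm]
  have h := starProjection_span_eq_sum (orthonormal_atomLp hg j) (u := hf.toLp f)
    (F := indexSet A T j) (fun k hk => by rw [hin, integral_mul_atom_eq_zero hfs hgA hk])
  simp_rw [hin] at h
  have h' : (levelSpace g j).starProjection (hf.toLp f) =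
      ∑ k ∈ indexSet A T j, (∫ y, f y * atom g j k y) • atomLp hg j k := by
    rw [← h]
    congr! 2
    exact levelSpace_eq hg j
  rw [h']
  apply Lp.ext
  refine EventuallyEq.trans ?_ (MemLp.coeFn_toLp _).symm
  have h3 : ∀ k ∈ indexSet A T j,
      (fun x => ((∫ y, f y * atom g j k y) • atomLp hg j k : Lp ℝ 2 (volume : Measure ℝ)) x) =ᵐ[volume]
        fun x => (∫ y, f y * atom g j k y) * atom g j k x := by
    intro k _
    filter_upwards [Lp.coeFn_smul (∫ y, f y * atom g j k y) (atomLp hg j k),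
      (memLp_atom hg j k).coeFn_toLp] with x h1 h2
    rw [h1, Pi.smul_apply, smul_eq_mul, atomLp, h2]
  have h4 := (ae_ball_iff (indexSet A T j).countable_toSet).2 h3
  filter_upwards [h4, Lp.coeFn_finsetSum (indexSet A T j) fun k => (∫ y, f y * atom g j k y) • atomLp hg j k]
    with x h5 h6
  rw [h6, waveletProj]
  simp only [Finset.sum_apply]
  exact Finset.sum_congr rfl fun k hk => h5 k hk

/-! ### Boundedness of the mother wavelet -/

lemma FatherWavelet.exists_boundedGenerator {φ : ℝ → ℝ} {N : ℕ} {A : ℝ} (hφ : FatherWavelet φ N)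
    (hφm : Measurable φ) (hφA : Function.support φ ⊆ Set.Icc (-A) A) :
    ∃ b, BoundedGenerator φ A b := by
  obtain ⟨Φ, ⟨M, hM⟩, -, hb, -, -⟩ := hφ.envelope
  refine ⟨M, hφm, hφA, Eventually.of_forall fun x =>
    (hb x).trans ((le_abs_self _).trans (hM _ (abs_nonneg x))), ?_⟩
  -- For `A < 0` the support condition would make `φ` vanish identically, against `∫ φ² = 1`.
  by_contra! h
  have h0 : ∀ x, φ x = 0 := by
    intro x
    by_contra hx
    have := hφA hx
    linarith [this.1, this.2]
  have := hφ.mra.orthonormal 0 0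
  simp [h0] at this

lemma IsMotherWavelet.mem_levelSpace {φ ψ : ℝ → ℝ} (hψ : IsMotherWavelet φ ψ) :
    atomLp hψ.toOrthonormalTranslates 0 0 ∈ levelSpace φ 1 := by
  have h : atomLp hψ.toOrthonormalTranslates 0 0 ∈ levelSpace ψ 0 := by
    rw [levelSpace_eq hψ.toOrthonormalTranslates]
    exact Submodule.le_topologicalClosure _ (Submodule.subset_span ⟨0, rfl⟩)
  rw [hψ.detail] at h
  exact h.1

lemma atom_zero_zero (g : ℝ → ℝ) : atom g 0 0 = g := by
  ext x
  simp [atom]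

/-- The mother wavelet lies in `V₁`, so the projection fixes it. As its support is compact, it is a
finite combination of the bounded atoms `φ_{1k}`; this is why `ψ` is essentially bounded. -/
lemma IsMotherWavelet.ae_eq_waveletProj {φ ψ : ℝ → ℝ} {A : ℝ} (hψ : IsMotherWavelet φ ψ)
    (hφ : OrthonormalTranslates φ) (hφA : Function.support φ ⊆ Set.Icc (-A) A)
    (hψA : Function.support ψ ⊆ Set.Icc (-A) A) :
    ψ =ᵐ[volume] waveletProj φ A A 1 ψ := by
  have h1 := starProjection_levelSpace hφ hφA 1 hψ.memLp hψA
  have h2 : hψ.memLp.toLp ψ ∈ levelSpace φ 1 := by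
    have h3 : hψ.memLp.toLp ψ = atomLp hψ.toOrthonormalTranslates 0 0 := by
      rw [atomLp]
      congr 1
      rw [atom_zero_zero]
    rw [h3]
    exact hψ.mem_levelSpace
  rw [Submodule.starProjection_eq_self_iff.2 h2] at h1
  exact (MemLp.toLp_eq_toLp_iff _ _).1 h1

lemma IsMotherWavelet.exists_bound {φ ψ : ℝ → ℝ} {A b : ℝ} (hψ : IsMotherWavelet φ ψ)
    (hφ : OrthonormalTranslates φ) (hφb : BoundedGenerator φ A b)
    (hψA : Function.support ψ ⊆ Set.Icc (-A) A) :
    ∃ b', ∀ᵐ x, |ψ x| ≤ b' := by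
  set B := ∑ k ∈ indexSet A A 1, |∫ y, ψ y * atom φ 1 k y|
  have h := hφb.ae_abs_sum_atom_le 1 (indexSet A A 1) (fun k => ∫ y, ψ y * atom φ 1 k y)
    (B := B) (Finset.sum_nonneg fun _ _ => abs_nonneg _)
    (fun k hk => Finset.single_le_sum (f := fun k => |∫ y, ψ y * atom φ 1 k y|)
      (fun _ _ => abs_nonneg _) hk)
  refine ⟨multiplicity A * b * (B * (2 : ℝ) ^ (((1 : ℤ) : ℝ) / 2)), ?_⟩
  filter_upwards [h, hψ.ae_eq_waveletProj hφ hφb.support hψA] with x h1 h2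
  rw [h2]
  exact h1

/-- An essentially bounded generator is bounded by its `L^∞` norm. -/
lemma ae_abs_le_supNorm {g : ℝ → ℝ} {b : ℝ} (hb : ∀ᵐ x, |g x| ≤ b) :
    ∀ᵐ x, |g x| ≤ supNorm g := by
  have h1 : eLpNorm g ⊤ volume ≠ ⊤ := by
    rw [eLpNorm_exponent_top]
    exact (lt_of_le_of_lt (eLpNormEssSup_le_of_ae_bound hb) ENNReal.ofReal_lt_top).ne
  filter_upwards [ae_le_eLpNormEssSup (f := g) (μ := volume)] with x hx
  rw [← eLpNorm_exponent_top] at hx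
  have := ENNReal.toReal_mono h1 hx
  simpa [supNorm] using this

lemma supNorm_pos {g : ℝ → ℝ} {b : ℝ} (hg : OrthonormalTranslates g)
    (hb : ∀ᵐ x, |g x| ≤ b) : 0 < supNorm g := by
  refine lt_of_le_of_ne ENNReal.toReal_nonneg fun h => ?_
  have h1 := ae_abs_le_supNorm hb
  rw [← h] at h1
  have h2 := hg.orthonormal 0 0
  have h3 : ∫ x, g (x - (0 : ℤ)) * g (x - (0 : ℤ)) = 0 := by
    rw [← integral_zero ℝ ℝ (μ := volume)]
    apply integral_congr_ae
    filter_upwards [h1] with x hx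
    have : g x = 0 := abs_eq_zero.1 (le_antisymm hx (abs_nonneg _))
    simp [this]
  rw [h3] at h2
  simp at h2

lemma BoundedGenerator.toSupNorm {g : ℝ → ℝ} {A b : ℝ} (hg : BoundedGenerator g A b) :
    BoundedGenerator g A (supNorm g) :=
  ⟨hg.measurable, hg.support, ae_abs_le_supNorm hg.bound, hg.width_nonneg⟩

/-! ### Scaling of projections -/

lemma atom_add (g : ℝ → ℝ) (j i k : ℤ) (x : ℝ) :
    atom g (j + i) k x = (2 : ℝ) ^ ((j : ℝ) / 2) * atom g i k ((2 : ℝ) ^ j * x) := by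
  have e1 : (2 : ℝ) ^ (((j + i : ℤ) : ℝ) / 2) =
      (2 : ℝ) ^ ((j : ℝ) / 2) * (2 : ℝ) ^ ((i : ℝ) / 2) := by
    rw [← Real.rpow_add (by norm_num)]
    push_cast
    ring_nf
  have e2 : (2 : ℝ) ^ (j + i) * x - k = (2 : ℝ) ^ i * ((2 : ℝ) ^ j * x) - k := by
    rw [zpow_add₀ (by norm_num)]
    ring
  rw [atom, atom, e1, e2]
  ring

/-- The mother wavelet is described at level `0` only. Dilation transports the two-scale relation
from there to all levels. -/
lemma waveletProj_scale (g f : ℝ → ℝ) (A T : ℝ) (j i : ℤ) (x : ℝ) :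
    waveletProj g A T (j + i) f x =
      waveletProj g A ((2 : ℝ) ^ j * T) i (fun y => f (((2 : ℝ) ^ j)⁻¹ * y)) ((2 : ℝ) ^ j * x) := by
  have hset : indexSet A T (j + i) = indexSet A ((2 : ℝ) ^ j * T) i := by
    have : (2 : ℝ) ^ (j + i) * T = (2 : ℝ) ^ i * ((2 : ℝ) ^ j * T) := by
      rw [zpow_add₀ (by norm_num)]
      ring
    rw [indexSet, indexSet, this]
  have hp : (0 : ℝ) < (2 : ℝ) ^ j := by positivity
  have hhalf : (2 : ℝ) ^ ((j : ℝ) / 2) * (2 : ℝ) ^ ((j : ℝ) / 2) = (2 : ℝ) ^ j := by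
    rw [← Real.rpow_add (by norm_num), two_zpow_eq_rpow]
    congr 1
    ring
  rw [waveletProj, waveletProj, hset]
  refine Finset.sum_congr rfl fun k _ => ?_
  have h1 := Measure.integral_comp_mul_left
    (fun y => f (((2 : ℝ) ^ j)⁻¹ * y) * atom g i k y) ((2 : ℝ) ^ j)
  have h2 : ∫ y, f y * atom g (j + i) k y =
      (2 : ℝ) ^ ((j : ℝ) / 2) *
        ∫ y, f (((2 : ℝ) ^ j)⁻¹ * ((2 : ℝ) ^ j * y)) * atom g i k ((2 : ℝ) ^ j * y) := by
    rw [← integral_const_mul]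
    congr 1 with y
    rw [inv_mul_cancel_left₀ hp.ne', atom_add]
    ring
  rw [h2, h1, atom_add, abs_of_pos (by positivity), smul_eq_mul]
  set I := ∫ y, f (((2 : ℝ) ^ j)⁻¹ * y) * atom g i k y
  calc _ = ((2 : ℝ) ^ ((j : ℝ) / 2) * (2 : ℝ) ^ ((j : ℝ) / 2)) * ((2 : ℝ) ^ j)⁻¹ *
        (I * atom g i k ((2 : ℝ) ^ j * x)) := by ring
    _ = _ := by rw [hhalf, mul_inv_cancel₀ hp.ne', one_mul]

/-! ### Coefficients of integrable functions -/

lemma BoundedGenerator.integrable_mul_atom {g f : ℝ → ℝ} {A b : ℝ} (hg : BoundedGenerator g A b)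
    (hf : Integrable f) (j k : ℤ) : Integrable fun x => f x * atom g j k x := by
  refine hf.mul_bdd (c := (2 : ℝ) ^ ((j : ℝ) / 2) * b)
    (measurable_atom hg.measurable j k).aestronglyMeasurable ?_
  filter_upwards [hg.ae_abs_atom_le j] with x hx
  exact hx k

lemma BoundedGenerator.waveletProj_sub {g f f' : ℝ → ℝ} {A b : ℝ} (hg : BoundedGenerator g A b)
    (T : ℝ) (j : ℤ) (hf : Integrable f) (hf' : Integrable f') (x : ℝ) :
    waveletProj g A T j (fun y => f y - f' y) x =
      waveletProj g A T j f x - waveletProj g A T j f' x := by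
  simp only [waveletProj, ← Finset.sum_sub_distrib]
  refine Finset.sum_congr rfl fun k _ => ?_
  simp_rw [sub_mul]
  rw [integral_sub (hg.integrable_mul_atom hf j k) (hg.integrable_mul_atom hf' j k), sub_mul]

lemma measurable_waveletProj {g : ℝ → ℝ} (hg : Measurable g) (A T : ℝ) (j : ℤ) (f : ℝ → ℝ) :
    Measurable (waveletProj g A T j f) :=
  Finset.measurable_fun_sum _ fun k _ => (measurable_atom hg j k).const_mul _

/-- Truncation of a function at height `n`. -/
noncomputable def truncate (f : ℝ → ℝ) (n : ℕ) (x : ℝ) : ℝ :=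
  {x | |f x| ≤ n}.indicator f x

lemma abs_truncate_le (f : ℝ → ℝ) (n : ℕ) (x : ℝ) : |truncate f n x| ≤ |f x| := by
  unfold truncate
  by_cases h : x ∈ {x | |f x| ≤ n} <;> simp [Set.indicator, h]

lemma abs_truncate_le' (f : ℝ → ℝ) (n : ℕ) (x : ℝ) : |truncate f n x| ≤ n := by
  unfold truncate
  by_cases h : |f x| ≤ n
  · simp [Set.indicator, h]
  · simp [Set.indicator, h]

lemma eventually_truncate_eq (f : ℝ → ℝ) (x : ℝ) : ∀ᶠ n in atTop, truncate f n x = f x := by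
  obtain ⟨m, hm⟩ := exists_nat_ge |f x|
  filter_upwards [eventually_ge_atTop m] with n hn
  have : |f x| ≤ n := hm.trans (by exact_mod_cast hn)
  simp [truncate, Set.indicator, this]

lemma support_truncate (f : ℝ → ℝ) (n : ℕ) : Function.support (truncate f n) ⊆ Function.support f :=
  fun x hx h => hx (abs_eq_zero.1 (le_antisymm ((abs_truncate_le f n x).trans (by simp [h]))
    (abs_nonneg _)))

lemma aestronglyMeasurable_truncate {f : ℝ → ℝ} (hf : AEStronglyMeasurable f volume) (n : ℕ) :
    AEStronglyMeasurable (truncate f n) volume := by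
  have : NullMeasurableSet {x | |f x| ≤ n} volume :=
    nullMeasurableSet_le hf.aemeasurable.abs aemeasurable_const
  exact hf.indicator₀ this

lemma integrable_truncate {f : ℝ → ℝ} (hf : Integrable f) (n : ℕ) : Integrable (truncate f n) :=
  hf.mono (aestronglyMeasurable_truncate hf.1 n) (Eventually.of_forall fun x => abs_truncate_le f n x)

lemma memLp_truncate {f : ℝ → ℝ} (hf : Integrable f) (n : ℕ) : MemLp (truncate f n) 2 volume := by
  have hm := aestronglyMeasurable_truncate hf.1 n
  rw [memLp_two_iff_integrable_sq hm]
  refine (hf.norm.const_mul (n : ℝ)).mono (hm.pow 2) (Eventually.of_forall fun x => ?_)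
  rw [Real.norm_eq_abs, abs_pow, sq, Real.norm_eq_abs, abs_mul, Nat.abs_cast, Real.norm_eq_abs,
    abs_abs]
  exact mul_le_mul (abs_truncate_le' f n x) (abs_truncate_le f n x) (abs_nonneg _)
    (Nat.cast_nonneg _)

/-- Densities are only assumed integrable, whereas the multiresolution identities live in `L²`.
Truncations belong to `L²`, and dominated convergence passes to the limit in each of the finitely
many coefficients, hence at every point. -/
lemma BoundedGenerator.tendsto_waveletProj_truncate {g f : ℝ → ℝ} {A b : ℝ}
    (hg : BoundedGenerator g A b) (T : ℝ) (j : ℤ) (hf : Integrable f) (x : ℝ) :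
    Tendsto (fun n => waveletProj g A T j (truncate f n) x) atTop
      (𝓝 (waveletProj g A T j f x)) := by
  refine tendsto_finsetSum _ fun k _ => Tendsto.mul_const _ ?_
  refine tendsto_integral_of_dominated_convergence (fun y => |f y * atom g j k y|)
    (fun n => (hg.integrable_mul_atom (integrable_truncate hf n) j k).1)
    (hg.integrable_mul_atom hf j k).abs (fun n => Eventually.of_forall fun y => ?_)
    (Eventually.of_forall fun y => ?_)
  · rw [Real.norm_eq_abs, abs_mul, abs_mul]
    exact mul_le_mul_of_nonneg_right (abs_truncate_le f n y) (abs_nonneg _)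
  · exact (tendsto_const_nhds.congr' ((eventually_truncate_eq f y).mono fun n h => h.symm)).mul_const _

lemma tendsto_lintegral_sub_truncate {f : ℝ → ℝ} (hf : Integrable f) :
    Tendsto (fun n => ∫⁻ x, ‖f x - truncate f n x‖ₑ) atTop (𝓝 0) := by
  have h : Tendsto (fun n => ∫⁻ x, ‖f x - truncate f n x‖ₑ) atTop
      (𝓝 (∫⁻ _ : ℝ, (0 : ℝ≥0∞))) := by
    refine tendsto_lintegral_of_dominated_convergence' (fun x => 2 * ‖f x‖ₑ)
      (fun n => (hf.sub (integrable_truncate hf n)).1.enorm) (fun n => Eventually.of_forall fun x => ?_)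
      ?_ (Eventually.of_forall fun x => ?_)
    · refine enorm_sub_le.trans ?_
      simp only [two_mul]
      gcongr
      exact enorm_le_iff_norm_le.2 (abs_truncate_le f n x)
    · rw [lintegral_const_mul' _ _ (by norm_num)]
      exact ENNReal.mul_ne_top (by norm_num) hf.2.ne
    · refine tendsto_const_nhds.congr' ?_
      filter_upwards [eventually_truncate_eq f x] with n hn
      simp [hn]
  simpa using h

/-! ### The two-scale relation -/

section TwoScale

variable {φ ψ : ℝ → ℝ} {A b b' : ℝ}

lemma two_scale_memLp (hφ : GeneratesMRA φ) (hψ : IsMotherWavelet φ ψ)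
    (hφA : Function.support φ ⊆ Set.Icc (-A) A) (hψA : Function.support ψ ⊆ Set.Icc (-A) A)
    {T : ℝ} {f : ℝ → ℝ} (hf : MemLp f 2 volume) (hfs : Function.support f ⊆ Set.Icc (-T) T) :
    ∀ᵐ x, waveletProj φ A T 1 f x = waveletProj φ A T 0 f x + waveletProj ψ A T 0 f x := by
  have h := starProjection_eq_add_of_eq_inf_orthogonal (hφ.nested 0) hψ.detail (hf.toLp f)
  rw [zero_add, starProjection_levelSpace hφ.toOrthonormalTranslates hφA 1 hf hfs,
    starProjection_levelSpace hφ.toOrthonormalTranslates hφA 0 hf hfs,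
    starProjection_levelSpace hψ.toOrthonormalTranslates hψA 0 hf hfs, ← MemLp.toLp_add] at h
  exact (MemLp.toLp_eq_toLp_iff _ _).1 h

lemma two_scale_zero (hφ : GeneratesMRA φ) (hψ : IsMotherWavelet φ ψ)
    (hφb : BoundedGenerator φ A b) (hψb : BoundedGenerator ψ A b')
    {T : ℝ} {f : ℝ → ℝ} (hf : Integrable f) (hfs : Function.support f ⊆ Set.Icc (-T) T) :
    ∀ᵐ x, waveletProj φ A T 1 f x = waveletProj φ A T 0 f x + waveletProj ψ A T 0 f x := by
  have h : ∀ᵐ x, ∀ n, waveletProj φ A T 1 (truncate f n) x =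
      waveletProj φ A T 0 (truncate f n) x + waveletProj ψ A T 0 (truncate f n) x := by
    rw [ae_all_iff]
    exact fun n => two_scale_memLp hφ hψ hφb.support hψb.support (memLp_truncate hf n)
      ((support_truncate f n).trans hfs)
  filter_upwards [h] with x hx
  refine tendsto_nhds_unique (hφb.tendsto_waveletProj_truncate T 1 hf x) ?_
  simp_rw [hx]
  exact (hφb.tendsto_waveletProj_truncate T 0 hf x).add (hψb.tendsto_waveletProj_truncate T 0 hf x)

lemma two_scale (hφ : GeneratesMRA φ) (hψ : IsMotherWavelet φ ψ)
    (hφb : BoundedGenerator φ A b) (hψb : BoundedGenerator ψ A b')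
    {T : ℝ} {f : ℝ → ℝ} (hf : Integrable f) (hfs : Function.support f ⊆ Set.Icc (-T) T) (j : ℤ) :
    ∀ᵐ x, waveletProj φ A T (j + 1) f x = waveletProj φ A T j f x + waveletProj ψ A T j f x := by
  have hp : (0 : ℝ) < (2 : ℝ) ^ j := by positivity
  have h := two_scale_zero hφ hψ hφb hψb (T := (2 : ℝ) ^ j * T)
    (f := fun y => f (((2 : ℝ) ^ j)⁻¹ * y)) (hf.comp_mul_left' (by positivity)) (by
      intro y hy
      have := hfs (show f (((2 : ℝ) ^ j)⁻¹ * y) ≠ 0 from hy)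
      rw [Set.mem_Icc, inv_mul_eq_div, le_div_iff₀ hp, div_le_iff₀ hp] at this
      constructor <;> linarith [this.1, this.2])
  have h2 := (quasiMeasurePreserving_affine hp.ne' 0).ae h
  filter_upwards [h2] with x hx
  rw [sub_zero] at hx
  have e0 : ∀ g : ℝ → ℝ, waveletProj g A T j f x = waveletProj g A ((2 : ℝ) ^ j * T) 0
      (fun y => f (((2 : ℝ) ^ j)⁻¹ * y)) ((2 : ℝ) ^ j * x) := by
    intro g
    have := waveletProj_scale g f A T j 0 x
    rwa [add_zero] at this
  rw [waveletProj_scale, hx, e0, e0]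

lemma waveletProj_eq_add_sum (hφ : GeneratesMRA φ) (hψ : IsMotherWavelet φ ψ)
    (hφb : BoundedGenerator φ A b) (hψb : BoundedGenerator ψ A b')
    {T : ℝ} {f : ℝ → ℝ} (hf : Integrable f) (hfs : Function.support f ⊆ Set.Icc (-T) T)
    {J M : ℕ} (hJM : J ≤ M) :
    ∀ᵐ x, waveletProj φ A T M f x =
      waveletProj φ A T J f x + ∑ l ∈ Finset.Ico J M, waveletProj ψ A T l f x := by
  induction M, hJM using Nat.le_induction with
  | base => simp
  | succ M hM ih =>
    filter_upwards [ih, two_scale hφ hψ hφb hψb hf hfs M] with x h1 h2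
    rw [Finset.sum_Ico_succ_top hM, ← add_assoc, ← h1, ← h2]
    simp

end TwoScale

/-! ### Convergence of the projections in `L¹` -/

lemma BoundedGenerator.abs {g : ℝ → ℝ} {A b : ℝ} (hg : BoundedGenerator g A b) :
    BoundedGenerator (fun x => |g x|) A b :=
  ⟨hg.measurable.abs, fun _ hx => hg.support fun h => hx (by simp [h]),
    hg.bound.mono fun x hx => by rwa [abs_abs], hg.width_nonneg⟩

lemma atom_abs (g : ℝ → ℝ) (j k : ℤ) (x : ℝ) : atom (fun x => |g x|) j k x = |atom g j k x| := by
  rw [atom, atom, abs_mul, abs_of_nonneg (a := (2 : ℝ) ^ ((j : ℝ) / 2)) (by positivity)]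

lemma BoundedGenerator.ae_sum_enorm_atom_le {g : ℝ → ℝ} {A b : ℝ} (hg : BoundedGenerator g A b)
    (j : ℤ) (F : Finset ℤ) :
    ∀ᵐ x, ∑ k ∈ F, ‖atom g j k x‖ₑ ≤
      ENNReal.ofReal (multiplicity A * b * (2 : ℝ) ^ ((j : ℝ) / 2)) := by
  filter_upwards [hg.abs.ae_abs_sum_atom_le j F (fun _ => 1) zero_le_one (by simp)] with x hx
  simp only [one_mul, atom_abs] at hx
  simp_rw [Real.enorm_eq_ofReal_abs]
  rw [← ENNReal.ofReal_sum_of_nonneg fun _ _ => abs_nonneg _]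
  exact ENNReal.ofReal_le_ofReal ((le_abs_self _).trans hx)

/-- The sum over `k` of the absolute atoms is of order `2^{j/2}` and the `L¹` norm of one atom is of
order `2^{-j/2}`. The product is free of `j`, so the projections are uniformly bounded on `L¹`. -/
lemma BoundedGenerator.lintegral_waveletProj_le {g f : ℝ → ℝ} {A b : ℝ}
    (hg : BoundedGenerator g A b) (T : ℝ) (j : ℤ) (hf : AEStronglyMeasurable f volume) :
    ∫⁻ x, ‖waveletProj g A T j f x‖ₑ ≤
      ENNReal.ofReal (2 * A * b * (multiplicity A * b)) * ∫⁻ x, ‖f x‖ₑ := by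
  have hb := hg.bound_nonneg
  have hA := hg.width_nonneg
  have hm : ∀ k, Measurable fun x => ‖atom g j k x‖ₑ := fun k =>
    (measurable_atom hg.measurable j k).enorm
  have hone : ∀ k, ∫⁻ x, ‖atom g j k x‖ₑ ≤
      ENNReal.ofReal (2 * A * b * (2 : ℝ) ^ (-((j : ℝ) / 2))) := by
    intro k
    have := hg.lintegral_atom_rpow_le j k one_pos
    simp only [ENNReal.rpow_one, Real.rpow_one] at this
    refine this.trans (le_of_eq ?_)
    congr 3
    ring
  calc ∫⁻ x, ‖waveletProj g A T j f x‖ₑ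
      ≤ ∫⁻ x, ∑ k ∈ indexSet A T j, ‖∫ y, f y * atom g j k y‖ₑ * ‖atom g j k x‖ₑ := by
        refine lintegral_mono fun x => (enorm_sum_le _ _).trans (le_of_eq ?_)
        simp [enorm_mul]
    _ = ∑ k ∈ indexSet A T j, ‖∫ y, f y * atom g j k y‖ₑ * ∫⁻ x, ‖atom g j k x‖ₑ := by
        rw [lintegral_finsetSum _ fun k _ => (hm k).const_mul _]
        exact Finset.sum_congr rfl fun k _ => lintegral_const_mul _ (hm k)
    _ ≤ ∑ k ∈ indexSet A T j, (∫⁻ y, ‖f y‖ₑ * ‖atom g j k y‖ₑ) *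
          ENNReal.ofReal (2 * A * b * (2 : ℝ) ^ (-((j : ℝ) / 2))) := by
        gcongr with k
        · refine (enorm_integral_le_lintegral_enorm _).trans (le_of_eq ?_)
          simp [enorm_mul]
        · exact hone k
    _ = (∫⁻ y, ‖f y‖ₑ * ∑ k ∈ indexSet A T j, ‖atom g j k y‖ₑ) *
          ENNReal.ofReal (2 * A * b * (2 : ℝ) ^ (-((j : ℝ) / 2))) := by
        have hfm : ∀ k ∈ indexSet A T j, AEMeasurable (fun y => ‖f y‖ₑ * ‖atom g j k y‖ₑ) volume :=
          fun k _ => hf.enorm.mul (hm k).aemeasurable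
        rw [← Finset.sum_mul, ← lintegral_finsetSum' _ hfm]
        simp_rw [Finset.mul_sum]
    _ ≤ (∫⁻ y, ‖f y‖ₑ * ENNReal.ofReal (multiplicity A * b * (2 : ℝ) ^ ((j : ℝ) / 2))) *
          ENNReal.ofReal (2 * A * b * (2 : ℝ) ^ (-((j : ℝ) / 2))) := by
        gcongr ?_ * _
        refine lintegral_mono_ae ?_
        filter_upwards [hg.ae_sum_enorm_atom_le j (indexSet A T j)] with x hx
        gcongr
    _ = _ := by
        rw [lintegral_mul_const'' _ hf.enorm, mul_assoc, ← ENNReal.ofReal_mul (by positivity),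
          mul_comm]
        congr 2
        have : (2 : ℝ) ^ ((j : ℝ) / 2) * (2 : ℝ) ^ (-((j : ℝ) / 2)) = 1 := by
          rw [← Real.rpow_add (by norm_num), add_neg_cancel, Real.rpow_zero]
        linear_combination (multiplicity A * b * (2 * A * b)) * this

/-- At the levels `J ≥ 0` all projections live on one fixed compact interval, on which `L²`
convergence implies `L¹` convergence. -/
lemma waveletProj_eq_zero {g : ℝ → ℝ} {A T : ℝ} (hA : 0 ≤ A)
    (hg : Function.support g ⊆ Set.Icc (-A) A) (f : ℝ → ℝ) (J : ℕ) {x : ℝ}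
    (hx : x ∉ Set.Icc (-(T + 2 * A)) (T + 2 * A)) : waveletProj g A T J f x = 0 := by
  refine Finset.sum_eq_zero fun k hk => ?_
  rw [atom_eq_zero hg, mul_zero]
  by_contra! h
  apply hx
  have h1 : (1 : ℝ) ≤ 2 ^ J := one_le_pow₀ (by norm_num)
  rw [indexSet, Finset.mem_Icc, Int.ceil_le, Int.le_floor, zpow_natCast] at hk
  rw [zpow_natCast] at h
  obtain ⟨h2, h3⟩ := abs_le.1 h
  have h4 : (2 : ℝ) ^ J * x ≤ 2 ^ J * (T + 2 * A) := by nlinarith [hk.2]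
  have h5 : (2 : ℝ) ^ J * (-(T + 2 * A)) ≤ 2 ^ J * x := by nlinarith [hk.1]
  exact ⟨le_of_mul_le_mul_left h5 (by positivity), le_of_mul_le_mul_left h4 (by positivity)⟩

lemma GeneratesMRA.monotone_levelSpace {φ : ℝ → ℝ} (hφ : GeneratesMRA φ) :
    Monotone (levelSpace φ) := monotone_int_of_le_succ hφ.nested

lemma tendsto_eLpNorm_two_sub_waveletProj {φ : ℝ → ℝ} {A T : ℝ} (hφ : GeneratesMRA φ)
    (hφA : Function.support φ ⊆ Set.Icc (-A) A)
    {f : ℝ → ℝ} (hf : MemLp f 2 volume) (hfs : Function.support f ⊆ Set.Icc (-T) T) :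
    Tendsto (fun J : ℕ => eLpNorm (waveletProj φ A T J f - f) 2 volume) atTop (𝓝 0) := by
  have : ((⨆ j, levelSpace φ j).topologicalClosure).HasOrthogonalProjection := by
    rw [hφ.dense]
    infer_instance
  have h := Submodule.starProjection_tendsto_closure_iSup (levelSpace φ) hφ.monotone_levelSpace
    (hf.toLp f)
  have h0 : (⨆ j, levelSpace φ j).topologicalClosure.starProjection (hf.toLp f) = hf.toLp f := by
    rw [Submodule.starProjection_eq_self_iff, hφ.dense]
    trivial
  rw [h0] at h
  have h1 := h.comp (tendsto_natCast_atTop_atTop (R := ℤ))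
  have h2 : Tendsto (fun J : ℕ => (memLp_waveletProj hφ.toOrthonormalTranslates A T J f).toLp
      (waveletProj φ A T J f)) atTop (𝓝 (hf.toLp f)) := by
    refine h1.congr fun J => ?_
    exact starProjection_levelSpace hφ.toOrthonormalTranslates hφA J hf hfs
  exact (Lp.tendsto_Lp_iff_tendsto_eLpNorm'' _ _ _ _).1 h2

lemma tendsto_lintegral_sub_waveletProj_of_memLp {φ : ℝ → ℝ} {A b T : ℝ} (hφ : GeneratesMRA φ)
    (hφb : BoundedGenerator φ A b)
    {f : ℝ → ℝ} (hf : MemLp f 2 volume) (hfs : Function.support f ⊆ Set.Icc (-T) T) :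
    Tendsto (fun J : ℕ => ∫⁻ x, ‖waveletProj φ A T J f x - f x‖ₑ) atTop (𝓝 0) := by
  have hA := hφb.width_nonneg
  set S := Set.Icc (-(T + 2 * A)) (T + 2 * A)
  set V : ℝ≥0∞ := volume S ^ (1 / (1 : ℝ≥0∞).toReal - 1 / (2 : ℝ≥0∞).toReal)
  have hV : V ≠ ⊤ := by
    refine ENNReal.rpow_ne_top_of_nonneg (by norm_num) ?_
    simp [S, Real.volume_Icc]
  have h := ENNReal.Tendsto.mul_const (b := V)
    (tendsto_eLpNorm_two_sub_waveletProj hφ hφb.support hf hfs) (Or.inr hV)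
  rw [zero_mul] at h
  refine tendsto_of_tendsto_of_tendsto_of_le_of_le tendsto_const_nhds h
    (fun _ => zero_le) fun J => ?_
  have hm : AEStronglyMeasurable (waveletProj φ A T J f - f) volume :=
    (memLp_waveletProj hφ.toOrthonormalTranslates A T J f).1.sub hf.1
  have h1 : ∫⁻ x, ‖waveletProj φ A T J f x - f x‖ₑ =
      ∫⁻ x in S, ‖waveletProj φ A T J f x - f x‖ₑ := by
    refine (setLIntegral_eq_of_support_subset fun x hx => ?_).symm
    by_contra hS
    apply hx
    have : f x = 0 := by
      by_contra h0
      have := hfs h0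
      exact hS ⟨by linarith [this.1], by linarith [this.2]⟩
    simp [waveletProj_eq_zero hA hφb.support f J hS, this]
  simp only
  rw [h1]
  have h2 := eLpNorm_le_eLpNorm_mul_rpow_measure_univ (μ := volume.restrict S)
    (p := 1) (q := 2) (by norm_num) hm.restrict
  rw [eLpNorm_one_eq_lintegral_enorm, Measure.restrict_apply_univ] at h2
  refine h2.trans ?_
  gcongr
  exact Measure.restrict_le_self

/-- Truncations are dense and the projections are uniformly bounded on `L¹`, so the convergence
known for functions in `L²` extends to integrable ones. -/
lemma tendsto_lintegral_sub_waveletProj {φ : ℝ → ℝ} {A b T : ℝ} (hφ : GeneratesMRA φ)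
    (hφb : BoundedGenerator φ A b)
    {f : ℝ → ℝ} (hf : Integrable f) (hfs : Function.support f ⊆ Set.Icc (-T) T) :
    Tendsto (fun J : ℕ => ∫⁻ x, ‖waveletProj φ A T J f x - f x‖ₑ) atTop (𝓝 0) := by
  set C := ENNReal.ofReal (2 * A * b * (multiplicity A * b))
  rw [ENNReal.tendsto_nhds_zero]
  intro ε hε
  have hε2 : 0 < ε / 2 := ENNReal.half_pos hε.ne'
  have h1 : Tendsto (fun n => C * (∫⁻ x, ‖f x - truncate f n x‖ₑ) +
      ∫⁻ x, ‖f x - truncate f n x‖ₑ) atTop (𝓝 0) := by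
    have := tendsto_lintegral_sub_truncate hf
    have h2 := ENNReal.Tendsto.const_mul (a := C) this (Or.inr ENNReal.ofReal_ne_top)
    simpa using h2.add this
  obtain ⟨n, hn⟩ := ((ENNReal.tendsto_nhds_zero.1 h1) _ hε2).exists
  have h3 := tendsto_lintegral_sub_waveletProj_of_memLp hφ hφb (memLp_truncate hf n)
    ((support_truncate f n).trans hfs)
  filter_upwards [(ENNReal.tendsto_nhds_zero.1 h3) _ hε2] with J hJ
  have hfn := integrable_truncate hf n
  have hm1 : AEMeasurable (fun x => ‖waveletProj φ A T J (fun y => f y - truncate f n y) x‖ₑ) :=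
    (measurable_waveletProj hφb.measurable A T J _).enorm.aemeasurable
  have hm2 : AEMeasurable (fun x => ‖f x - truncate f n x‖ₑ) := (hf.sub hfn).1.enorm
  calc ∫⁻ x, ‖waveletProj φ A T J f x - f x‖ₑ
      ≤ ∫⁻ x, (‖waveletProj φ A T J (fun y => f y - truncate f n y) x‖ₑ + ‖f x - truncate f n x‖ₑ)
          + ‖waveletProj φ A T J (truncate f n) x - truncate f n x‖ₑ := by
        refine lintegral_mono fun x => ?_
        have : waveletProj φ A T J f x - f x =
            (waveletProj φ A T J (fun y => f y - truncate f n y) x - (f x - truncate f n x)) +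
            (waveletProj φ A T J (truncate f n) x - truncate f n x) := by
          rw [hφb.waveletProj_sub T J hf hfn]
          ring
        rw [this]
        refine (enorm_add_le _ _).trans ?_
        gcongr
        exact enorm_sub_le
    _ = (∫⁻ x, ‖waveletProj φ A T J (fun y => f y - truncate f n y) x‖ₑ) +
          (∫⁻ x, ‖f x - truncate f n x‖ₑ) +
          ∫⁻ x, ‖waveletProj φ A T J (truncate f n) x - truncate f n x‖ₑ := by
        rw [← lintegral_add_left' hm1]
        exact lintegral_add_left' (hm1.add hm2) _
    _ ≤ ε / 2 + ε / 2 := by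
        gcongr
        refine le_trans ?_ hn
        gcongr
        exact hφb.lintegral_waveletProj_le T J (hf.sub hfn).1
    _ = ε := ENNReal.add_halves ε

/-! ### Besov bounds on the coefficients -/

/-- The wavelet coefficient of `f` at `(j, k)`. -/
noncomputable def waveletCoeff (g f : ℝ → ℝ) (j k : ℤ) : ℝ := ∫ x, f x * atom g j k x

lemma sum_abs_rpow_le_of_seqNorm_le {a : ℤ → ℝ} {p c B : ℝ} (hp : 1 ≤ p) (hc : 0 < c)
    (hB : 0 ≤ B) (h : ENNReal.ofReal c * seqNorm p a ≤ ENNReal.ofReal B) (F : Finset ℤ) :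
    ∑ k ∈ F, |a k| ^ p ≤ (B / c) ^ p := by
  have hp0 : 0 < p := by linarith
  have h1 : seqNorm p a ≤ ENNReal.ofReal (B / c) := by
    rw [ENNReal.ofReal_div_of_pos hc]
    exact ENNReal.le_div_iff_mul_le (Or.inl (by simpa using hc)) (Or.inl ENNReal.ofReal_ne_top) |>.2
      (by rwa [mul_comm])
  have h2 : ∑ k ∈ F, ‖a k‖ₑ ^ p ≤ ENNReal.ofReal (B / c) ^ p := by
    refine (ENNReal.sum_le_tsum F).trans ?_
    have := ENNReal.rpow_le_rpow h1 hp0.le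
    rwa [seqNorm, ← ENNReal.rpow_mul, one_div_mul_cancel hp0.ne', ENNReal.rpow_one] at this
  rw [ENNReal.ofReal_rpow_of_nonneg (by positivity) hp0.le] at h2
  have h3 : ∑ k ∈ F, ‖a k‖ₑ ^ p = ENNReal.ofReal (∑ k ∈ F, |a k| ^ p) := by
    rw [ENNReal.ofReal_sum_of_nonneg fun _ _ => by positivity]
    refine Finset.sum_congr rfl fun k _ => ?_
    rw [Real.enorm_eq_ofReal_abs, ENNReal.ofReal_rpow_of_nonneg (abs_nonneg _) hp0.le]
  rw [h3] at h2
  exact (ENNReal.ofReal_le_ofReal_iff (by positivity)).1 h2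

/-- The `ℓ^q` norm over the levels dominates each of its terms. Only this consequence of the norm in
`q` is used, so the resulting constants do not depend on `q`. -/
lemma sum_abs_coeff_rpow_le {φ ψ f : ℝ → ℝ} {s p q L : ℝ} (hp : 1 ≤ p) (hq : 1 ≤ q) (hL : 0 ≤ L)
    (hf : besovNorm φ ψ s p q f ≤ ENNReal.ofReal L) (j : ℕ) (F : Finset ℤ) :
    ∑ k ∈ F, |waveletCoeff ψ f j k| ^ p ≤
      (L * (2 : ℝ) ^ (-((j : ℝ) * (s + 1 / 2 - 1 / p)))) ^ p := by
  have hq0 : 0 < q := by linarith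
  rw [Real.rpow_neg (by norm_num), ← div_eq_mul_inv]
  refine sum_abs_rpow_le_of_seqNorm_le hp (by positivity) hL ?_ F
  refine le_trans ?_ ((le_add_self.trans (le_of_eq (by rw [besovNorm]))).trans hf)
  have h := ENNReal.le_tsum (f := fun j : ℕ =>
    (ENNReal.ofReal ((2 : ℝ) ^ ((j : ℝ) * (s + 1 / 2 - 1 / p))) *
      seqNorm p (fun k => ∫ x, f x * atom ψ j k x)) ^ q) j
  have h2 := ENNReal.rpow_le_rpow h (one_div_nonneg.2 hq0.le)
  rwa [← ENNReal.rpow_mul, mul_one_div_cancel hq0.ne', ENNReal.rpow_one] at h2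

lemma abs_coeff_le {φ ψ f : ℝ → ℝ} {s p q L : ℝ} (hp : 1 ≤ p) (hq : 1 ≤ q) (hL : 0 ≤ L)
    (hf : besovNorm φ ψ s p q f ≤ ENNReal.ofReal L) (j : ℕ) (k : ℤ) :
    |waveletCoeff ψ f j k| ≤ L * (2 : ℝ) ^ (-((j : ℝ) * (s + 1 / 2 - 1 / p))) := by
  have h := sum_abs_coeff_rpow_le hp hq hL hf j {k}
  rw [Finset.sum_singleton] at h
  exact (Real.rpow_le_rpow_iff (abs_nonneg _) (by positivity) (by linarith)).1 h

/-- The constant in the bound on the number of indices at a given level. -/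
def countConst (A T : ℝ) : ℝ := 2 * T + 2 * A + 1

lemma one_le_countConst {A T : ℝ} (hA : 0 ≤ A) (hT : 0 < T) : 1 ≤ countConst A T := by
  unfold countConst
  linarith

/-- For `p > r`, Jensen's inequality over the `O(2^j)` indices of the level turns `ℓ^p` into `ℓ^r`
without loss of smoothness. Afterwards the exponent may be taken to be `min p r`, which is at most
`r`. -/
lemma sum_abs_coeff_rpow_min_le {φ ψ f : ℝ → ℝ} {A T s p q L r : ℝ} (hA : 0 ≤ A) (hT : 0 < T)
    (hp : 1 ≤ p) (hq : 1 ≤ q) (hL : 0 ≤ L) (hr : 1 ≤ r)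
    (hf : besovNorm φ ψ s p q f ≤ ENNReal.ofReal L) (j : ℕ) :
    ∑ k ∈ indexSet A T j, |waveletCoeff ψ f j k| ^ (min p r) ≤
      (countConst A T * L * (2 : ℝ) ^ (-((j : ℝ) * (s + 1 / 2 - 1 / min p r)))) ^ (min p r) := by
  have hκ := one_le_countConst hA hT
  have h := sum_abs_coeff_rpow_le hp hq hL hf j (indexSet A T j)
  rcases le_total p r with hpr | hpr
  · rw [min_eq_left hpr]
    refine h.trans ?_
    gcongr
    nlinarith
  · rw [min_eq_right hpr]
    have hr0 : 0 < r := by linarith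
    have hp0 : 0 < p := by linarith
    have hpr1 : 1 ≤ p / r := (one_le_div hr0).2 hpr
    set a := fun k => |waveletCoeff ψ f j k| with ha
    have h1 := Real.rpow_sum_le_const_mul_sum_rpow_of_nonneg (s := indexSet A T j)
      (f := fun k => a k ^ r) hpr1 (fun k _ => by positivity)
    have e : ∀ k, (a k ^ r) ^ (p / r) = a k ^ p := fun k => by
      rw [← Real.rpow_mul (abs_nonneg _), mul_div_cancel₀ _ hr0.ne']
    simp_rw [e] at h1
    set y := (2 : ℝ) ^ (j : ℝ) with hy
    have hcard : ((indexSet A T j).card : ℝ) ≤ countConst A T * y := by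
      rw [hy, Real.rpow_natCast]
      exact card_indexSet_le hA hT j
    have h2 : (∑ k ∈ indexSet A T j, a k ^ r) ^ (p / r) ≤
        (countConst A T * y) ^ (p / r - 1) *
          (L * (2 : ℝ) ^ (-((j : ℝ) * (s + 1 / 2 - 1 / p)))) ^ p := by
      refine h1.trans ?_
      gcongr
    have h3 : (countConst A T * y) ^ (p / r - 1) *
          (L * (2 : ℝ) ^ (-((j : ℝ) * (s + 1 / 2 - 1 / p)))) ^ p ≤
        ((countConst A T * L * (2 : ℝ) ^ (-((j : ℝ) * (s + 1 / 2 - 1 / r)))) ^ r) ^ (p / r) := by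
      rw [← Real.rpow_mul (by positivity), mul_div_cancel₀ _ hr0.ne',
        Real.mul_rpow (by positivity) (by positivity), Real.mul_rpow hL (by positivity),
        Real.mul_rpow (by positivity) (by positivity), Real.mul_rpow (by positivity) hL,
        hy, ← Real.rpow_mul zero_le_two (-_) p, ← Real.rpow_mul zero_le_two (-_) p,
        ← Real.rpow_mul zero_le_two (j : ℝ)]
      have e1 : (2 : ℝ) ^ ((j : ℝ) * (p / r - 1)) * (2 : ℝ) ^ (-((j : ℝ) * (s + 1 / 2 - 1 / p)) * p)
          = (2 : ℝ) ^ (-((j : ℝ) * (s + 1 / 2 - 1 / r)) * p) := by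
        rw [← Real.rpow_add (by norm_num)]
        congr 1
        field_simp
        ring
      -- The factor from Jensen's inequality is enlarged to a `p`-th power, possible since `r ≥ 1`,
      -- so that a single factor `countConst A T` survives the root for all `p`.
      have e2 : countConst A T ^ (p / r - 1) ≤ countConst A T ^ p := by
        apply Real.rpow_le_rpow_of_exponent_le hκ
        have : p / r ≤ p := div_le_self hp0.le hr
        linarith
      rw [← e1]
      have : 0 ≤ L ^ p * ((2 : ℝ) ^ ((j : ℝ) * (p / r - 1)) *
        (2 : ℝ) ^ (-((j : ℝ) * (s + 1 / 2 - 1 / p)) * p)) := by positivity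
      nlinarith [mul_le_mul_of_nonneg_right e2 this]
    exact (Real.rpow_le_rpow_iff (Finset.sum_nonneg fun _ _ => by positivity) (by positivity)
      (by positivity)).1 (h2.trans h3)

/-- The `ℓ^r` sum is controlled by the `ℓ^p` sum when `p ≤ r`. -/
lemma sum_rpow_le_of_sum_rpow_le {ι : Type*} {F : Finset ι} {a : ι → ℝ} (ha : ∀ k, 0 ≤ a k)
    {p r B : ℝ} (hp : 0 < p) (hpr : p ≤ r) (hB : 0 ≤ B) (h : ∑ k ∈ F, a k ^ p ≤ B ^ p) :
    ∑ k ∈ F, a k ^ r ≤ B ^ r := by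
  have h1 : ∀ k ∈ F, a k ≤ B := fun k hk =>
    (Real.rpow_le_rpow_iff (ha k) hB hp).1
      ((Finset.single_le_sum (f := fun k => a k ^ p) (fun k _ => by have := ha k; positivity) hk).trans h)
  calc ∑ k ∈ F, a k ^ r ≤ ∑ k ∈ F, a k ^ p * B ^ (r - p) := by
        gcongr with k hk
        have : a k ^ r = a k ^ p * a k ^ (r - p) := by
          rw [← Real.rpow_add_of_nonneg (ha k) hp.le (by linarith)]
          congr 1
          ring
        rw [this]
        have h0 := ha k
        gcongr
        exact h1 k hk
    _ = (∑ k ∈ F, a k ^ p) * B ^ (r - p) := by rw [Finset.sum_mul]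
    _ ≤ B ^ p * B ^ (r - p) := by gcongr
    _ = B ^ r := by
        rw [← Real.rpow_add_of_nonneg hB hp.le (by linarith)]
        congr 1
        ring

/-- The smoothness that is left after the embedding in `L^r`. -/
noncomputable def reducedSmoothness (s p r : ℝ) : ℝ := s - 1 / min p r + 1 / r

lemma lintegral_detail_rpow_le {φ ψ f : ℝ → ℝ} {A b T s p q L r : ℝ}
    (hψ : BoundedGenerator ψ A b) (hT : 0 < T)
    (hp : 1 ≤ p) (hq : 1 ≤ q) (hL : 0 ≤ L) (hr : 1 ≤ r)
    (hf : besovNorm φ ψ s p q f ≤ ENNReal.ofReal L) (j : ℕ) :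
    ∫⁻ x, ‖waveletProj ψ A T j f x‖ₑ ^ r ≤
      ENNReal.ofReal (sumConst A b r *
        (countConst A T * L * (2 : ℝ) ^ (-((j : ℝ) * reducedSmoothness s p r))) ^ r) := by
  have hA := hψ.width_nonneg
  have hr0 : 0 < r := by linarith
  have hκ := one_le_countConst hA hT
  have hpr : 0 < min p r := lt_min (by linarith) hr0
  have h1 := sum_rpow_le_of_sum_rpow_le (fun k => abs_nonneg (waveletCoeff ψ f j k)) hpr
    (min_le_right p r) (by positivity) (sum_abs_coeff_rpow_min_le hA hT hp hq hL hr hf j)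
  refine (hψ.lintegral_sum_atom_rpow_le j hr _ _).trans ?_
  have h3 : ∑ k ∈ indexSet A T j, ‖∫ y, f y * atom ψ j k y‖ₑ ^ r =
      ENNReal.ofReal (∑ k ∈ indexSet A T j, |waveletCoeff ψ f j k| ^ r) := by
    rw [ENNReal.ofReal_sum_of_nonneg fun _ _ => by positivity]
    refine Finset.sum_congr rfl fun k _ => ?_
    rw [Real.enorm_eq_ofReal_abs, ENNReal.ofReal_rpow_of_nonneg (abs_nonneg _) hr0.le, waveletCoeff]
  have hs := hψ.sumConst_nonneg r
  rw [h3, ← ENNReal.ofReal_mul (by positivity)]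
  apply ENNReal.ofReal_le_ofReal
  rw [mul_assoc]
  gcongr
  calc _ ≤ _ := mul_le_mul_of_nonneg_left h1 (by positivity)
    _ = _ := by
      rw [Real.mul_rpow (by positivity) (by positivity),
        Real.mul_rpow (x := countConst A T * L) (by positivity) (by positivity),
        ← Real.rpow_mul (by norm_num), ← Real.rpow_mul (by norm_num), mul_left_comm,
        ← Real.rpow_add (by norm_num)]
      congr 2
      rw [reducedSmoothness]
      push_cast
      field_simp
      ring

lemma eLpNorm_ofReal_le {f : ℝ → ℝ} {r B : ℝ} (hr : 1 ≤ r) (hB : 0 ≤ B) {μ : Measure ℝ}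
    (h : ∫⁻ x, ‖f x‖ₑ ^ r ∂μ ≤ ENNReal.ofReal (B ^ r)) :
    eLpNorm f (ENNReal.ofReal r) μ ≤ ENNReal.ofReal B := by
  have hr0 : 0 < r := by linarith
  rw [eLpNorm_eq_lintegral_rpow_enorm_toReal (by simpa using hr0) ENNReal.ofReal_ne_top,
    ENNReal.toReal_ofReal hr0.le, one_div, ENNReal.rpow_inv_le_iff hr0,
    ENNReal.ofReal_rpow_of_nonneg hB hr0.le]
  exact h

lemma lintegral_rpow_le_of_eLpNorm {f : ℝ → ℝ} {r B : ℝ} (hr : 1 ≤ r) (hB : 0 ≤ B) {μ : Measure ℝ}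
    (h : eLpNorm f (ENNReal.ofReal r) μ ≤ ENNReal.ofReal B) :
    ∫⁻ x, ‖f x‖ₑ ^ r ∂μ ≤ ENNReal.ofReal (B ^ r) := by
  have hr0 : 0 < r := by linarith
  rwa [eLpNorm_eq_lintegral_rpow_enorm_toReal (by simpa using hr0) ENNReal.ofReal_ne_top,
    ENNReal.toReal_ofReal hr0.le, one_div, ENNReal.rpow_inv_le_iff hr0,
    ENNReal.ofReal_rpow_of_nonneg hB hr0.le] at h

lemma eLpNorm_detail_le {φ ψ f : ℝ → ℝ} {A b T s p q L r : ℝ}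
    (hψ : BoundedGenerator ψ A b) (hT : 0 < T)
    (hp : 1 ≤ p) (hq : 1 ≤ q) (hL : 0 ≤ L) (hr : 1 ≤ r)
    (hf : besovNorm φ ψ s p q f ≤ ENNReal.ofReal L) (j : ℕ) :
    eLpNorm (waveletProj ψ A T j f) (ENNReal.ofReal r) volume ≤
      ENNReal.ofReal (sumConst A b r ^ (1 / r) *
        (countConst A T * L * (2 : ℝ) ^ (-((j : ℝ) * reducedSmoothness s p r)))) := by
  have hr0 : 0 < r := by linarith
  have hκ := one_le_countConst hψ.width_nonneg hT
  have hs := hψ.sumConst_nonneg r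
  refine eLpNorm_ofReal_le hr (by positivity) ?_
  rw [Real.mul_rpow (by positivity) (by positivity), ← Real.rpow_mul hs,
    one_div_mul_cancel hr0.ne', Real.rpow_one]
  exact lintegral_detail_rpow_le hψ hT hp hq hL hr hf j

/-! ### The bias of the projections in `L^r` -/

lemma sum_Ico_two_rpow_neg_le {a : ℝ} (ha : 0 < a) (J M : ℕ) :
    ∑ l ∈ Finset.Ico J M, (2 : ℝ) ^ (-((l : ℝ) * a)) ≤
      (2 : ℝ) ^ (-((J : ℝ) * a)) / (1 - (2 : ℝ) ^ (-a)) := by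
  have h0 : (2 : ℝ) ^ (-a) < 1 := Real.rpow_lt_one_of_one_lt_of_neg (by norm_num) (by linarith)
  have e : ∀ l : ℕ, (2 : ℝ) ^ (-((l : ℝ) * a)) = ((2 : ℝ) ^ (-a)) ^ l := by
    intro l
    rw [← Real.rpow_natCast, ← Real.rpow_mul (by norm_num)]
    congr 1
    ring
  simp_rw [e]
  exact geom_sum_Ico_le_of_lt_one (by positivity) h0

/-- Almost everywhere convergence along a subsequence is all that Fatou's lemma requires for the
bias; convergence in `L^r` need not be known beforehand. -/
lemma exists_subseq_waveletProj_tendsto {φ f : ℝ → ℝ} {A b T : ℝ} (hφ : GeneratesMRA φ)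
    (hφb : BoundedGenerator φ A b) (hf : Integrable f)
    (hfs : Function.support f ⊆ Set.Icc (-T) T) :
    ∃ M : ℕ → ℕ, StrictMono M ∧
      ∀ᵐ x, Tendsto (fun i => waveletProj φ A T (M i) f x) atTop (𝓝 (f x)) := by
  have h := tendsto_lintegral_sub_waveletProj hφ hφb hf hfs
  have h1 : Tendsto (fun J : ℕ => eLpNorm (waveletProj φ A T J f - f) 1 volume) atTop (𝓝 0) := by
    simpa [eLpNorm_one_eq_lintegral_enorm] using h
  have h2 := tendstoInMeasure_of_tendsto_eLpNorm one_ne_zero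
    (fun J : ℕ => (measurable_waveletProj hφb.measurable A T J f).aestronglyMeasurable) hf.1 h1
  exact h2.exists_seq_tendsto_ae

/-- The bias of the projection on level `J`. -/
lemma lintegral_sub_waveletProj_rpow_le {φ ψ f : ℝ → ℝ} {A b b' T s p q L r : ℝ}
    (hφ : GeneratesMRA φ) (hψm : IsMotherWavelet φ ψ)
    (hφb : BoundedGenerator φ A b) (hψ : BoundedGenerator ψ A b') (hT : 0 < T)
    (hp : 1 ≤ p) (hq : 1 ≤ q) (hL : 0 ≤ L) (hr : 1 ≤ r) (hσ : 0 < reducedSmoothness s p r)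
    (hint : Integrable f) (hfs : Function.support f ⊆ Set.Icc (-T) T)
    (hf : besovNorm φ ψ s p q f ≤ ENNReal.ofReal L) (J : ℕ) :
    ∫⁻ x, ‖waveletProj φ A T J f x - f x‖ₑ ^ r ≤
      ENNReal.ofReal ((sumConst A b' r ^ (1 / r) * (countConst A T * L) *
        ((2 : ℝ) ^ (-((J : ℝ) * reducedSmoothness s p r)) /
          (1 - (2 : ℝ) ^ (-reducedSmoothness s p r)))) ^ r) := by
  have hκ := one_le_countConst hψ.width_nonneg hT
  have hs := hψ.sumConst_nonneg r
  have h0 : (2 : ℝ) ^ (-reducedSmoothness s p r) < 1 :=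
    Real.rpow_lt_one_of_one_lt_of_neg (by norm_num) (by linarith)
  have h0' : 0 < 1 - (2 : ℝ) ^ (-reducedSmoothness s p r) := by linarith
  have hr1 : 1 ≤ ENNReal.ofReal r := by simpa using hr
  refine lintegral_rpow_le_of_eLpNorm hr (by positivity) ?_
  obtain ⟨M, hM, hlim⟩ := exists_subseq_waveletProj_tendsto hφ hφb hint hfs
  have hm := fun j : ℕ => (measurable_waveletProj hφb.measurable A T j f).aestronglyMeasurable (μ := volume)
  set u : ℕ → ℝ → ℝ := fun i x => waveletProj φ A T J f x - waveletProj φ A T (M i) f x with hu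
  have hum : ∀ i, AEStronglyMeasurable (u i) volume := fun i => (hm J).sub (hm (M i))
  have hulim : ∀ᵐ x, Tendsto (fun i => u i x) atTop (𝓝 (waveletProj φ A T J f x - f x)) := by
    filter_upwards [hlim] with x hx
    exact tendsto_const_nhds.sub hx
  -- By Fatou it suffices to bound the partial sums of details between `J` and `M i`, uniformly in
  -- `i`.
  refine (Lp.eLpNorm_lim_le_liminf_eLpNorm hum _ hulim).trans ?_
  refine liminf_le_of_frequently_le' (Eventually.frequently ?_)
  filter_upwards [eventually_ge_atTop J] with i hi
  have hJM : J ≤ M i := hi.trans (hM.le_apply)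
  have e : u i =ᵐ[volume] -∑ l ∈ Finset.Ico J (M i), waveletProj ψ A T l f := by
    filter_upwards [waveletProj_eq_add_sum hφ hψm hφb hψ hint hfs hJM] with x hx
    simp only [hu]
    rw [hx]
    simp
  rw [eLpNorm_congr_ae e, eLpNorm_neg]
  have hsum := eLpNorm_sum_le (μ := volume) (s := Finset.Ico J (M i))
    (f := fun l : ℕ => waveletProj ψ A T l f)
    (fun l _ => (measurable_waveletProj hψ.measurable A T l f).aestronglyMeasurable) hr1
  refine hsum.trans ?_
  refine (Finset.sum_le_sum fun l _ => eLpNorm_detail_le hψ hT hp hq hL hr hf l).trans ?_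
  rw [← ENNReal.ofReal_sum_of_nonneg fun l _ => by positivity]
  apply ENNReal.ofReal_le_ofReal
  rw [← Finset.mul_sum, ← Finset.mul_sum, ← mul_assoc]
  exact mul_le_mul_of_nonneg_left (sum_Ico_two_rpow_neg_le hσ J (M i)) (by positivity)

/-! ### The mass that a density puts on a short interval -/

lemma setLIntegral_enorm_le_of_ae_abs_le {u : ℝ → ℝ} {B v : ℝ} (hB : 0 ≤ B) {I : Set ℝ}
    (hu : ∀ᵐ x, |u x| ≤ B) (hI : volume I ≤ ENNReal.ofReal v) :
    ∫⁻ x in I, ‖u x‖ₑ ≤ ENNReal.ofReal (B * v) := by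
  calc ∫⁻ x in I, ‖u x‖ₑ ≤ ∫⁻ _ in I, ENNReal.ofReal B := by
        refine lintegral_mono_ae (ae_restrict_of_ae ?_)
        filter_upwards [hu] with x hx
        rw [Real.enorm_eq_ofReal_abs]
        exact ENNReal.ofReal_le_ofReal hx
    _ = ENNReal.ofReal B * volume I := setLIntegral_const _ _
    _ ≤ ENNReal.ofReal B * ENNReal.ofReal v := by gcongr
    _ = _ := (ENNReal.ofReal_mul hB).symm

lemma setLIntegral_enorm_le_of_eLpNorm_le {u : ℝ → ℝ} {p B v : ℝ} (hp : 1 ≤ p) (hv : 0 ≤ v)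
    (hB : 0 ≤ B) {I : Set ℝ} (hu : AEStronglyMeasurable u volume)
    (h : eLpNorm u (ENNReal.ofReal p) volume ≤ ENNReal.ofReal B)
    (hI : volume I ≤ ENNReal.ofReal v) :
    ∫⁻ x in I, ‖u x‖ₑ ≤ ENNReal.ofReal (B * v ^ (1 - 1 / p)) := by
  have hp0 : 0 < p := by linarith
  have hp1 : 0 ≤ 1 - 1 / p := sub_nonneg.2 ((div_le_one hp0).2 hp)
  have h2 := eLpNorm_le_eLpNorm_mul_rpow_measure_univ (μ := volume.restrict I)
    (p := 1) (q := ENNReal.ofReal p) (by simpa using hp) hu.restrict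
  rw [eLpNorm_one_eq_lintegral_enorm, Measure.restrict_apply_univ, ENNReal.toReal_one,
    ENNReal.toReal_ofReal hp0.le, div_one] at h2
  refine h2.trans ?_
  rw [ENNReal.ofReal_mul hB, ← ENNReal.ofReal_rpow_of_nonneg hv hp1]
  gcongr
  exact (eLpNorm_mono_measure _ Measure.restrict_le_self).trans h

lemma BoundedGenerator.abs_waveletCoeff_zero_le {φ f : ℝ → ℝ} {A b : ℝ}
    (hφ : BoundedGenerator φ A b)
    (hf0 : ∀ x, 0 ≤ f x) (hint : Integrable f) (h1 : ∫ x, f x = 1) (k : ℤ) :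
    |∫ y, f y * atom φ 0 k y| ≤ b := by
  have hb := hφ.ae_abs_atom_le 0
  simp only [Int.cast_zero, zero_div, Real.rpow_zero, one_mul] at hb
  calc |∫ y, f y * atom φ 0 k y| ≤ ∫ y, |f y * atom φ 0 k y| := abs_integral_le_integral_abs
    _ ≤ ∫ y, f y * b := by
        refine integral_mono_ae (hφ.integrable_mul_atom hint 0 k).abs (hint.mul_const b) ?_
        filter_upwards [hb] with x hx
        rw [abs_mul, abs_of_nonneg (hf0 x)]
        exact mul_le_mul_of_nonneg_left (hx k) (hf0 x)
    _ = b := by rw [integral_mul_const, h1, one_mul]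

/-- A bound for `sumConst A b p ^ (1 / p)` that does not depend on `p`. -/
lemma sumConst_rpow_le {A b p : ℝ} (hA : 0 ≤ A) (hb : 0 ≤ b) (hp : 1 ≤ p) :
    sumConst A b p ^ (1 / p) ≤ multiplicity A * (2 * A + 1) * b := by
  have hp0 : 0 < p := by linarith
  have hm : (1 : ℝ) ≤ multiplicity A := by exact_mod_cast multiplicity_pos A
  rw [one_div, Real.rpow_inv_le_iff_of_pos (by unfold sumConst; positivity) (by positivity) hp0,
    Real.mul_rpow (by positivity) hb, Real.mul_rpow (by positivity) (by positivity), sumConst,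
    ← mul_assoc]
  gcongr
  · linarith
  · calc 2 * A ≤ 2 * A + 1 := by linarith
      _ = (2 * A + 1) ^ (1 : ℝ) := (Real.rpow_one _).symm
      _ ≤ (2 * A + 1) ^ p := Real.rpow_le_rpow_of_exponent_le (by linarith) hp

variable {φ ψ : ℝ → ℝ} {A b b' T : ℝ}

/-- Since `s > 1/p`, the detail of each level is bounded by a constant. There is no uniform decay in
`l`, because `s - 1/p` may be arbitrarily small. -/
lemma setLIntegral_detail_low_le {f : ℝ → ℝ} {s p q L : ℝ} (hψ : BoundedGenerator ψ A b')
    (hp : 1 ≤ p) (hq : 1 ≤ q) (hs : 1 / p < s) (hL : 0 ≤ L)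
    (hf : besovNorm φ ψ s p q f ≤ ENNReal.ofReal L) (l : ℕ) {I : Set ℝ} {v : ℝ}
    (hI : volume I ≤ ENNReal.ofReal v) :
    ∫⁻ x in I, ‖waveletProj ψ A T l f x‖ₑ ≤ ENNReal.ofReal (multiplicity A * b' * L * v) := by
  have hb := hψ.bound_nonneg
  refine setLIntegral_enorm_le_of_ae_abs_le (by positivity) ?_ hI
  have h := hψ.ae_abs_sum_atom_le l (indexSet A T l) (fun k => ∫ y, f y * atom ψ l k y)
    (B := L * (2 : ℝ) ^ (-((l : ℝ) * (s + 1 / 2 - 1 / p)))) (by positivity)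
    (fun k _ => abs_coeff_le hp hq hL hf l k)
  filter_upwards [h] with x hx
  refine hx.trans ?_
  rw [mul_assoc _ _ L]
  have : (2 : ℝ) ^ (-((l : ℝ) * (s + 1 / 2 - 1 / p))) * (2 : ℝ) ^ (((l : ℤ) : ℝ) / 2) ≤ 1 := by
    rw [← Real.rpow_add (by norm_num)]
    apply Real.rpow_le_one_of_one_le_of_nonpos (by norm_num)
    push_cast
    have : 0 ≤ (l : ℝ) * (s - 1 / p) := mul_nonneg (Nat.cast_nonneg _) (by linarith)
    linarith
  calc _ = multiplicity A * b' * L * ((2 : ℝ) ^ (-((l : ℝ) * (s + 1 / 2 - 1 / p))) *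
        (2 : ℝ) ^ (((l : ℤ) : ℝ) / 2)) := by ring
    _ ≤ multiplicity A * b' * L * 1 := by gcongr
    _ = _ := by ring

/-- At levels finer than the interval, the `L^p` norm of the detail is used with Hölder's
inequality. It yields a geometric decay in `l - j` of rate `ε`, which the sup bound cannot give
uniformly. -/
lemma setLIntegral_detail_high_le {f : ℝ → ℝ} {s p q L ε : ℝ} (hψ : BoundedGenerator ψ A b')
    (hT : 0 < T) (hp : 1 ≤ p) (hq : 1 ≤ q) (hs : 1 / p < s) (hε : ε ≤ s) (hL : 0 ≤ L)
    (hf : besovNorm φ ψ s p q f ≤ ENNReal.ofReal L) {j l : ℕ} (hjl : j ≤ l) {I : Set ℝ}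
    (hI : volume I ≤ ENNReal.ofReal (2 * A * (2 : ℝ) ^ (-(j : ℝ)))) :
    ∫⁻ x in I, ‖waveletProj ψ A T l f x‖ₑ ≤
      ENNReal.ofReal (multiplicity A * (2 * A + 1) * b' * (countConst A T * L) * (2 * A + 1) *
        (2 : ℝ) ^ (-(j : ℝ)) * ((2 : ℝ) ^ ((j : ℝ) * ε) * (2 : ℝ) ^ (-((l : ℝ) * ε)))) := by
  have hb := hψ.bound_nonneg
  have hA := hψ.width_nonneg
  have hκ := one_le_countConst hA hT
  have hp0 : 0 < p := by linarith
  have hp1 : 0 ≤ 1 - 1 / p := sub_nonneg.2 ((div_le_one hp0).2 hp)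
  have hip : 0 < 1 / p := by positivity
  -- The integrability index is taken equal to `p`, so that the full smoothness `s` is kept.
  have h := eLpNorm_detail_le hψ hT hp hq hL hp hf l
  have hsum := hψ.sumConst_nonneg p
  refine (setLIntegral_enorm_le_of_eLpNorm_le hp (by positivity) (by positivity)
    (measurable_waveletProj hψ.measurable A T l f).aestronglyMeasurable h hI).trans ?_
  apply ENNReal.ofReal_le_ofReal
  have e1 : reducedSmoothness s p p = s := by simp [reducedSmoothness]
  rw [e1, Real.mul_rpow (by positivity) (by positivity), ← Real.rpow_mul (by norm_num)]
  have h1 : (2 * A) ^ (1 - 1 / p) ≤ 2 * A + 1 := by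
    calc (2 * A) ^ (1 - 1 / p) ≤ (2 * A + 1) ^ (1 - 1 / p) := by gcongr; linarith
      _ ≤ (2 * A + 1) ^ (1 : ℝ) :=
          Real.rpow_le_rpow_of_exponent_le (by linarith) (by linarith)
      _ = _ := Real.rpow_one _
  have h2 : (2 : ℝ) ^ (-((l : ℝ) * s)) * (2 : ℝ) ^ (-(j : ℝ) * (1 - 1 / p)) ≤
      (2 : ℝ) ^ (-(j : ℝ)) * ((2 : ℝ) ^ ((j : ℝ) * ε) * (2 : ℝ) ^ (-((l : ℝ) * ε))) := by
    rw [← Real.rpow_add (by norm_num), ← Real.rpow_add (by norm_num),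
      ← Real.rpow_add (by norm_num)]
    apply Real.rpow_le_rpow_of_exponent_le (by norm_num)
    have hjl' : (j : ℝ) ≤ l := by exact_mod_cast hjl
    have hj0 : (0 : ℝ) ≤ j := Nat.cast_nonneg j
    -- The identity behind it is `l s - j/p = (l - j) s + j (s - 1/p)`, with `s ≥ ε` in the first
    -- term and `s > 1/p` in the second.
    nlinarith [mul_nonneg (sub_nonneg.2 hjl') (sub_nonneg.2 hε),
      mul_nonneg hj0 (sub_nonneg.2 hs.le)]
  calc sumConst A b' p ^ (1 / p) * (countConst A T * L * (2 : ℝ) ^ (-((l : ℝ) * s))) *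
        ((2 * A) ^ (1 - 1 / p) * (2 : ℝ) ^ (-(j : ℝ) * (1 - 1 / p)))
      = sumConst A b' p ^ (1 / p) * (countConst A T * L) * (2 * A) ^ (1 - 1 / p) *
        ((2 : ℝ) ^ (-((l : ℝ) * s)) * (2 : ℝ) ^ (-(j : ℝ) * (1 - 1 / p))) := by ring
    _ ≤ (multiplicity A * (2 * A + 1) * b') * (countConst A T * L) * (2 * A + 1) *
        ((2 : ℝ) ^ (-(j : ℝ)) * ((2 : ℝ) ^ ((j : ℝ) * ε) * (2 : ℝ) ^ (-((l : ℝ) * ε)))) := by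
        gcongr
        exact sumConst_rpow_le hA hb hp
    _ = _ := by ring

/-- The constant in the bound for the mass of an interval of length comparable to `2^{-j}`. -/
noncomputable def massConst (A b b' T L ε : ℝ) : ℝ :=
  multiplicity A * b * b * (2 * A) + multiplicity A * b' * L * (2 * A) +
    multiplicity A * (2 * A + 1) * b' * (countConst A T * L) * (2 * A + 1) /
      (1 - (2 : ℝ) ^ (-ε))

/-- The coarse part and each of the `j` details below level `j` have mass `O(2^{-j})` on the
interval, and the finer details add up to a geometric series. The factor `1 + j` is the price for
uniformity as `s` tends to `1/p`. -/
lemma setLIntegral_density_le {f : ℝ → ℝ} {s p q L ε : ℝ} (hφM : GeneratesMRA φ)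
    (hψM : IsMotherWavelet φ ψ) (hφ : BoundedGenerator φ A b) (hψ : BoundedGenerator ψ A b')
    (hT : 0 < T) (hp : 1 ≤ p) (hq : 1 ≤ q) (hs : 1 / p < s) (hε0 : 0 < ε) (hε : ε ≤ s)
    (hL : 0 ≤ L) (hf : f ∈ densityClass φ ψ s p q L T) (j : ℕ) {I : Set ℝ}
    (hI : volume I ≤ ENNReal.ofReal (2 * A * (2 : ℝ) ^ (-(j : ℝ)))) :
    ∫⁻ x in I, ‖f x‖ₑ ≤
      ENNReal.ofReal (massConst A b b' T L ε * (1 + j) * (2 : ℝ) ^ (-(j : ℝ))) := by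
  obtain ⟨hf0, hint, hone, hfs, hbes⟩ := hf
  have hb := hφ.bound_nonneg
  have hb' := hψ.bound_nonneg
  have hA := hψ.width_nonneg
  have hκ := one_le_countConst hA hT
  have h2ε : (2 : ℝ) ^ (-ε) < 1 :=
    Real.rpow_lt_one_of_one_lt_of_neg (by norm_num) (by linarith)
  have h2ε' : 0 < 1 - (2 : ℝ) ^ (-ε) := by linarith
  set w := (2 : ℝ) ^ (-(j : ℝ)) with hw
  have hw0 : 0 < w := by positivity
  have hlim := tendsto_lintegral_sub_waveletProj hφM hφ hint hfs
  set K := multiplicity A * (2 * A + 1) * b' * (countConst A T * L) * (2 * A + 1) with hK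
  have hK0 : 0 ≤ K := by positivity
  have hmain : ∀ M : ℕ, j ≤ M → ∫⁻ x in I, ‖f x‖ₑ ≤
      ENNReal.ofReal (massConst A b b' T L ε * (1 + j) * w) +
        ∫⁻ x, ‖waveletProj φ A T M f x - f x‖ₑ := by
    intro M hM
    have hmP : AEMeasurable (fun x => ‖waveletProj φ A T (0 : ℕ) f x‖ₑ) (volume.restrict I) :=
      (measurable_waveletProj hφ.measurable A T _ f).enorm.aemeasurable
    have hmD : ∀ l : ℕ, AEMeasurable (fun x => ‖waveletProj ψ A T l f x‖ₑ) (volume.restrict I) :=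
      fun l => (measurable_waveletProj hψ.measurable A T _ f).enorm.aemeasurable
    have hle : ∀ᵐ x, ‖f x‖ₑ ≤ (‖waveletProj φ A T (0 : ℕ) f x‖ₑ +
        (∑ l ∈ Finset.Ico 0 j, ‖waveletProj ψ A T l f x‖ₑ +
          ∑ l ∈ Finset.Ico j M, ‖waveletProj ψ A T l f x‖ₑ)) +
        ‖waveletProj φ A T M f x - f x‖ₑ := by
      filter_upwards [waveletProj_eq_add_sum hφM hψM hφ hψ hint hfs (Nat.zero_le M)] with x hx
      rw [Finset.sum_Ico_consecutive _ (Nat.zero_le j) hM]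
      have : f x = waveletProj φ A T M f x - (waveletProj φ A T M f x - f x) := by ring
      rw [this]
      refine enorm_sub_le.trans ?_
      rw [sub_sub_cancel]
      gcongr
      rw [hx]
      refine (enorm_add_le _ _).trans ?_
      gcongr
      exact enorm_sum_le _ _
    refine (lintegral_mono_ae (ae_restrict_of_ae hle)).trans ?_
    have hmS : AEMeasurable (fun x => ‖waveletProj φ A T (0 : ℕ) f x‖ₑ +
        (∑ l ∈ Finset.Ico 0 j, ‖waveletProj ψ A T l f x‖ₑ +
          ∑ l ∈ Finset.Ico j M, ‖waveletProj ψ A T l f x‖ₑ)) (volume.restrict I) :=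
      hmP.add ((Finset.aemeasurable_fun_sum _ fun l _ => hmD l).add
        (Finset.aemeasurable_fun_sum _ fun l _ => hmD l))
    rw [lintegral_add_left' hmS]
    refine add_le_add ?_ (setLIntegral_le_lintegral _ _)
    rw [lintegral_add_left' hmP, lintegral_add_left' (Finset.aemeasurable_fun_sum _ fun l _ => hmD l),
      lintegral_finsetSum' _ fun l _ => hmD l, lintegral_finsetSum' _ fun l _ => hmD l]
    have t1 : ∫⁻ x in I, ‖waveletProj φ A T (0 : ℕ) f x‖ₑ ≤
        ENNReal.ofReal (multiplicity A * b * b * (2 * A * w)) := by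
      refine setLIntegral_enorm_le_of_ae_abs_le (by positivity) ?_ hI
      have h := hφ.ae_abs_sum_atom_le (0 : ℕ) (indexSet A T (0 : ℕ))
        (fun k => ∫ y, f y * atom φ (0 : ℕ) k y) (B := b) hb
        (fun k _ => hφ.abs_waveletCoeff_zero_le hf0 hint hone k)
      filter_upwards [h] with x hx
      refine hx.trans (le_of_eq ?_)
      simp
    have t2 : ∑ l ∈ Finset.Ico 0 j, ∫⁻ x in I, ‖waveletProj ψ A T l f x‖ₑ ≤
        ENNReal.ofReal (j * (multiplicity A * b' * L * (2 * A * w))) := by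
      refine (Finset.sum_le_sum fun l _ =>
        setLIntegral_detail_low_le hψ hp hq hs hL hbes l hI).trans (le_of_eq ?_)
      rw [Finset.sum_const, Nat.card_Ico, Nat.sub_zero, nsmul_eq_mul,
        ENNReal.ofReal_mul (Nat.cast_nonneg j), ENNReal.ofReal_natCast]
    have t3 : ∑ l ∈ Finset.Ico j M, ∫⁻ x in I, ‖waveletProj ψ A T l f x‖ₑ ≤
        ENNReal.ofReal (K * w / (1 - (2 : ℝ) ^ (-ε))) := by
      refine (Finset.sum_le_sum fun l hl => setLIntegral_detail_high_le hψ hT hp hq hs hε hL hbes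
        (Finset.mem_Ico.1 hl).1 hI).trans ?_
      rw [← ENNReal.ofReal_sum_of_nonneg fun l _ => by positivity]
      apply ENNReal.ofReal_le_ofReal
      rw [← Finset.mul_sum, ← Finset.mul_sum]
      have h3 := sum_Ico_two_rpow_neg_le hε0 j M
      have h4 : (2 : ℝ) ^ ((j : ℝ) * ε) * (2 : ℝ) ^ (-((j : ℝ) * ε)) = 1 := by
        rw [← Real.rpow_add (by norm_num), add_neg_cancel, Real.rpow_zero]
      calc _ ≤ K * w * ((2 : ℝ) ^ ((j : ℝ) * ε) *
            ((2 : ℝ) ^ (-((j : ℝ) * ε)) / (1 - (2 : ℝ) ^ (-ε)))) := by gcongr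
        _ = _ := by rw [← mul_div_assoc, h4, mul_one_div]
    refine (add_le_add t1 (add_le_add t2 t3)).trans ?_
    rw [← ENNReal.ofReal_add (by positivity) (by positivity),
      ← ENNReal.ofReal_add (by positivity) (by positivity)]
    apply ENNReal.ofReal_le_ofReal
    rw [massConst, ← hK]
    have hj : (0 : ℝ) ≤ j := Nat.cast_nonneg j
    have a1 : 0 ≤ multiplicity A * b * b * (2 * A) * w * j := by positivity
    have a2 : 0 ≤ multiplicity A * b' * L * (2 * A) * w := by positivity
    have a3 : 0 ≤ K / (1 - (2 : ℝ) ^ (-ε)) * w * j := by positivity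
    have e : K * w / (1 - (2 : ℝ) ^ (-ε)) = K / (1 - (2 : ℝ) ^ (-ε)) * w := by ring
    rw [e]
    linarith
  have hlim2 := hlim.const_add (ENNReal.ofReal (massConst A b b' T L ε * (1 + j) * w))
  rw [add_zero] at hlim2
  -- The `L¹` remainder of the projection on level `M` disappears as `M` tends to infinity.
  exact ge_of_tendsto hlim2 ((eventually_ge_atTop j).mono hmain)

lemma massConst_mono {A b b' T L L' ε : ℝ} (hA : 0 ≤ A) (hT : 0 < T) (hb' : 0 ≤ b')
    (hε : 0 < ε) (hLL : L ≤ L') : massConst A b b' T L ε ≤ massConst A b b' T L' ε := by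
  have h2ε : (2 : ℝ) ^ (-ε) < 1 :=
    Real.rpow_lt_one_of_one_lt_of_neg (by norm_num) (by linarith)
  have h2ε' : 0 < 1 - (2 : ℝ) ^ (-ε) := by linarith
  have hκ := one_le_countConst hA hT
  unfold massConst
  gcongr

/-- The second moment of an atom under a density of the class. -/
lemma lintegral_density_mul_atom_sq_le {f g : ℝ → ℝ} {s p q L ε bg : ℝ} (hφM : GeneratesMRA φ)
    (hψM : IsMotherWavelet φ ψ) (hφ : BoundedGenerator φ A b) (hψ : BoundedGenerator ψ A b')
    (hg : BoundedGenerator g A bg)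
    (hT : 0 < T) (hp : 1 ≤ p) (hq : 1 ≤ q) (hs : 1 / p < s) (hε0 : 0 < ε) (hε : ε ≤ s)
    (hL : 0 ≤ L) (hf : f ∈ densityClass φ ψ s p q L T) (j : ℕ) (k : ℤ) :
    ∫ x, f x * atom g j k x ^ 2 ≤ bg ^ 2 * massConst A b b' T L ε * (1 + j) := by
  have hmass := setLIntegral_density_le hφM hψM hφ hψ hT hp hq hs hε0 hε hL hf j
    (I := atomInterval A j k) (volume_atomInterval A j k).le
  obtain ⟨hf0, hint, -, -, -⟩ := hf
  have hbg := hg.bound_nonneg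
  have hA := hg.width_nonneg
  have hκ := one_le_countConst hA hT
  have hb' := hψ.bound_nonneg
  have hb := hφ.bound_nonneg
  have h2ε : (2 : ℝ) ^ (-ε) < 1 :=
    Real.rpow_lt_one_of_one_lt_of_neg (by norm_num) (by linarith)
  have h2ε' : 0 < 1 - (2 : ℝ) ^ (-ε) := by linarith
  have hmc : 0 ≤ massConst A b b' T L ε := by unfold massConst; positivity
  have hI : MeasurableSet (atomInterval A j k) := measurableSet_Icc
  have h1 : ∫ x in atomInterval A j k, f x ≤
      massConst A b b' T L ε * (1 + j) * (2 : ℝ) ^ (-(j : ℝ)) := by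
    rw [integral_eq_lintegral_of_nonneg_ae (Eventually.of_forall hf0) hint.1.restrict]
    refine ENNReal.toReal_le_of_le_ofReal (by positivity) (le_trans (le_of_eq ?_) hmass)
    congr 1 with x
    rw [Real.enorm_eq_ofReal (hf0 x)]
  calc ∫ x, f x * atom g j k x ^ 2
      ≤ ∫ x, (atomInterval A j k).indicator f x * ((2 : ℝ) ^ (j : ℝ) * bg ^ 2) := by
        have hb2 := hg.ae_abs_atom_le j
        have hsq : ∀ᵐ x, atom g j k x ^ 2 ≤ (2 : ℝ) ^ (j : ℝ) * bg ^ 2 := by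
          filter_upwards [hb2] with x hx
          rw [← sq_abs]
          calc |atom g j k x| ^ 2 ≤ ((2 : ℝ) ^ (((j : ℤ) : ℝ) / 2) * bg) ^ 2 :=
                pow_le_pow_left₀ (abs_nonneg _) (hx k) 2
            _ = _ := by
              rw [mul_pow, ← Real.rpow_natCast, ← Real.rpow_mul (by norm_num)]
              congr 2
              push_cast
              ring
        refine integral_mono_ae ?_ ((hint.indicator hI).mul_const _) ?_
        · refine hint.mul_bdd (c := (2 : ℝ) ^ (j : ℝ) * bg ^ 2)
            ((measurable_atom hg.measurable j k).pow_const 2).aestronglyMeasurable ?_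
          filter_upwards [hsq] with x hx
          rwa [Real.norm_eq_abs, abs_of_nonneg (sq_nonneg _)]
        · filter_upwards [hsq] with x hx
          by_cases hxI : x ∈ atomInterval A j k
          · simp only [Set.indicator_of_mem hxI]
            exact mul_le_mul_of_nonneg_left hx (hf0 x)
          · simp [Set.indicator_of_notMem hxI, hg.atom_eq_zero_of_notMem hxI]
    _ = (∫ x in atomInterval A j k, f x) * ((2 : ℝ) ^ (j : ℝ) * bg ^ 2) := by
        rw [integral_mul_const, integral_indicator hI]
    _ ≤ massConst A b b' T L ε * (1 + j) * (2 : ℝ) ^ (-(j : ℝ)) *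
          ((2 : ℝ) ^ (j : ℝ) * bg ^ 2) := by gcongr
    _ = _ := by
        have : (2 : ℝ) ^ (-(j : ℝ)) * (2 : ℝ) ^ (j : ℝ) = 1 := by
          rw [← Real.rpow_add (by norm_num), neg_add_cancel, Real.rpow_zero]
        linear_combination (massConst A b b' T L ε * (1 + j) * bg ^ 2) * this

/-! ### Integrals against a law with a density -/

lemma law_ae {f : ℝ → ℝ} {p : ℝ → Prop} (h : ∀ᵐ x, p x) : ∀ᵐ x ∂(law f), p x :=
  (withDensity_absolutelyContinuous _ _).ae_le h

lemma integral_law {f : ℝ → ℝ} (hf0 : ∀ x, 0 ≤ f x) (hf : Integrable f) (g : ℝ → ℝ) :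
    ∫ x, g x ∂(law f) = ∫ x, f x * g x := by
  rw [law, integral_withDensity_eq_integral_toReal_smul₀ hf.1.aemeasurable.ennreal_ofReal
    (Eventually.of_forall fun _ => ENNReal.ofReal_lt_top)]
  congr 1 with x
  rw [ENNReal.toReal_ofReal (hf0 x), smul_eq_mul]

lemma integrable_law_iff {f : ℝ → ℝ} (hf0 : ∀ x, 0 ≤ f x) (hf : Integrable f) (g : ℝ → ℝ) :
    Integrable g (law f) ↔ Integrable fun x => f x * g x := by
  rw [law, integrable_withDensity_iff_integrable_smul₀' hf.1.aemeasurable.ennreal_ofReal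
    (Eventually.of_forall fun _ => ENNReal.ofReal_lt_top)]
  refine integrable_congr (Eventually.of_forall fun x => ?_)
  simp only [ENNReal.toReal_ofReal (hf0 x), smul_eq_mul]

lemma isProbabilityMeasure_law {f : ℝ → ℝ} (hf0 : ∀ x, 0 ≤ f x) (hf : Integrable f)
    (h1 : ∫ x, f x = 1) : IsProbabilityMeasure (law f) := by
  constructor
  rw [law, withDensity_apply _ MeasurableSet.univ, Measure.restrict_univ,
    ← ofReal_integral_eq_lintegral_ofReal hf (Eventually.of_forall hf0), h1, ENNReal.ofReal_one]

/-! ### Exponential moments of the noise -/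

lemma integrable_laplaceDensity : Integrable fun x : ℝ => 1 / 2 * Real.exp (-|x|) := by
  have h1 : ∫ x : ℝ, 1 / 2 * Real.exp (-|x|) = 1 := by
    rw [integral_const_mul, integral_comp_abs (f := fun x => Real.exp (-x)),
      integral_exp_neg_Ioi_zero]
    norm_num
  exact integrable_of_integral_eq_one h1

lemma laplace_exp {θ : ℝ} (hθ : |θ| < 1) :
    Integrable (fun x => Real.exp (θ * x)) laplace ∧
      ∫ x, Real.exp (θ * x) ∂laplace = 1 / (1 - θ ^ 2) := by
  obtain ⟨hθ1, hθ2⟩ := abs_lt.1 hθ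
  have h0 : ∀ x : ℝ, 0 ≤ 1 / 2 * Real.exp (-|x|) := fun x => by positivity
  have e1 : ∀ x ∈ Set.Iic (0 : ℝ), 1 / 2 * Real.exp ((1 + θ) * x) =
      1 / 2 * Real.exp (-|x|) * Real.exp (θ * x) := by
    intro x hx
    rw [abs_of_nonpos hx, mul_assoc, ← Real.exp_add]
    congr 2
    ring
  have e2 : ∀ x ∈ Set.Ioi (0 : ℝ), 1 / 2 * Real.exp ((θ - 1) * x) =
      1 / 2 * Real.exp (-|x|) * Real.exp (θ * x) := by
    intro x hx
    rw [abs_of_pos hx, mul_assoc, ← Real.exp_add]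
    congr 2
    ring
  have i1 : IntegrableOn (fun x => 1 / 2 * Real.exp (-|x|) * Real.exp (θ * x)) (Set.Iic 0) :=
    IntegrableOn.congr_fun (f := fun x => 1 / 2 * Real.exp ((1 + θ) * x))
      ((integrableOn_exp_mul_Iic (a := 1 + θ) (by linarith) 0).const_mul (1 / 2)) e1
      measurableSet_Iic
  have i2 : IntegrableOn (fun x => 1 / 2 * Real.exp (-|x|) * Real.exp (θ * x)) (Set.Ioi 0) :=
    IntegrableOn.congr_fun (f := fun x => 1 / 2 * Real.exp ((θ - 1) * x))
      ((integrableOn_exp_mul_Ioi (a := θ - 1) (by linarith) 0).const_mul (1 / 2)) e2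
      measurableSet_Ioi
  have hi : Integrable fun x => 1 / 2 * Real.exp (-|x|) * Real.exp (θ * x) := by
    rw [← integrableOn_univ, ← Set.Iic_union_Ioi (a := (0 : ℝ))]
    exact i1.union i2
  rw [laplace]
  refine ⟨(integrable_law_iff h0 integrable_laplaceDensity _).2 hi, ?_⟩
  rw [integral_law h0 integrable_laplaceDensity,
    ← intervalIntegral.integral_Iic_add_Ioi i1 i2, ← setIntegral_congr_fun measurableSet_Iic e1,
    ← setIntegral_congr_fun measurableSet_Ioi e2, integral_const_mul, integral_const_mul,
    integral_exp_mul_Iic (by linarith), integral_exp_mul_Ioi (by linarith)]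
  have a1 : 1 + θ ≠ 0 := by linarith
  have a2 : θ - 1 ≠ 0 := by linarith
  have a3 : 1 - θ ^ 2 ≠ 0 := by nlinarith
  simp only [mul_zero, Real.exp_zero]
  field_simp
  ring

/-- Used with `x = θ²`, it compares the Laplace exponential moment `1/(1 - θ²)` with a Gaussian one.
The constants `1/10` and `10/9` of the later bounds come from `1/(1 - x) ≤ 10/9`. -/
lemma one_div_one_sub_le_exp {x : ℝ} (hx0 : 0 ≤ x) (hx : x ≤ 1 / 10) :
    1 / (1 - x) ≤ Real.exp (10 / 9 * x) := by
  have h : 1 / (1 - x) = 1 + x / (1 - x) := by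
    field_simp [show (1 : ℝ) - x ≠ 0 by linarith]
    ring
  have h2 : x / (1 - x) ≤ 10 / 9 * x := by
    rw [div_le_iff₀ (by linarith)]
    nlinarith
  rw [h]
  linarith [Real.add_one_le_exp (10 / 9 * x)]

lemma noise_exp {θ : ℝ} (hθ : θ ^ 2 ≤ 1 / 10) (i : ℤ × ℤ) :
    Integrable (fun w : ℤ × ℤ → ℝ => Real.exp (θ * w i)) noise ∧
      ∫ w, Real.exp (θ * w i) ∂noise ≤ Real.exp (10 / 9 * θ ^ 2) := by
  have hθ1 : |θ| < 1 := by
    rw [← sq_lt_one_iff_abs_lt_one]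
    linarith
  obtain ⟨h1, h2⟩ := laplace_exp hθ1
  have hmp : MeasurePreserving (Function.eval i) noise laplace :=
    measurePreserving_eval_infinitePi (fun _ => laplace) i
  refine ⟨(hmp.integrable_comp h1.1).2 h1, ?_⟩
  have h3 : ∫ w, Real.exp (θ * w i) ∂noise = ∫ x, Real.exp (θ * x) ∂laplace := by
    rw [← hmp.map_eq, integral_map hmp.measurable.aemeasurable (by
      rw [hmp.map_eq]; exact h1.1)]
  rw [h3, h2]
  exact one_div_one_sub_le_exp (sq_nonneg θ) hθ

/-! ### Exponential moments of a bounded variable -/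

section Bounded

variable {Ω : Type*} [MeasurableSpace Ω] {μ : Measure Ω} [IsProbabilityMeasure μ]

/-- Bernstein's argument: as long as `|θ (X - m)| ≤ 1` the exponential is dominated by a quadratic
polynomial, so the moment is governed by the second moment `v` and not by the sup bound `G`. -/
lemma integral_exp_centered_le {X : Ω → ℝ} (hX : AEStronglyMeasurable X μ) {G v θ : ℝ}
    (hG : ∀ᵐ z ∂μ, |X z| ≤ G) (hv : ∫ z, X z ^ 2 ∂μ ≤ v) (hθ : |θ| * (2 * G) ≤ 1) :
    Integrable (fun z => Real.exp (θ * (X z - ∫ z, X z ∂μ))) μ ∧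
      ∫ z, Real.exp (θ * (X z - ∫ z, X z ∂μ)) ∂μ ≤ Real.exp (θ ^ 2 * v) := by
  set m := ∫ z, X z ∂μ with hm
  have hXi : Integrable X μ := Integrable.of_bound hX G hG
  have hX2 : Integrable (fun z => X z ^ 2) μ := by
    refine Integrable.of_bound (hX.pow 2) (G ^ 2) ?_
    filter_upwards [hG] with z h
    rw [Real.norm_eq_abs, abs_pow]
    exact pow_le_pow_left₀ (abs_nonneg _) h 2
  have hmG : |m| ≤ G := by
    have h1 : |m| ≤ ∫ z, |X z| ∂μ := abs_integral_le_integral_abs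
    have h2 : ∫ z, |X z| ∂μ ≤ ∫ _, G ∂μ := integral_mono_ae hXi.abs (integrable_const G) hG
    simpa using h1.trans h2
  have hb : ∀ᵐ z ∂μ, |θ * (X z - m)| ≤ 1 := by
    filter_upwards [hG] with z h
    rw [abs_mul]
    refine le_trans ?_ hθ
    gcongr
    calc |X z - m| ≤ |X z| + |m| := abs_sub _ _
      _ ≤ 2 * G := by linarith
  have hY : AEStronglyMeasurable (fun z => Real.exp (θ * (X z - m))) μ :=
    Real.continuous_exp.comp_aestronglyMeasurable
      ((hX.sub aestronglyMeasurable_const).const_mul θ)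
  have hYi : Integrable (fun z => Real.exp (θ * (X z - m))) μ := by
    refine Integrable.of_bound hY (Real.exp 1) ?_
    filter_upwards [hb] with z h
    rw [Real.norm_eq_abs, Real.abs_exp]
    exact Real.exp_le_exp.2 ((le_abs_self _).trans h)
  refine ⟨hYi, ?_⟩
  have h1 : ∀ᵐ z ∂μ, Real.exp (θ * (X z - m)) ≤
      (1 - θ * m + θ ^ 2 * m ^ 2) + (θ - 2 * θ ^ 2 * m) * X z + θ ^ 2 * X z ^ 2 := by
    filter_upwards [hb] with z h
    -- This is `exp u ≤ 1 + u + u²` for `|u| ≤ 1`, rearranged in powers of `X`.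
    have := (abs_le.1 (Real.abs_exp_sub_one_sub_id_le h)).2
    nlinarith
  have hr : Integrable (fun z => (1 - θ * m + θ ^ 2 * m ^ 2) + (θ - 2 * θ ^ 2 * m) * X z +
      θ ^ 2 * X z ^ 2) μ :=
    ((integrable_const _).add (hXi.const_mul _)).add (hX2.const_mul _)
  refine (integral_mono_ae hYi hr h1).trans ?_
  rw [integral_add (f := fun z => (1 - θ * m + θ ^ 2 * m ^ 2) + (θ - 2 * θ ^ 2 * m) * X z)
    ((integrable_const _).add (hXi.const_mul _)) (hX2.const_mul _),
    integral_add (integrable_const _) (hXi.const_mul _), integral_const_mul, integral_const_mul,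
    ← hm]
  simp only [integral_const, probReal_univ, one_smul]
  have h2 := Real.add_one_le_exp (θ ^ 2 * v)
  nlinarith [mul_le_mul_of_nonneg_left hv (sq_nonneg θ), mul_nonneg (sq_nonneg θ) (sq_nonneg m)]

end Bounded

/-! ### The empirical mean of privatized coefficients -/

/-- The error of the mean of `n` independent privatized observations of `g`, centred at `β`. -/
noncomputable def meanError {n : ℕ} (g : ℝ → ℝ) (c : ℝ) (i : ℤ × ℤ) (β : ℝ)
    (y : Fin n → ℝ × (ℤ × ℤ → ℝ)) : ℝ :=
  1 / (n : ℝ) * ∑ l, (g (y l).1 + c * (y l).2 i) - β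

lemma measurable_meanError {n : ℕ} {g : ℝ → ℝ} (hg : Measurable g) (c : ℝ) (i : ℤ × ℤ) (β : ℝ) :
    Measurable (meanError (n := n) g c i β) := by
  unfold meanError
  fun_prop

instance : IsProbabilityMeasure noise := by
  unfold noise
  infer_instance

section MeanError

variable {μ : Measure ℝ} [IsProbabilityMeasure μ] {g : ℝ → ℝ} {G v c : ℝ} {n : ℕ}

/-- Independence factorises the exponential over the data holders, and each factor into data and
noise. With `θ = t/n`, the two conditions on `t` are those of the one-variable bounds. -/
lemma lintegral_exp_meanError_le (hg : Measurable g) (hG : ∀ᵐ x ∂μ, |g x| ≤ G)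
    (hv : ∫ x, g x ^ 2 ∂μ ≤ v) (hn : 0 < n) (i : ℤ × ℤ) {t : ℝ}
    (h1 : |t| * (2 * G) ≤ n) (h2 : (t * c / n) ^ 2 ≤ 1 / 10) :
    ∫⁻ y, ENNReal.ofReal (Real.exp (t * meanError g c i (∫ x, g x ∂μ) y))
        ∂(Measure.pi fun _ : Fin n => μ.prod noise) ≤
      ENNReal.ofReal (Real.exp (t ^ 2 / n * (v + 10 / 9 * c ^ 2))) := by
  have hn' : (0 : ℝ) < n := by exact_mod_cast hn
  set m := ∫ x, g x ∂μ with hm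
  set θ := t / n with hθ
  have h1' : |θ| * (2 * G) ≤ 1 := by
    rw [hθ, abs_div, Nat.abs_cast, div_mul_eq_mul_div, div_le_one hn']
    exact h1
  have h2' : (θ * c) ^ 2 ≤ 1 / 10 := by
    rw [hθ, div_mul_eq_mul_div]
    exact h2
  obtain ⟨a1, a2⟩ := integral_exp_centered_le hg.aestronglyMeasurable hG hv h1'
  obtain ⟨b1, b2⟩ := noise_exp h2' i
  set F : ℝ × (ℤ × ℤ → ℝ) → ℝ := fun z =>
    Real.exp (θ * (g z.1 - m)) * Real.exp (θ * c * z.2 i) with hF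
  have e : ∀ y : Fin n → ℝ × (ℤ × ℤ → ℝ),
      Real.exp (t * meanError g c i m y) = ∏ l, F (y l) := by
    intro y
    simp only [hF, ← Real.exp_add]
    rw [← Real.exp_sum]
    congr 1
    rw [meanError, Finset.sum_add_distrib, Finset.sum_add_distrib, ← Finset.mul_sum,
      ← Finset.mul_sum, ← Finset.mul_sum, Finset.sum_sub_distrib]
    simp only [Finset.sum_const, Finset.card_univ, Fintype.card_fin, nsmul_eq_mul]
    rw [hθ]
    field_simp
    ring
  have hFi : Integrable F (μ.prod noise) := a1.mul_prod b1
  have hFI : ∫ z, F z ∂(μ.prod noise) ≤ Real.exp (θ ^ 2 * (v + 10 / 9 * c ^ 2)) := by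
    rw [hF, integral_prod_mul (fun x => Real.exp (θ * (g x - m)))
      (fun w : ℤ × ℤ → ℝ => Real.exp (θ * c * w i))]
    refine (mul_le_mul a2 b2 (integral_nonneg fun _ => (Real.exp_pos _).le)
      (Real.exp_pos _).le).trans (le_of_eq ?_)
    rw [← Real.exp_add]
    congr 1
    ring
  simp_rw [e]
  rw [← ofReal_integral_eq_lintegral_ofReal (Integrable.fintype_prod fun _ => hFi)
    (Eventually.of_forall fun y => Finset.prod_nonneg fun l _ => by simp only [hF]; positivity),
    integral_fintype_prod_eq_pow]
  apply ENNReal.ofReal_le_ofReal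
  refine (pow_le_pow_left₀ (integral_nonneg fun z => by simp only [hF]; positivity) hFI _).trans
    (le_of_eq ?_)
  rw [← Real.exp_nat_mul, Fintype.card_fin, hθ]
  congr 1
  field_simp

/-- Raise `y ≤ exp y` for `y = t|u|/r` to the power `r`. -/
lemma abs_rpow_le_exp {t r : ℝ} (ht : 0 < t) (hr : 0 < r) (u : ℝ) :
    |u| ^ r ≤ (r / t) ^ r * Real.exp (t * |u|) := by
  have h : t * |u| / r ≤ Real.exp (t * |u| / r) := by
    linarith [Real.add_one_le_exp (t * |u| / r)]
  have h2 := Real.rpow_le_rpow (by positivity) h hr.le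
  rw [← Real.exp_mul, div_mul_cancel₀ _ hr.ne'] at h2
  calc |u| ^ r = (r / t) ^ r * (t * |u| / r) ^ r := by
        rw [← Real.mul_rpow (by positivity) (by positivity)]
        congr 1
        field_simp
    _ ≤ _ := by gcongr

lemma exp_mul_abs_le (t u : ℝ) :
    Real.exp (t * |u|) ≤ Real.exp (t * u) + Real.exp (-t * u) := by
  rcases abs_cases u with ⟨h, _⟩ | ⟨h, _⟩ <;> rw [h]
  · linarith [Real.exp_pos (-t * u)]
  · rw [mul_neg, ← neg_mul]
    linarith [Real.exp_pos (t * u)]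

lemma lintegral_exp_abs_meanError_le (hg : Measurable g) (hG : ∀ᵐ x ∂μ, |g x| ≤ G)
    (hv : ∫ x, g x ^ 2 ∂μ ≤ v) (hn : 0 < n) (i : ℤ × ℤ) {t : ℝ} (ht : 0 < t)
    (h1 : t * (2 * G) ≤ n) (h2 : (t * c / n) ^ 2 ≤ 1 / 10) :
    ∫⁻ y, ENNReal.ofReal (Real.exp (t * |meanError g c i (∫ x, g x ∂μ) y|))
        ∂(Measure.pi fun _ : Fin n => μ.prod noise) ≤
      ENNReal.ofReal (2 * Real.exp (t ^ 2 / n * (v + 10 / 9 * c ^ 2))) := by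
  have hm := measurable_meanError (n := n) hg c i (∫ x, g x ∂μ)
  have k1 := lintegral_exp_meanError_le hg hG hv hn i (t := t) (by rwa [abs_of_pos ht]) h2
  have k2 := lintegral_exp_meanError_le hg hG hv hn i (t := -t)
    (by rwa [abs_neg, abs_of_pos ht]) (by rwa [neg_mul, neg_div, neg_sq])
  rw [neg_sq] at k2
  calc _ ≤ ∫⁻ y, (ENNReal.ofReal (Real.exp (t * meanError g c i (∫ x, g x ∂μ) y)) +
          ENNReal.ofReal (Real.exp (-t * meanError g c i (∫ x, g x ∂μ) y)))
          ∂(Measure.pi fun _ : Fin n => μ.prod noise) := by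
        refine lintegral_mono fun y => ?_
        rw [← ENNReal.ofReal_add (Real.exp_pos _).le (Real.exp_pos _).le]
        exact ENNReal.ofReal_le_ofReal (exp_mul_abs_le _ _)
    _ ≤ _ := by
        rw [lintegral_add_left (hm.const_mul t).exp.ennreal_ofReal]
        refine (add_le_add k1 k2).trans (le_of_eq ?_)
        rw [← ENNReal.ofReal_add (Real.exp_pos _).le (Real.exp_pos _).le, two_mul]

lemma lintegral_abs_meanError_rpow_le (hg : Measurable g) (hG : ∀ᵐ x ∂μ, |g x| ≤ G)
    (hv : ∫ x, g x ^ 2 ∂μ ≤ v) (hn : 0 < n) (i : ℤ × ℤ) {t r : ℝ} (ht : 0 < t) (hr : 0 < r)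
    (h1 : t * (2 * G) ≤ n) (h2 : (t * c / n) ^ 2 ≤ 1 / 10) :
    ∫⁻ y, ENNReal.ofReal (|meanError g c i (∫ x, g x ∂μ) y| ^ r)
        ∂(Measure.pi fun _ : Fin n => μ.prod noise) ≤
      ENNReal.ofReal ((r / t) ^ r * (2 * Real.exp (t ^ 2 / n * (v + 10 / 9 * c ^ 2)))) := by
  have hm := measurable_meanError (n := n) hg c i (∫ x, g x ∂μ)
  have hm' : Measurable fun y : Fin n → ℝ × (ℤ × ℤ → ℝ) =>
      ENNReal.ofReal (Real.exp (t * |meanError g c i (∫ x, g x ∂μ) y|)) :=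
    (hm.abs.const_mul t).exp.ennreal_ofReal
  rw [ENNReal.ofReal_mul (by positivity)]
  refine le_trans ?_ (mul_le_mul_right (lintegral_exp_abs_meanError_le hg hG hv hn i ht h1 h2) _)
  rw [← lintegral_const_mul _ hm']
  refine lintegral_mono fun y => ?_
  rw [← ENNReal.ofReal_mul (by positivity)]
  exact ENNReal.ofReal_le_ofReal (abs_rpow_le_exp ht hr _)

/-- On the event `τ ≤ u` one has `exp(t u) ≤ exp(-t τ) exp(2 t u)`. The tail gains `exp(-t τ)` at
the price of doubling the argument of the exponential moment. -/
lemma lintegral_abs_meanError_rpow_tail_le (hg : Measurable g) (hG : ∀ᵐ x ∂μ, |g x| ≤ G)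
    (hv : ∫ x, g x ^ 2 ∂μ ≤ v) (hn : 0 < n) (i : ℤ × ℤ) {t r τ : ℝ} (ht : 0 < t) (hr : 0 < r)
    (h1 : 2 * t * (2 * G) ≤ n) (h2 : (2 * t * c / n) ^ 2 ≤ 1 / 10) :
    ∫⁻ y, ENNReal.ofReal (if τ ≤ |meanError g c i (∫ x, g x ∂μ) y| then
        |meanError g c i (∫ x, g x ∂μ) y| ^ r else 0)
        ∂(Measure.pi fun _ : Fin n => μ.prod noise) ≤
      ENNReal.ofReal ((r / t) ^ r * Real.exp (-(t * τ)) *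
        (2 * Real.exp ((2 * t) ^ 2 / n * (v + 10 / 9 * c ^ 2)))) := by
  have hm := measurable_meanError (n := n) hg c i (∫ x, g x ∂μ)
  have hm' : Measurable fun y : Fin n → ℝ × (ℤ × ℤ → ℝ) =>
      ENNReal.ofReal (Real.exp (2 * t * |meanError g c i (∫ x, g x ∂μ) y|)) :=
    (hm.abs.const_mul _).exp.ennreal_ofReal
  rw [ENNReal.ofReal_mul (by positivity)]
  refine le_trans ?_ (mul_le_mul_right
    (lintegral_exp_abs_meanError_le hg hG hv hn i (t := 2 * t) (by positivity) h1 h2) _)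
  rw [← lintegral_const_mul _ hm']
  refine lintegral_mono fun y => ?_
  rw [← ENNReal.ofReal_mul (by positivity)]
  apply ENNReal.ofReal_le_ofReal
  set u := |meanError g c i (∫ x, g x ∂μ) y| with hu
  split_ifs with h
  · calc u ^ r ≤ (r / t) ^ r * Real.exp (t * u) := abs_rpow_le_exp ht hr _
      _ ≤ (r / t) ^ r * Real.exp (-(t * τ) + 2 * t * u) := by
          gcongr
          nlinarith
      _ = _ := by rw [Real.exp_add]; ring
  · positivity

end MeanError

/-! ### The exponents of the rate -/

/-- The exponent of the rate for an effective sample size `M` and a noise level `2^{je} / M`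
at resolution `j`. -/
noncomputable def rateExponent (e s p r : ℝ) : ℝ :=
  if e * r < p * (2 * s + e) then r * s / (2 * s + e)
  else r * (s - 1 / p + 1 / r) / (2 * (s - 1 / p) + e)

section Exponents

variable {e s p r : ℝ}

/-- If `p ≥ r`, both `p` and `r` fall in the dense case, where the exponent does not involve `p`. -/
lemma rateExponent_min (he : 0 < e) (hs : 0 < s) (hr : 1 ≤ r) :
    rateExponent e s (min p r) r = rateExponent e s p r := by
  rcases le_total p r with h | h
  · rw [min_eq_left h]
  · rw [min_eq_right h]
    have h1 : e * r < r * (2 * s + e) := by nlinarith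
    have h2 : e * r < p * (2 * s + e) := by nlinarith
    rw [rateExponent, rateExponent, if_pos h1, if_pos h2]

lemma rateExponent_le_dense (he : 0 < e) (hp : 1 ≤ p) (hs : 1 / p < s) (hr : 1 ≤ r) :
    rateExponent e s p r ≤ r * s / (2 * s + e) := by
  have hp0 : 0 < p := by linarith
  have hr0 : 0 < r := by linarith
  have hip : 0 < 1 / p := by positivity
  unfold rateExponent
  split_ifs with h
  · exact le_rfl
  · push Not at h
    have h1 : (2 * s + e) / r ≤ e / p := by
      rw [div_le_div_iff₀ hr0 hp0]
      linarith
    rw [div_le_div_iff₀ (by linarith) (by linarith), mul_assoc, mul_assoc]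
    refine mul_le_mul_of_nonneg_left ?_ hr0.le
    have e1 : (2 * s + e) / r = (1 / r) * (2 * s + e) := by ring
    have e2 : e / p = e * (1 / p) := by ring
    rw [e1, e2] at h1
    nlinarith

lemma dense_le_half (he : 0 < e) (hs : 0 < s) (hr : 1 ≤ r) :
    r * s / (2 * s + e) ≤ r / 2 := by
  rw [div_le_div_iff₀ (by linarith) (by norm_num)]
  nlinarith

lemma dense_mono {s' : ℝ} (he : 0 < e) (hs : 0 < s) (hss : s ≤ s') (hr : 1 ≤ r) :
    r * s / (2 * s + e) ≤ r * s' / (2 * s' + e) := by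
  rw [div_le_div_iff₀ (by linarith) (by linarith), mul_assoc, mul_assoc]
  refine mul_le_mul_of_nonneg_left ?_ (by linarith)
  nlinarith

/-- For `p ≤ r` the gap `s - 1/p` may be tiny, but `1/r` remains; for `p ≥ r` the value is `s`. The
bound depends only on `ε` and `r`, which keeps the geometric series of the bias uniform. -/
lemma reducedSmoothness_lower {ε : ℝ} (hs : 1 / p < s) (hε : ε ≤ s) :
    min ε (1 / r) ≤ reducedSmoothness s p r := by
  unfold reducedSmoothness
  rcases le_total p r with h | h
  · rw [min_eq_left h]
    exact (min_le_right _ _).trans (by linarith)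
  · rw [min_eq_right h]
    exact (min_le_left _ _).trans (by linarith)

lemma reducedSmoothness_le (hp : 1 ≤ p) (hr : 1 ≤ r) :
    reducedSmoothness s p r ≤ s := by
  unfold reducedSmoothness
  have hpr : 0 < min p r := lt_min (by linarith) (by linarith)
  have := one_div_le_one_div_of_le hpr (min_le_right p r)
  linarith

/-- With `σ` the reduced smoothness, at a cut-off `2^j` of order `M^{1/e}` the bias has order
`M^{-rσ/e}`; the inequality says that this is within the rate. -/
lemma rateExponent_le_reducedSmoothness (he : 0 < e) (hp : 1 ≤ p) (hs : 1 / p < s) (hr : 1 ≤ r) :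
    rateExponent e s p r ≤ r * reducedSmoothness s p r / e := by
  have hp0 : 0 < p := by linarith
  have hr0 : 0 < r := by linarith
  have hip : 0 < 1 / p := by positivity
  have hir : 0 < 1 / r := by positivity
  have hs0 : 0 < s := hip.trans hs
  unfold rateExponent reducedSmoothness
  rcases le_total p r with hpr | hpr
  · rw [min_eq_left hpr]
    split_ifs with h
    · rw [mul_div_assoc, mul_div_assoc]
      refine mul_le_mul_of_nonneg_left ?_ hr0.le
      set u := 1 / p with hu
      set w := 1 / r with hw
      have h1 : e * u < w * (2 * s + e) := by
        have : e * u = e * r * (u * w) := by rw [hw]; field_simp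
        rw [this]
        have h2 : w * (2 * s + e) = p * (2 * s + e) * (u * w) := by rw [hu]; field_simp
        rw [h2]
        exact mul_lt_mul_of_pos_right h (by positivity)
      rw [div_le_div_iff₀ (by linarith) he]
      rcases le_total (e * s) (w * (2 * s + e)) with h3 | h3
      · nlinarith
      · -- here `s - u + w ≥ s - 2 s w / e`
        have h4 : e * (s - u + w) ≥ e * s - 2 * s * w := by nlinarith
        have h5 : e * (e * s) ≤ (e * s - 2 * s * w) * (2 * s + e) := by nlinarith
        have h6 : (e * s - 2 * s * w) * (2 * s + e) ≤ e * (s - u + w) * (2 * s + e) := by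
          nlinarith
        have h7 : e * (s * e) ≤ e * ((s - u + w) * (2 * s + e)) := by nlinarith
        exact le_of_mul_le_mul_left h7 he
    · refine div_le_div_of_nonneg_left ?_ he (by linarith)
      exact mul_nonneg hr0.le (by linarith)
  · rw [min_eq_right hpr]
    have h2 : e * r < p * (2 * s + e) := by nlinarith
    rw [if_pos h2, sub_add_cancel]
    exact div_le_div_of_nonneg_left (by positivity) he (by linarith)

/-- The weighted geometric mean argument behind the rate, in logarithmic form. -/
lemma log_level_le (he : 0 < e) (hp : 1 ≤ p) (hpr : p ≤ r) (hs0 : 0 < s)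
    (hs : p < r → 1 / p < s)
    {X l y : ℝ} (h1 : y ≤ r * ((e * X - l) / 2))
    (h2 : y ≤ (r - p) * ((e * X - l) / 2) - X * (p * s))
    (h3 : y ≤ -(X * (r * (s - 1 / p + 1 / r)))) :
    y ≤ -(l * rateExponent e s p r) := by
  have hp0 : 0 < p := by linarith
  have hr0 : 0 < r := by linarith
  unfold rateExponent
  split_ifs with h
  -- The weight for which the coefficient of `X` vanishes in the mean of `h1` and `h2`; `u ≤ 1` is
  -- the dense condition.
  · set u := e * r / (p * (2 * s + e)) with hu
    have hu0 : 0 ≤ u := by positivity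
    have hu1 : u ≤ 1 := (div_le_one (by positivity)).2 h.le
    have key : (1 - u) * (r * ((e * X - l) / 2)) + u * ((r - p) * ((e * X - l) / 2) - X * (p * s)) =
        -(l * (r * s / (2 * s + e))) := by
      rw [hu]
      have : 2 * s + e ≠ 0 := by positivity
      field_simp
      ring
    rw [← key]
    nlinarith [mul_le_mul_of_nonneg_left h1 (sub_nonneg.2 hu1), mul_le_mul_of_nonneg_left h2 hu0]
  · push Not at h
    have hlt : p < r := by nlinarith
    have hir0 : 0 < 1 / r := by positivity
    have hs' := hs hlt
    have hsp : 0 < 2 * (s - 1 / p) + e := by linarith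
    have hσ : 0 ≤ s - 1 / p + 1 / r := by linarith
    set d := 2 * (s - 1 / p) + e with hd
    -- Now the weight eliminates `X` between `h2` and `h3`; by `hid`, `u ≤ 1` is the sparse
    -- condition.
    set u := 2 * r * (s - 1 / p + 1 / r) / ((r - p) * d) with hu
    have hrp : 0 < r - p := by linarith
    have hid : (r - p) * d = (e * r - p * (2 * s + e)) + 2 * r * (s - 1 / p + 1 / r) := by
      rw [hd]
      field_simp
      ring
    have hip : 1 / p * p = 1 := by field_simp
    have hir : 1 / r * r = 1 := by field_simp
    have hu0 : 0 ≤ u := by positivity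
    have hu1 : u ≤ 1 := by
      rw [hu, div_le_one (by positivity), hid]
      linarith
    have key : u * ((r - p) * ((e * X - l) / 2) - X * (p * s)) +
        (1 - u) * (-(X * (r * (s - 1 / p + 1 / r)))) =
        -(l * (r * (s - 1 / p + 1 / r) / d)) := by
      have hu2 : u * ((r - p) * d) = 2 * r * (s - 1 / p + 1 / r) := by
        rw [hu]
        field_simp
      have hu3 : u * (r - p) = 2 * r * (s - 1 / p + 1 / r) / d := by
        rw [eq_div_iff hsp.ne']
        linarith
      have e1 : r * (s - 1 / p + 1 / r) / d = u * (r - p) / 2 := by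
        rw [hu3]
        ring
      rw [e1]
      rw [hid] at hu2
      linear_combination (X / 2) * hu2
    rw [← key]
    nlinarith [mul_le_mul_of_nonneg_left h3 (sub_nonneg.2 hu1), mul_le_mul_of_nonneg_left h2 hu0]

end Exponents

lemma le_rpow_neg_of_level {e s p r x M D Y : ℝ} (he : 0 < e) (hp : 1 ≤ p) (hpr : p ≤ r) (hs0 : 0 < s)
    (hs : p < r → 1 / p < s)
    (hx : 0 < x) (hM : 0 < M) (hD : D = x ^ (e / 2) / M ^ (1 / 2 : ℝ))
    (h1 : Y ≤ D ^ r) (h2 : Y ≤ D ^ (r - p) * x ^ (-(p * s)))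
    (h3 : Y ≤ x ^ (-(r * (s - 1 / p + 1 / r)))) :
    Y ≤ M ^ (-rateExponent e s p r) := by
  by_cases hY : 0 < Y
  · have hD0 : 0 < D := by rw [hD]; positivity
    have hlD : Real.log D = (e * Real.log x - Real.log M) / 2 := by
      rw [hD, Real.log_div (by positivity) (by positivity), Real.log_rpow hx, Real.log_rpow hM]
      ring
    rw [← Real.log_le_log_iff hY (by positivity), Real.log_rpow hM]
    rw [← Real.log_le_log_iff hY (by positivity)] at h1 h2 h3
    rw [Real.log_rpow hD0, hlD] at h1
    rw [Real.log_mul (by positivity) (by positivity), Real.log_rpow hD0, hlD, Real.log_rpow hx] at h2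
    rw [Real.log_rpow hx] at h3
    have := log_level_le (X := Real.log x) (l := Real.log M) he hp hpr hs0 hs h1 (by linarith) (by linarith)
    linarith
  · exact (not_lt.1 hY).trans (by positivity)

/-! ### Hard thresholding -/

/-- Hard thresholding. -/
noncomputable def hardThreshold (τ x : ℝ) : ℝ := if τ ≤ |x| then x else 0

/-- If `x` is kept while `|β| < τ/2`, the error is at least `τ/2`. If `x` is killed, either `|β| ≤
2τ`, and `|β|` is at most twice `min τ |β|`, or the error exceeds `|β|/2`, hence also `τ/2`. -/
lemma abs_hardThreshold_sub_rpow_le {τ r : ℝ} (hτ : 0 < τ) (hr : 0 < r) (x β : ℝ) :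
    |hardThreshold τ x - β| ^ r ≤
      (if τ / 2 ≤ |β| then |x - β| ^ r else 0) +
        2 ^ r * (if τ / 2 ≤ |x - β| then |x - β| ^ r else 0) + 2 ^ r * (min τ |β|) ^ r := by
  have h2 : (1 : ℝ) ≤ 2 ^ r := Real.one_le_rpow (by norm_num) hr.le
  have hY : 0 ≤ |x - β| ^ r := by positivity
  have hm0 : 0 ≤ min τ |β| := le_min hτ.le (abs_nonneg _)
  have hm : 0 ≤ 2 ^ r * (min τ |β|) ^ r := by positivity
  have hab : |x| - |β| ≤ |x - β| := abs_sub_abs_le_abs_sub x β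
  have hba : |β| - |x| ≤ |x - β| := by rw [abs_sub_comm]; exact abs_sub_abs_le_abs_sub β x
  unfold hardThreshold
  split_ifs with h1 h3 h4 h3 h4 <;> try nlinarith
  all_goals
    rw [zero_sub, abs_neg]
    push Not at h1
    by_cases h : |β| ≤ 2 * τ
    · have : |β| ^ r ≤ 2 ^ r * (min τ |β|) ^ r := by
        rw [← Real.mul_rpow (by norm_num) hm0]
        gcongr
        rcases min_cases τ |β| with ⟨h5, _⟩ | ⟨h5, _⟩ <;> rw [h5]
        · exact h
        · linarith [abs_nonneg β]
      nlinarith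
    · have : |β| ^ r ≤ 2 ^ r * |x - β| ^ r := by
        rw [← Real.mul_rpow (by norm_num) (abs_nonneg _)]
        gcongr
        linarith
      nlinarith

/-! ### Deterministic bounds at one resolution level -/

/-- The standard deviation of an estimated coefficient at level `j`, up to logarithms. -/
noncomputable def noiseLevel (α : ℝ) (n j : ℕ) : ℝ :=
  max 1 ((2 : ℝ) ^ ((j : ℝ) / 2) / α) / Real.sqrt n

/-- A lower bound for the rate that ignores logarithms. -/
noncomputable def baseRate (r s p n m : ℝ) : ℝ :=
  max (n ^ (-rateExponent 1 s p r)) (m ^ (-rateExponent 2 s p r))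

section Level

variable {α : ℝ} {n j : ℕ}

lemma noiseLevel_pos (hn : 0 < n) : 0 < noiseLevel α n j := by
  have : (0 : ℝ) < n := by exact_mod_cast hn
  unfold noiseLevel
  have : 0 < max 1 ((2 : ℝ) ^ ((j : ℝ) / 2) / α) := lt_max_of_lt_left one_pos
  positivity

lemma one_le_sqrt_mul_noiseLevel (hn : 0 < n) : 1 ≤ Real.sqrt n * noiseLevel α n j := by
  have : (0 : ℝ) < n := by exact_mod_cast hn
  rw [noiseLevel, mul_div_cancel₀ _ (by positivity)]
  exact le_max_left _ _

lemma le_sqrt_mul_noiseLevel (hn : 0 < n) :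
    (2 : ℝ) ^ ((j : ℝ) / 2) / α ≤ Real.sqrt n * noiseLevel α n j := by
  have : (0 : ℝ) < n := by exact_mod_cast hn
  rw [noiseLevel, mul_div_cancel₀ _ (by positivity)]
  exact le_max_right _ _

lemma thresh_eq (γ ν : ℝ) : thresh γ ν α n j = γ * (j : ℝ) ^ (ν + 1 / 2) * noiseLevel α n j := by
  rw [thresh, noiseLevel]
  ring

/-- The normalised noise has the form `x^{e/2}/M^{1/2}` in two versions, `(e, M) = (1, n)` and `(2,
nα²)`. This lets one interpolation argument serve for sampling and for privacy. -/
lemma two_rpow_half_mul_noiseLevel (hα : 0 < α) :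
    (2 : ℝ) ^ ((j : ℝ) / 2) * noiseLevel α n j =
      max (((2 : ℝ) ^ (j : ℝ)) ^ ((1 : ℝ) / 2) / (n : ℝ) ^ (1 / 2 : ℝ))
        (((2 : ℝ) ^ (j : ℝ)) ^ ((2 : ℝ) / 2) / ((n : ℝ) * α ^ 2) ^ (1 / 2 : ℝ)) := by
  have hn : (0 : ℝ) ≤ n := Nat.cast_nonneg n
  have e0 : ((2 : ℝ) ^ (j : ℝ)) ^ ((1 : ℝ) / 2) = (2 : ℝ) ^ ((j : ℝ) / 2) := by
    rw [← Real.rpow_mul (by norm_num)]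
    ring_nf
  have e1 : ((2 : ℝ) ^ (j : ℝ)) ^ ((2 : ℝ) / 2) = (2 : ℝ) ^ ((j : ℝ) / 2) * (2 : ℝ) ^ ((j : ℝ) / 2) := by
    rw [div_self (by norm_num), Real.rpow_one, ← Real.rpow_add (by norm_num)]
    ring_nf
  have e2 : ((n : ℝ) * α ^ 2) ^ (1 / 2 : ℝ) = Real.sqrt n * α := by
    rw [← Real.sqrt_eq_rpow, Real.sqrt_mul hn, Real.sqrt_sq hα.le]
  rw [e0, e1, e2, ← Real.sqrt_eq_rpow, noiseLevel, mul_div_assoc', mul_max_of_nonneg _ _ (by positivity),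
    ← max_div_div_right (Real.sqrt_nonneg _), mul_one]
  congr 1
  field_simp

lemma baseRate_pos {r s p x y : ℝ} (hx : 0 < x) : 0 < baseRate r s p x y :=
  lt_max_of_lt_left (Real.rpow_pos_of_pos hx _)

/-- The core of the rate. The sum of `min(τ, a_k)^r` is estimated by noise alone (`b1`), by a
mixture (`b2`) and by signal alone (`b3`); interpolation removes `j`. The factor `Λ` collects all
logarithmic losses. -/
lemma level_sum_le {r s p κ Λ B τ : ℝ} {a : ℤ → ℝ} {F : Finset ℤ} (ha : ∀ k, 0 ≤ a k)
    (hn : 0 < n) (hα : 0 < α) (hp : 1 ≤ p) (hr : 1 ≤ r) (hs : 1 / p < s)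
    (hκ : 1 ≤ κ) (hF : (F.card : ℝ) ≤ κ * 2 ^ j) (hΛ : 1 ≤ Λ) (hB0 : 0 ≤ B) (hB : B ≤ Λ)
    (hτ0 : 0 ≤ τ) (hτ : τ ≤ Λ * noiseLevel α n j)
    (hsum : ∑ k ∈ F, a k ^ (min p r) ≤
      (B * (2 : ℝ) ^ (-((j : ℝ) * (s + 1 / 2 - 1 / min p r)))) ^ (min p r)) :
    (2 : ℝ) ^ ((j : ℝ) * (r / 2 - 1)) * ∑ k ∈ F, (min τ (a k)) ^ r ≤
      κ * Λ ^ r * baseRate r s p n (n * α ^ 2) := by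
  have hp0 : 0 < p := by linarith
  have hr0 : 0 < r := by linarith
  have hs0 : 0 < s := (one_div_pos.2 hp0).trans hs
  have hP1 : 1 ≤ min p r := le_min hp hr
  have hPr : min p r ≤ r := min_le_right _ _
  have hPs : min p r < r → 1 / min p r < s := by
    intro h
    rcases min_cases p r with ⟨h1, _⟩ | ⟨h1, _⟩ <;> rw [h1] at h ⊢
    · exact hs
    · exact absurd h (lt_irrefl _)
  set P := min p r with hP
  have hP0 : 0 < P := by linarith
  have hn' : (0 : ℝ) < n := by exact_mod_cast hn
  set δ := noiseLevel α n j with hδ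
  have hδ0 : 0 < δ := noiseLevel_pos hn
  set S := ∑ k ∈ F, (min τ (a k)) ^ r with hS
  have hmin : ∀ k, 0 ≤ min τ (a k) := fun k => le_min hτ0 (ha k)
  have hS0 : 0 ≤ S := Finset.sum_nonneg fun k _ => Real.rpow_nonneg (hmin k) _
  set c := (2 : ℝ) ^ ((j : ℝ) * (r / 2 - 1)) with hc
  set x := (2 : ℝ) ^ (j : ℝ) with hx
  have hx0 : 0 < x := by positivity
  set E := B * (2 : ℝ) ^ (-((j : ℝ) * (s + 1 / 2 - 1 / P))) with hE
  have hE0 : 0 ≤ E := by positivity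
  have hEΛ : E ≤ Λ * (2 : ℝ) ^ (-((j : ℝ) * (s + 1 / 2 - 1 / P))) := by
    rw [hE]; gcongr
  have hxpow : ∀ y : ℝ, x ^ y = (2 : ℝ) ^ ((j : ℝ) * y) := fun y => by
    rw [hx, ← Real.rpow_mul (by norm_num)]
  set D := (2 : ℝ) ^ ((j : ℝ) / 2) * δ with hD
  have hD0 : 0 < D := by positivity
  have hκ0 : 0 < κ := by linarith
  have hΛ0 : 0 < Λ := by linarith
  have hΛr : 0 < Λ ^ r := by positivity
  have b1 : c * S ≤ κ * Λ ^ r * D ^ r := by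
    have h1 : S ≤ κ * x * (Λ * δ) ^ r := by
      calc S ≤ ∑ _k ∈ F, τ ^ r := Finset.sum_le_sum fun k _ =>
            Real.rpow_le_rpow (hmin k) (min_le_left _ _) hr0.le
        _ = F.card * τ ^ r := by rw [Finset.sum_const, nsmul_eq_mul]
        _ ≤ κ * x * (Λ * δ) ^ r := by
            rw [hx, Real.rpow_natCast]
            gcongr
    calc c * S ≤ c * (κ * x * (Λ * δ) ^ r) := by gcongr
      _ = κ * Λ ^ r * ((c * x) * δ ^ r) := by
          rw [Real.mul_rpow hΛ0.le hδ0.le]; ring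
      _ = _ := by
          rw [hD, Real.mul_rpow (by positivity) hδ0.le, hc, hx, ← Real.rpow_add (by norm_num),
            ← Real.rpow_mul (by norm_num)]
          ring_nf
  -- Split the `r`-th power into `r - P` factors bounded by the threshold and `P` factors bounded by
  -- the coefficient, then use the Besov bound in `ℓ^P`.
  have b2 : c * S ≤ κ * Λ ^ r * (D ^ (r - P) * x ^ (-(P * s))) := by
    have h1 : S ≤ (Λ * δ) ^ (r - P) * (Λ * (2 : ℝ) ^ (-((j : ℝ) * (s + 1 / 2 - 1 / P)))) ^ P := by
      calc S ≤ ∑ k ∈ F, (Λ * δ) ^ (r - P) * a k ^ P := by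
            refine Finset.sum_le_sum fun k _ => ?_
            have : (min τ (a k)) ^ r = (min τ (a k)) ^ (r - P) * (min τ (a k)) ^ P := by
              rw [← Real.rpow_add_of_nonneg (hmin k) (by linarith) hP0.le, sub_add_cancel]
            rw [this]
            have h0 := hmin k
            have hΛδ : 0 ≤ Λ * δ := by positivity
            exact mul_le_mul
              (Real.rpow_le_rpow h0 ((min_le_left _ _).trans hτ) (sub_nonneg.2 hPr))
              (Real.rpow_le_rpow h0 (min_le_right _ _) hP0.le) (Real.rpow_nonneg h0 _)
              (Real.rpow_nonneg hΛδ _)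
        _ ≤ _ := by
            rw [← Finset.mul_sum]
            gcongr
            exact hsum.trans (by gcongr)
    have h2 : (Λ * δ) ^ (r - P) * (Λ * (2 : ℝ) ^ (-((j : ℝ) * (s + 1 / 2 - 1 / P)))) ^ P =
        Λ ^ r * (δ ^ (r - P) * (2 : ℝ) ^ (-((j : ℝ) * (s + 1 / 2 - 1 / P)) * P)) := by
      rw [Real.mul_rpow hΛ0.le hδ0.le, Real.mul_rpow hΛ0.le (by positivity),
        ← Real.rpow_mul (by norm_num)]
      have : Λ ^ r = Λ ^ (r - P) * Λ ^ P := by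
        rw [← Real.rpow_add hΛ0, sub_add_cancel]
      rw [this]
      ring
    have h3 : c * (Λ ^ r * (δ ^ (r - P) * (2 : ℝ) ^ (-((j : ℝ) * (s + 1 / 2 - 1 / P)) * P))) =
        Λ ^ r * (D ^ (r - P) * x ^ (-(P * s))) := by
      rw [hD, Real.mul_rpow (by positivity) hδ0.le, hxpow, hc, ← Real.rpow_mul (by norm_num)]
      have e : (2 : ℝ) ^ ((j : ℝ) * (r / 2 - 1)) *
          (2 : ℝ) ^ (-((j : ℝ) * (s + 1 / 2 - 1 / P)) * P) =
          (2 : ℝ) ^ ((j : ℝ) / 2 * (r - P)) * (2 : ℝ) ^ ((j : ℝ) * -(P * s)) := by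
        rw [← Real.rpow_add (by norm_num), ← Real.rpow_add (by norm_num)]
        congr 1
        field_simp
        ring
      linear_combination (Λ ^ r * δ ^ (r - P)) * e
    rw [h2] at h1
    calc c * S ≤ _ := mul_le_mul_of_nonneg_left h1 (by positivity)
      _ = Λ ^ r * (D ^ (r - P) * x ^ (-(P * s))) := h3
      _ ≤ _ := by
          have : 0 ≤ Λ ^ r * (D ^ (r - P) * x ^ (-(P * s))) := by positivity
          nlinarith
  have b3 : c * S ≤ κ * Λ ^ r * x ^ (-(r * (s - 1 / P + 1 / r))) := by
    have h1 : S ≤ (Λ * (2 : ℝ) ^ (-((j : ℝ) * (s + 1 / 2 - 1 / P)))) ^ r := by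
      calc S ≤ ∑ k ∈ F, a k ^ r := Finset.sum_le_sum fun k _ =>
            Real.rpow_le_rpow (hmin k) (min_le_right _ _) hr0.le
        _ ≤ E ^ r := sum_rpow_le_of_sum_rpow_le ha hP0 hPr hE0 hsum
        _ ≤ _ := by gcongr
    have h3 : c * (Λ * (2 : ℝ) ^ (-((j : ℝ) * (s + 1 / 2 - 1 / P)))) ^ r =
        Λ ^ r * x ^ (-(r * (s - 1 / P + 1 / r))) := by
      rw [Real.mul_rpow hΛ0.le (by positivity), hxpow, hc, ← Real.rpow_mul (by norm_num),
        mul_left_comm, ← Real.rpow_add (by norm_num)]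
      congr 2
      field_simp
      ring
    calc c * S ≤ _ := mul_le_mul_of_nonneg_left h1 (by positivity)
      _ = Λ ^ r * x ^ (-(r * (s - 1 / P + 1 / r))) := h3
      _ ≤ _ := by
          have : 0 ≤ Λ ^ r * x ^ (-(r * (s - 1 / P + 1 / r))) := by positivity
          nlinarith
  set K := κ * Λ ^ r with hK
  have hK0 : 0 < K := by positivity
  have c1 : c * S / K ≤ D ^ r := by rw [div_le_iff₀' hK0]; exact b1
  have c2 : c * S / K ≤ D ^ (r - P) * x ^ (-(P * s)) := by rw [div_le_iff₀' hK0]; exact b2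
  have c3 : c * S / K ≤ x ^ (-(r * (s - 1 / P + 1 / r))) := by rw [div_le_iff₀' hK0]; exact b3
  rw [← div_le_iff₀' hK0, baseRate, ← rateExponent_min one_pos hs0 hr,
    ← rateExponent_min two_pos hs0 hr]
  have hDmax := two_rpow_half_mul_noiseLevel (j := j) (n := n) hα
  rw [← hδ, ← hD, ← hx] at hDmax
  -- Whichever of the sampling and privacy noises attains the maximum yields the matching term of
  -- `baseRate`.
  rcases max_choice (x ^ ((1 : ℝ) / 2) / (n : ℝ) ^ (1 / 2 : ℝ))
    (x ^ ((2 : ℝ) / 2) / ((n : ℝ) * α ^ 2) ^ (1 / 2 : ℝ)) with h | h <;> rw [h] at hDmax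
  · exact le_max_of_le_left (le_rpow_neg_of_level one_pos hP1 hPr hs0 hPs hx0 hn' hDmax c1 c2 c3)
  · exact le_max_of_le_right
      (le_rpow_neg_of_level two_pos hP1 hPr hs0 hPs hx0 (by positivity) hDmax c1 c2 c3)

/-- No rate exponent exceeds the parametric value `r/2`, so terms of parametric size are negligible.
-/
lemma rpow_neg_half_le_baseRate {r s p x y : ℝ} (hx : 1 ≤ x) (hy : 1 ≤ y)
    (hp : 1 ≤ p) (hr : 1 ≤ r) (hs : 1 / p < s) :
    max (x ^ (-(r / 2))) (y ^ (-(r / 2))) ≤ baseRate r s p x y := by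
  have hs0 : 0 < s := (one_div_pos.2 (by linarith)).trans hs
  refine max_le_max ?_ ?_
  · exact Real.rpow_le_rpow_of_exponent_le hx (neg_le_neg
      ((rateExponent_le_dense one_pos hp hs hr).trans (dense_le_half one_pos hs0 hr)))
  · exact Real.rpow_le_rpow_of_exponent_le hy (neg_le_neg
      ((rateExponent_le_dense two_pos hp hs hr).trans (dense_le_half two_pos hs0 hr)))

lemma max_rpow_of_nonneg {a b r : ℝ} (ha : 0 ≤ a) (hb : 0 ≤ b) (hr : 0 ≤ r) :
    (max a b) ^ r = max (a ^ r) (b ^ r) := by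
  rcases le_total a b with h | h
  · rw [max_eq_right h, max_eq_right (Real.rpow_le_rpow ha h hr)]
  · rw [max_eq_left h, max_eq_left (Real.rpow_le_rpow hb h hr)]

/-- The contribution of the large deviations at level `j`. -/
lemma level_tail_le {r s p : ℝ} (hn : 0 < n) (hα : 0 < α) (hm : 1 ≤ (n : ℝ) * α ^ 2)
    (hp : 1 ≤ p) (hr : 1 ≤ r) (hs : 1 / p < s) :
    (2 : ℝ) ^ ((j : ℝ) * (r / 2 - 1)) * (2 ^ j * (noiseLevel α n j ^ r * (2 : ℝ) ^ (-(r * j)))) ≤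
      baseRate r s p n (n * α ^ 2) := by
  have hr0 : 0 < r := by linarith
  have hn1 : (1 : ℝ) ≤ n := by exact_mod_cast hn
  have hn0 : (0 : ℝ) < n := by linarith
  have hm0 : (0 : ℝ) < n * α ^ 2 := by linarith
  refine le_trans ?_ (rpow_neg_half_le_baseRate hn1 hm hp hr hs)
  have hδ0 : 0 < noiseLevel α n j := noiseLevel_pos hn
  have hx1 : (1 : ℝ) ≤ (2 : ℝ) ^ (j : ℝ) := Real.one_le_rpow (by norm_num) (Nat.cast_nonneg j)
  have e1 : (2 : ℝ) ^ ((j : ℝ) * (r / 2 - 1)) *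
      (2 ^ j * (noiseLevel α n j ^ r * (2 : ℝ) ^ (-(r * j)))) =
      ((2 : ℝ) ^ (-(j : ℝ)) * ((2 : ℝ) ^ ((j : ℝ) / 2) * noiseLevel α n j)) ^ r := by
    rw [Real.mul_rpow (by positivity) (by positivity), Real.mul_rpow (by positivity) hδ0.le,
      ← Real.rpow_natCast, ← Real.rpow_mul (by norm_num), ← Real.rpow_mul (by norm_num)]
    have : (2 : ℝ) ^ ((j : ℝ) * (r / 2 - 1)) * (2 : ℝ) ^ (j : ℝ) = (2 : ℝ) ^ ((j : ℝ) / 2 * r) := by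
      rw [← Real.rpow_add (by norm_num)]
      ring_nf
    have h2 : -(r * (j : ℝ)) = -(j : ℝ) * r := by ring
    rw [h2]
    linear_combination (noiseLevel α n j ^ r * (2 : ℝ) ^ (-(j : ℝ) * r)) * this
  have e2 : ∀ y : ℝ, 0 < y → y ^ (-(r / 2)) = (1 / y ^ (1 / 2 : ℝ)) ^ r := by
    intro y hy
    rw [one_div, ← Real.rpow_neg hy.le, ← Real.rpow_mul hy.le]
    ring_nf
  rw [e1, e2 _ hn0, e2 _ hm0, ← max_rpow_of_nonneg (by positivity) (by positivity) hr0.le]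
  refine Real.rpow_le_rpow (by positivity) ?_ hr0.le
  rw [two_rpow_half_mul_noiseLevel hα, mul_max_of_nonneg _ _ (by positivity)]
  set x := (2 : ℝ) ^ (j : ℝ) with hx
  have hxn : (2 : ℝ) ^ (-(j : ℝ)) = x⁻¹ := by rw [Real.rpow_neg (by norm_num)]
  rw [hxn]
  refine max_le_max ?_ ?_
  · rw [mul_div_assoc']
    gcongr
    have h : x ^ ((1 : ℝ) / 2) ≤ x := by
      calc x ^ ((1 : ℝ) / 2) ≤ x ^ (1 : ℝ) := Real.rpow_le_rpow_of_exponent_le hx1 (by norm_num)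
        _ = x := Real.rpow_one x
    rw [inv_mul_le_iff₀ (by positivity), mul_one]
    exact h
  · rw [mul_div_assoc', div_self (by norm_num : (2 : ℝ) ≠ 0), Real.rpow_one,
      inv_mul_cancel₀ (by positivity)]

end Level

/-! ### Moments of the estimated coefficients -/

section Moments

variable {μ : Measure ℝ} [IsProbabilityMeasure μ] {g : ℝ → ℝ} {G V v c S α ν r b : ℝ} {n j : ℕ}

/-- The choice `t = 1/(j^ν δ)`, with `δ` the `noiseLevel`, makes the exponent of the exponential
moment bounded. The variance growth `1 + j` is absorbed by `j^{2ν}` because `ν ≥ 1`. -/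
lemma lintegral_meanError_rpow_le (hg : Measurable g)
    (hG : ∀ᵐ x ∂μ, |g x| ≤ (2 : ℝ) ^ ((j : ℝ) / 2) * b)
    (hv : ∫ x, g x ^ 2 ∂μ ≤ V * (1 + j)) (hV : 0 ≤ V) (hn : 0 < n) (hj : 1 ≤ j) (hν : 1 ≤ ν)
    (hr : 1 ≤ r) (hc0 : 0 ≤ c)
    (hc : c ≤ S * ((j : ℝ) ^ ν * (Real.sqrt n * noiseLevel α n j)))
    (h1 : 2 * b * (2 : ℝ) ^ ((j : ℝ) / 2) ≤ Real.sqrt n) (h2 : 10 * S ^ 2 ≤ n) (i : ℤ × ℤ) :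
    ∫⁻ y, ENNReal.ofReal (|meanError g c i (∫ x, g x ∂μ) y| ^ r)
        ∂(Measure.pi fun _ : Fin n => μ.prod noise) ≤
      ENNReal.ofReal (r ^ r * (2 * Real.exp (2 * V + 10 / 9 * S ^ 2)) *
        ((j : ℝ) ^ ν * noiseLevel α n j) ^ r) := by
  have hn0 : (0 : ℝ) < n := by exact_mod_cast hn
  have hj1 : (1 : ℝ) ≤ j := by exact_mod_cast hj
  have hδ0 : 0 < noiseLevel α n j := noiseLevel_pos hn
  have hnδ := one_le_sqrt_mul_noiseLevel (α := α) (j := j) hn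
  set δ := noiseLevel α n j
  set w := Real.sqrt n with hw
  have hw0 : 0 < w := Real.sqrt_pos.2 hn0
  have hww : w * w = n := Real.mul_self_sqrt hn0.le
  have hjν : (j : ℝ) ≤ (j : ℝ) ^ ν := by
    calc (j : ℝ) = (j : ℝ) ^ (1 : ℝ) := (Real.rpow_one _).symm
      _ ≤ (j : ℝ) ^ ν := Real.rpow_le_rpow_of_exponent_le hj1 hν
  set J := (j : ℝ) ^ ν with hJ
  have hJ1 : 1 ≤ J := hj1.trans hjν
  have hJδ : 0 < J * δ := by positivity
  have key := lintegral_abs_meanError_rpow_le (c := c) hg hG hv hn i (t := 1 / (J * δ)) (r := r)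
    (by positivity) (by linarith)
    (by
      rw [div_mul_eq_mul_div, div_le_iff₀ hJδ, one_mul, ← hww]
      calc 2 * ((2 : ℝ) ^ ((j : ℝ) / 2) * b) = 2 * b * (2 : ℝ) ^ ((j : ℝ) / 2) := by ring
        _ ≤ w * 1 := by rw [mul_one]; exact h1
        _ ≤ w * (J * (w * δ)) := by gcongr; nlinarith
        _ = _ := by ring)
    (by
      have : 1 / (J * δ) * c / n ≤ S / w := by
        rw [div_le_div_iff₀ hn0 hw0, one_div_mul_eq_div, div_mul_eq_mul_div, div_le_iff₀ hJδ]
        calc c * w ≤ S * (J * (w * δ)) * w := by gcongr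
          _ = S * (w * w) * (J * δ) := by ring
          _ = S * n * (J * δ) := by rw [hww]
      calc (1 / (J * δ) * c / n) ^ 2 ≤ (S / w) ^ 2 := pow_le_pow_left₀ (by positivity) this 2
        _ = S ^ 2 / n := by rw [div_pow, sq w, hww]
        _ ≤ 1 / 10 := by rw [div_le_div_iff₀ hn0 (by norm_num)]; linarith)
  refine key.trans (ENNReal.ofReal_le_ofReal ?_)
  have e : (1 / (J * δ)) ^ 2 / n * (V * (1 + j) + 10 / 9 * c ^ 2) ≤ 2 * V + 10 / 9 * S ^ 2 := by
    have hX : 0 < J * (w * δ) := by positivity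
    have e1 : (1 / (J * δ)) ^ 2 / n = 1 / (J * (w * δ)) ^ 2 := by
      rw [← hww]
      field_simp
    rw [e1, one_div_mul_eq_div, div_le_iff₀ (by positivity)]
    have h3 : c ^ 2 ≤ S ^ 2 * (J * (w * δ)) ^ 2 := by
      rw [← mul_pow]
      exact pow_le_pow_left₀ hc0 hc 2
    have h4 : (1 : ℝ) + j ≤ 2 * (J * (w * δ)) ^ 2 := by
      have h5 : J ≤ J * (w * δ) := by nlinarith
      nlinarith
    nlinarith [mul_le_mul_of_nonneg_left h4 hV]
  have e2 : (r / (1 / (J * δ))) ^ r = r ^ r * (J * δ) ^ r := by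
    rw [← Real.mul_rpow (by linarith) hJδ.le]
    congr 1
    field_simp
  rw [e2]
  calc r ^ r * (J * δ) ^ r * (2 * Real.exp _) ≤
        r ^ r * (J * δ) ^ r * (2 * Real.exp (2 * V + 10 / 9 * S ^ 2)) := by gcongr
    _ = _ := by ring

-- The additional `√j` in the threshold permits `t = κ √j/(j^ν δ)`, with `δ` the `noiseLevel`. Then
-- `t τ ≥ (9/20) γ² j`, the Laplace part of the exponent is at most `(9/40) γ² j`, and the variance
-- part stays bounded. The net gain `(9/40) γ² j` exceeds `r j log 2` because `γ ≥ 2r` and `r ≥ 1`.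
set_option maxHeartbeats 800000 in
lemma lintegral_meanError_rpow_tail_le {γ τ : ℝ} (hg : Measurable g)
    (hG : ∀ᵐ x ∂μ, |g x| ≤ (2 : ℝ) ^ ((j : ℝ) / 2) * b) (hb : 0 ≤ b)
    (hv : ∫ x, g x ^ 2 ∂μ ≤ V * (1 + j)) (hV : 0 ≤ V) (hn : 0 < n) (hj : 1 ≤ j) (hν : 1 ≤ ν)
    (hr : 1 ≤ r) (hc0 : 0 ≤ c) (hS : 0 < S) (hγ : 2 * r ≤ γ)
    (hc : c ≤ S * ((j : ℝ) ^ ν * (Real.sqrt n * noiseLevel α n j)))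
    (h1 : γ / S * b * (2 : ℝ) ^ ((j : ℝ) / 2) ≤ Real.sqrt n) (h2 : 40 * γ ^ 2 * j ≤ n)
    (hτ : 2 * S * γ * (j : ℝ) ^ (ν + 1 / 2) * noiseLevel α n j ≤ τ) (i : ℤ × ℤ) :
    ∫⁻ y, ENNReal.ofReal (if τ ≤ |meanError g c i (∫ x, g x ∂μ) y| then
        |meanError g c i (∫ x, g x ∂μ) y| ^ r else 0)
        ∂(Measure.pi fun _ : Fin n => μ.prod noise) ≤
      ENNReal.ofReal (((40 * S * r) / (9 * γ)) ^ r * (2 * Real.exp ((γ / S) ^ 2 * V)) *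
        (((j : ℝ) ^ ν * noiseLevel α n j) ^ r * (2 : ℝ) ^ (-(r * j)))) := by
  have hn0 : (0 : ℝ) < n := by exact_mod_cast hn
  have hj1 : (1 : ℝ) ≤ j := by exact_mod_cast hj
  have hγ0 : 0 < γ := by linarith
  have hδ0 : 0 < noiseLevel α n j := noiseLevel_pos hn
  have hnδ := one_le_sqrt_mul_noiseLevel (α := α) (j := j) hn
  set δ := noiseLevel α n j
  set w := Real.sqrt n with hw
  have hw0 : 0 < w := Real.sqrt_pos.2 hn0
  have hww : w * w = n := Real.mul_self_sqrt hn0.le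
  have hjν : (j : ℝ) ≤ (j : ℝ) ^ ν := by
    calc (j : ℝ) = (j : ℝ) ^ (1 : ℝ) := (Real.rpow_one _).symm
      _ ≤ (j : ℝ) ^ ν := Real.rpow_le_rpow_of_exponent_le hj1 hν
  have hsplit : (j : ℝ) ^ (ν + 1 / 2) = (j : ℝ) ^ ν * Real.sqrt j := by
    rw [Real.rpow_add (by linarith), ← Real.sqrt_eq_rpow]
  rw [hsplit] at hτ
  set J := (j : ℝ) ^ ν with hJ
  have hJ1 : 1 ≤ J := hj1.trans hjν
  have hJδ : 0 < J * δ := by positivity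
  set h := Real.sqrt j with hh
  have hh1 : 1 ≤ h := Real.one_le_sqrt.2 hj1
  have hhh : h * h = j := Real.mul_self_sqrt (by linarith)
  have hhJ : h ≤ J := le_trans (by nlinarith) hjν
  -- The value maximises `2γ y - (40/9) y²` at `y = κ S`, the gain from the threshold minus the cost
  -- of the Laplace noise, per unit of `j`.
  set κ := 9 * γ / (40 * S) with hκ
  have hκ0 : 0 < κ := by positivity
  have hκS : κ * S = 9 * γ / 40 := by rw [hκ]; field_simp
  set t := κ * h / (J * δ) with ht
  have ht0 : 0 < t := by positivity
  have hwδ : 1 ≤ w * δ := hnδ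
  have hX : 0 < J * (w * δ) := by positivity
  have et : t * J * δ = κ * h := by rw [ht]; field_simp
  have htw : t = κ * h * w / (J * (w * δ)) := by rw [ht]; field_simp
  have htc : t * c ≤ κ * S * h * w := by
    rw [htw, div_mul_eq_mul_div, div_le_iff₀ hX]
    calc κ * h * w * c ≤ κ * h * w * (S * (J * (w * δ))) := by gcongr
      _ = _ := by ring
  have key := lintegral_abs_meanError_rpow_tail_le (c := c) (τ := τ) hg hG hv hn i (t := t) (r := r)
    ht0 (by linarith)
    (by
      rw [htw]
      calc 2 * (κ * h * w / (J * (w * δ))) * (2 * ((2 : ℝ) ^ ((j : ℝ) / 2) * b))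
          ≤ 2 * (κ * w) * (2 * ((2 : ℝ) ^ ((j : ℝ) / 2) * b)) := by
            gcongr
            rw [div_le_iff₀ hX]
            calc κ * h * w ≤ κ * J * w := by gcongr
              _ ≤ κ * J * w * (w * δ) := le_mul_of_one_le_right (by positivity) hwδ
              _ = _ := by ring
        _ = (4 * κ * b * (2 : ℝ) ^ ((j : ℝ) / 2)) * w := by ring
        _ ≤ (γ / S * b * (2 : ℝ) ^ ((j : ℝ) / 2)) * w := by
            have : 4 * κ ≤ γ / S := by
              rw [hκ, le_div_iff₀ hS]
              field_simp
              norm_num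
            gcongr
        _ ≤ w * w := by gcongr
        _ = n := hww)
    (by
      have h3 : 2 * t * c / n ≤ 2 * (κ * S) * h / w := by
        rw [div_le_div_iff₀ hn0 hw0, ← hww]
        calc 2 * t * c * w = 2 * (t * c) * w := by ring
          _ ≤ 2 * (κ * S * h * w) * w := by gcongr
          _ = _ := by ring
      calc (2 * t * c / n) ^ 2 ≤ (2 * (κ * S) * h / w) ^ 2 := pow_le_pow_left₀ (by positivity) h3 2
        _ = (4 * (κ * S) ^ 2 * j) / n := by rw [← hww, ← hhh]; ring
        _ ≤ 1 / 10 := by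
          rw [div_le_div_iff₀ hn0 (by norm_num), hκS]
          have : 0 ≤ γ ^ 2 * j := by positivity
          nlinarith)
  refine key.trans (ENNReal.ofReal_le_ofReal ?_)
  have e2 : (r / t) ^ r ≤ ((40 * S * r) / (9 * γ)) ^ r * (J * δ) ^ r := by
    rw [← Real.mul_rpow (by positivity) hJδ.le]
    refine Real.rpow_le_rpow (by positivity) ?_ (by linarith)
    rw [ht, hκ, div_div_eq_mul_div, div_le_iff₀ (by positivity)]
    calc r * (J * δ) = 40 * S * r / (9 * γ) * (J * δ) * (9 * γ / (40 * S)) := by field_simp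
      _ ≤ 40 * S * r / (9 * γ) * (J * δ) * (9 * γ / (40 * S) * h) := by
        gcongr
        exact le_mul_of_one_le_right (by positivity) hh1
  have e3 : -(t * τ) + (2 * t) ^ 2 / n * (V * (1 + j) + 10 / 9 * c ^ 2) ≤
      (γ / S) ^ 2 * V + -(r * j) * Real.log 2 := by
    have f1 : 9 / 20 * γ ^ 2 * j ≤ t * τ := by
      calc 9 / 20 * γ ^ 2 * j = 2 * γ * (κ * S) * (h * h) := by rw [hκS, hhh]; ring
        _ = t * (2 * S * γ * (J * h) * δ) := by linear_combination (-2 * S * γ * h) * et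
        _ ≤ t * τ := by gcongr
    have f2 : (2 * t) ^ 2 / n * (10 / 9 * c ^ 2) ≤ 9 / 40 * γ ^ 2 * j := by
      rw [div_mul_eq_mul_div, div_le_iff₀ hn0]
      have h5 : (t * c) ^ 2 ≤ (κ * S * h * w) ^ 2 := pow_le_pow_left₀ (by positivity) htc 2
      calc (2 * t) ^ 2 * (10 / 9 * c ^ 2) = 40 / 9 * (t * c) ^ 2 := by ring
        _ ≤ 40 / 9 * (κ * S * h * w) ^ 2 := by gcongr
        _ = 40 / 9 * (κ * S) ^ 2 * (h * h) * (w * w) := by ring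
        _ = _ := by rw [hκS, hhh, hww]; ring
    have f3 : (2 * t) ^ 2 / n * (V * (1 + j)) ≤ (γ / S) ^ 2 * V := by
      have h6 : t ^ 2 * j ≤ κ ^ 2 * n := by
        rw [htw, div_pow, div_mul_eq_mul_div, div_le_iff₀ (by positivity)]
        have h7 : (j : ℝ) * j ≤ (J * (w * δ)) ^ 2 := by
          have h10 : (j : ℝ) ≤ J * (w * δ) :=
            hjν.trans (le_mul_of_one_le_right (by linarith) hwδ)
          rw [sq]
          exact mul_le_mul h10 h10 (by linarith) hX.le
        calc (κ * h * w) ^ 2 * j = κ ^ 2 * (w * w) * ((h * h) * j) := by ring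
          _ = κ ^ 2 * n * (j * j) := by rw [hww, hhh]
          _ ≤ κ ^ 2 * n * (J * (w * δ)) ^ 2 := by gcongr
      rw [div_mul_eq_mul_div, div_le_iff₀ hn0]
      have h8 : 8 * κ ^ 2 ≤ (γ / S) ^ 2 := by
        have : κ = 9 / 40 * (γ / S) := by rw [hκ]; field_simp
        rw [this, mul_pow, ← mul_assoc]
        exact mul_le_of_le_one_left (sq_nonneg _) (by norm_num)
      calc (2 * t) ^ 2 * (V * (1 + j)) ≤ (2 * t) ^ 2 * (V * (j + j)) := by gcongr
        _ = 8 * V * (t ^ 2 * j) := by ring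
        _ ≤ 8 * V * (κ ^ 2 * n) := by gcongr
        _ = 8 * κ ^ 2 * (V * n) := by ring
        _ ≤ (γ / S) ^ 2 * (V * n) := by gcongr
        _ = _ := by ring
    have f4 : r * j * Real.log 2 ≤ 9 / 40 * γ ^ 2 * j := by
      have l2 : Real.log 2 ≤ 0.7 := by linarith [Real.log_two_lt_d9]
      have h9 : 4 * r ^ 2 ≤ γ ^ 2 := by
        have := pow_le_pow_left₀ (by linarith) hγ 2
        linarith [mul_pow 2 r 2]
      calc r * j * Real.log 2 ≤ r * j * 0.7 := by gcongr
        _ ≤ 9 / 40 * (4 * r ^ 2) * j := by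
          have h11 : r * j * 1 ≤ r * j * r := by gcongr
          have h12 : 0 ≤ r * j := by positivity
          linarith
        _ ≤ _ := by gcongr
    have : (2 * t) ^ 2 / n * (V * (1 + j) + 10 / 9 * c ^ 2) =
        (2 * t) ^ 2 / n * (V * (1 + j)) + (2 * t) ^ 2 / n * (10 / 9 * c ^ 2) := by ring
    rw [this]
    linarith
  have e4 : Real.exp (-(t * τ)) * Real.exp ((2 * t) ^ 2 / n * (V * (1 + j) + 10 / 9 * c ^ 2)) ≤
      Real.exp ((γ / S) ^ 2 * V) * (2 : ℝ) ^ (-(r * j)) := by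
    rw [← Real.exp_add, Real.rpow_def_of_pos (by norm_num), ← Real.exp_add]
    apply Real.exp_le_exp.2
    rw [mul_comm (Real.log 2)]
    exact e3
  set X := Real.exp ((2 * t) ^ 2 / n * (V * (1 + j) + 10 / 9 * c ^ 2))
  calc (r / t) ^ r * Real.exp (-(t * τ)) * (2 * X)
      = (r / t) ^ r * (2 * (Real.exp (-(t * τ)) * X)) := by ring
    _ ≤ ((40 * S * r) / (9 * γ)) ^ r * (J * δ) ^ r *
        (2 * (Real.exp ((γ / S) ^ 2 * V) * (2 : ℝ) ^ (-(r * j)))) := by gcongr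
    _ = _ := by ring

end Moments

/-! ### Risk of one level -/

/-- The constant in the moment bound of an estimated coefficient. -/
noncomputable def momentConst (r V S : ℝ) : ℝ := r ^ r * (2 * Real.exp (2 * V + 10 / 9 * S ^ 2))

/-- The constant in the risk bound of a thresholded coefficient. -/
noncomputable def thresholdConst (r V S γ : ℝ) : ℝ :=
  momentConst r V S * (2 / (4 * S * γ)) ^ r +
    2 ^ r * (((40 * S * r) / (9 * γ)) ^ r * (2 * Real.exp ((γ / S) ^ 2 * V))) + 2 ^ r

lemma momentConst_nonneg {r V S : ℝ} (hr : 0 ≤ r) : 0 ≤ momentConst r V S := by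
  unfold momentConst
  positivity

lemma thresholdConst_nonneg {r V S γ : ℝ} (hr : 0 ≤ r) (hS : 0 < S) (hγ : 0 < γ) :
    0 ≤ thresholdConst r V S γ := by
  have := momentConst_nonneg (V := V) (S := S) hr
  unfold thresholdConst
  positivity

section Level

variable {μ : Measure ℝ} [IsProbabilityMeasure μ] {g : ℝ → ℝ} {V c S α ν r b γ τ : ℝ} {n j : ℕ}

/-- The ordinary moment bound is paid only if `|β| ≥ τ/2`, and then `τ ≤ 2 min τ |β|`; since `τ`
exceeds a multiple of the noise, this term is of order `min(τ, |β|)^r`. Large deviations contribute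
the factor `2^{-rj}`, which compensates for the `O(2^j)` indices of a level. -/
lemma lintegral_hardThreshold_le (hg : Measurable g)
    (hG : ∀ᵐ x ∂μ, |g x| ≤ (2 : ℝ) ^ ((j : ℝ) / 2) * b) (hb : 0 ≤ b)
    (hv : ∫ x, g x ^ 2 ∂μ ≤ V * (1 + j)) (hV : 0 ≤ V) (hn : 0 < n) (hj : 1 ≤ j) (hν : 1 ≤ ν)
    (hr : 1 ≤ r) (hc0 : 0 ≤ c) (hS : 0 < S) (hγ : 2 * r ≤ γ)
    (hc : c ≤ S * ((j : ℝ) ^ ν * (Real.sqrt n * noiseLevel α n j)))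
    (h1 : 2 * b * (2 : ℝ) ^ ((j : ℝ) / 2) ≤ Real.sqrt n) (h2 : 10 * S ^ 2 ≤ n)
    (h3 : γ / S * b * (2 : ℝ) ^ ((j : ℝ) / 2) ≤ Real.sqrt n) (h4 : 40 * γ ^ 2 * j ≤ n)
    (hτ : 4 * S * γ * (j : ℝ) ^ (ν + 1 / 2) * noiseLevel α n j ≤ τ) (i : ℤ × ℤ) :
    ∫⁻ y, ENNReal.ofReal (|hardThreshold τ (meanError g c i (∫ x, g x ∂μ) y + ∫ x, g x ∂μ) -
        ∫ x, g x ∂μ| ^ r) ∂(Measure.pi fun _ : Fin n => μ.prod noise) ≤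
      ENNReal.ofReal (thresholdConst r V S γ * ((min τ |∫ x, g x ∂μ|) ^ r +
        ((j : ℝ) ^ ν * noiseLevel α n j) ^ r * (2 : ℝ) ^ (-(r * j)))) := by
  have hr0 : 0 < r := by linarith
  have hγ0 : 0 < γ := by linarith
  have hj1 : (1 : ℝ) ≤ j := by exact_mod_cast hj
  have hδ0 : 0 < noiseLevel α n j := noiseLevel_pos hn
  set δ := noiseLevel α n j with hδ
  set β := ∫ x, g x ∂μ with hβ
  have hm := measurable_meanError (n := n) hg c i β
  have hmC := momentConst_nonneg (V := V) (S := S) hr0.le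
  have hJ : (j : ℝ) ^ ν ≤ (j : ℝ) ^ (ν + 1 / 2) :=
    Real.rpow_le_rpow_of_exponent_le hj1 (by linarith)
  have hJ0 : 0 < (j : ℝ) ^ ν := by positivity
  have hτ' : 4 * S * γ * ((j : ℝ) ^ ν * δ) ≤ τ := by
    refine le_trans ?_ hτ
    rw [← mul_assoc]
    gcongr
  have hτ0 : 0 < τ := lt_of_lt_of_le (by positivity) hτ'
  have M1 := lintegral_meanError_rpow_le hg hG hv hV hn hj hν hr hc0 hc h1 h2 i
  have M2 := lintegral_meanError_rpow_tail_le (τ := τ / 2) hg hG hb hv hV hn hj hν hr hc0 hS hγ hc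
    h3 h4 (by rw [← hδ]; linarith) i
  rw [← hβ] at M1 M2
  set U := fun y : Fin n → ℝ × (ℤ × ℤ → ℝ) => |meanError g c i β y| with hU
  have hUm : Measurable U := hm.abs
  set q := (min τ |β|) ^ r with hq
  have hq0 : 0 ≤ q := Real.rpow_nonneg (le_min hτ0.le (abs_nonneg _)) _
  set w := ((j : ℝ) ^ ν * δ) ^ r with hw
  have hw0 : 0 ≤ w := by positivity
  set C1 := momentConst r V S with hC1
  set C2 := ((40 * S * r) / (9 * γ)) ^ r * (2 * Real.exp ((γ / S) ^ 2 * V)) with hC2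
  have hC20 : 0 ≤ C2 := by positivity
  set P := Measure.pi fun _ : Fin n => μ.prod noise
  have T1 : ∫⁻ y, ENNReal.ofReal (if τ / 2 ≤ |β| then U y ^ r else 0) ∂P ≤
      ENNReal.ofReal (C1 * (2 / (4 * S * γ)) ^ r * q) := by
    split_ifs with hβτ
    · refine M1.trans (ENNReal.ofReal_le_ofReal ?_)
      change C1 * w ≤ _
      rw [mul_assoc]
      refine mul_le_mul_of_nonneg_left ?_ hmC
      rw [hw, hq, ← Real.mul_rpow (by positivity) (le_min hτ0.le (abs_nonneg _))]
      refine Real.rpow_le_rpow (by positivity) ?_ hr0.le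
      have : τ ≤ 2 * min τ |β| := by
        rcases min_cases τ |β| with ⟨h5, _⟩ | ⟨h5, _⟩ <;> rw [h5] <;> linarith
      rw [div_mul_eq_mul_div, le_div_iff₀ (by positivity)]
      linarith
    · simp
  have hite : Measurable fun y => if τ / 2 ≤ U y then U y ^ r else 0 :=
    Measurable.ite (measurableSet_le measurable_const hUm) (hUm.pow_const r) measurable_const
  calc ∫⁻ y, ENNReal.ofReal (|hardThreshold τ (meanError g c i β y + β) - β| ^ r) ∂P
      ≤ ∫⁻ y, ((ENNReal.ofReal (if τ / 2 ≤ |β| then U y ^ r else 0) +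
          ENNReal.ofReal (2 ^ r) * ENNReal.ofReal (if τ / 2 ≤ U y then U y ^ r else 0)) +
          ENNReal.ofReal (2 ^ r * q)) ∂P := by
        refine lintegral_mono fun y => ?_
        have h := abs_hardThreshold_sub_rpow_le hτ0 hr0 (meanError g c i β y + β) β
        rw [add_sub_cancel_right] at h
        have n1 : 0 ≤ if τ / 2 ≤ |β| then U y ^ r else 0 := by
          split_ifs
          exacts [by simp only [hU]; positivity, le_rfl]
        have n2 : 0 ≤ if τ / 2 ≤ U y then U y ^ r else 0 := by
          split_ifs
          exacts [by simp only [hU]; positivity, le_rfl]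
        rw [← ENNReal.ofReal_mul (by positivity), ← ENNReal.ofReal_add n1 (by positivity),
          ← ENNReal.ofReal_add (by positivity) (by positivity)]
        exact ENNReal.ofReal_le_ofReal h
    _ = (∫⁻ y, ENNReal.ofReal (if τ / 2 ≤ |β| then U y ^ r else 0) ∂P +
          ENNReal.ofReal (2 ^ r) * ∫⁻ y, ENNReal.ofReal (if τ / 2 ≤ U y then U y ^ r else 0) ∂P) +
          ENNReal.ofReal (2 ^ r * q) := by
        have hm3 : Measurable fun y => ENNReal.ofReal (2 ^ r) *
            ENNReal.ofReal (if τ / 2 ≤ U y then U y ^ r else 0) := hite.ennreal_ofReal.const_mul _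
        rw [lintegral_add_right _ measurable_const, lintegral_add_right _ hm3,
          lintegral_const_mul _ hite.ennreal_ofReal, lintegral_const, measure_univ, mul_one]
    _ ≤ (ENNReal.ofReal (C1 * (2 / (4 * S * γ)) ^ r * q) +
          ENNReal.ofReal (2 ^ r) * ENNReal.ofReal (C2 * (w * (2 : ℝ) ^ (-(r * j))))) +
          ENNReal.ofReal (2 ^ r * q) := by
        gcongr
    _ ≤ _ := by
        rw [← ENNReal.ofReal_mul (by positivity), ← ENNReal.ofReal_add (by positivity) (by positivity),
          ← ENNReal.ofReal_add (by positivity) (by positivity)]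
        apply ENNReal.ofReal_le_ofReal
        rw [thresholdConst, ← hC1, ← hC2]
        set z := w * (2 : ℝ) ^ (-(r * j))
        have hz : 0 ≤ z := by positivity
        have a1 : 0 ≤ C1 * (2 / (4 * S * γ)) ^ r * z := by positivity
        have a2 : 0 ≤ 2 ^ r * C2 * q := by positivity
        have a3 : 0 ≤ 2 ^ r * z := by positivity
        linarith

/-- Passing from the risk of coefficients to the risk of a wavelet sum. -/
lemma lintegral_lintegral_sum_atom_le {g : ℝ → ℝ} {A b r : ℝ} (hg : BoundedGenerator g A b)
    (hr : 1 ≤ r) (j : ℤ) (F : Finset ℤ) {Ω : Type*} [MeasurableSpace Ω] (P : Measure Ω)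
    {u : ℤ → Ω → ℝ} (hu : ∀ k, Measurable (u k)) {E : ℤ → ℝ} (hE : ∀ k ∈ F, 0 ≤ E k)
    (h : ∀ k ∈ F, ∫⁻ y, ENNReal.ofReal (|u k y| ^ r) ∂P ≤ ENNReal.ofReal (E k)) :
    ∫⁻ y, (∫⁻ x, ‖∑ k ∈ F, u k y * atom g j k x‖ₑ ^ r) ∂P ≤
      ENNReal.ofReal (sumConst A b r * ((2 : ℝ) ^ ((j : ℝ) * (r / 2 - 1)) * ∑ k ∈ F, E k)) := by
  have hs := hg.sumConst_nonneg r
  have hr0 : 0 < r := by linarith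
  have hm : ∀ k, Measurable fun y => ‖u k y‖ₑ ^ r := fun k => (hu k).enorm.pow_const r
  refine (lintegral_mono fun y => hg.lintegral_sum_atom_rpow_le j hr F (fun k => u k y)).trans ?_
  rw [lintegral_const_mul _ (Finset.measurable_fun_sum _ fun k _ => hm k),
    lintegral_finsetSum _ fun k _ => hm k, ← mul_assoc (sumConst A b r),
    ENNReal.ofReal_mul (q := ∑ k ∈ F, E k) (by positivity), ENNReal.ofReal_mul hs,
    ENNReal.ofReal_sum_of_nonneg hE]
  gcongr with k hk
  refine le_trans (le_of_eq ?_) (h k hk)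
  congr 1 with y
  rw [Real.enorm_eq_ofReal_abs, ENNReal.ofReal_rpow_of_nonneg (abs_nonneg _) hr0.le]

end Level

lemma one_le_overlap {A : ℝ} (hA : 0 ≤ A) : 1 ≤ overlap A := by
  unfold overlap
  have : (0 : ℝ) ≤ ⌈A⌉ := by exact_mod_cast Int.ceil_nonneg hA
  linarith

lemma noiseConst_pos {ψ : ℝ → ℝ} {A ν : ℝ} (hA : 0 ≤ A) (hν : 1 < ν) (hψ : 0 < supNorm ψ) :
    0 < noiseConst ψ A ν := by
  have := one_le_overlap hA
  have h1 : 0 < 2 * ν - 1 := by linarith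
  have h2 : 0 < ν - 1 := by linarith
  unfold noiseConst
  positivity

section Risk

variable {φ ψ : ℝ → ℝ} {A T ν r γ Lmax α ε s p q L : ℝ} {n j₀ j₁ : ℕ} {f : ℝ → ℝ}

/-- The bound for the second moments of the atoms, divided by `1 + j`. -/
noncomputable def momentBound (φ ψ : ℝ → ℝ) (A T L ε : ℝ) : ℝ :=
  (supNorm φ ^ 2 + supNorm ψ ^ 2) * massConst A (supNorm φ) (supNorm ψ) T L ε

lemma massConst_nonneg {A b b' T L ε : ℝ} (hA : 0 ≤ A) (hT : 0 < T) (hb : 0 ≤ b) (hb' : 0 ≤ b')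
    (hε : 0 < ε) (hL : 0 ≤ L) : 0 ≤ massConst A b b' T L ε := by
  have h2ε : (2 : ℝ) ^ (-ε) < 1 :=
    Real.rpow_lt_one_of_one_lt_of_neg (by norm_num) (by linarith)
  have h2ε' : 0 < 1 - (2 : ℝ) ^ (-ε) := by linarith
  have hκ := one_le_countConst hA hT
  unfold massConst
  positivity

lemma momentBound_nonneg (hA : 0 ≤ A) (hT : 0 < T)
    (hε : 0 < ε) (hL : 0 ≤ L) : 0 ≤ momentBound φ ψ A T L ε :=
  mul_nonneg (by positivity) (massConst_nonneg hA hT ENNReal.toReal_nonneg ENNReal.toReal_nonneg hε hL)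

/-- The risk of the coarse coefficients. -/
lemma coarse_risk_le (hφM : GeneratesMRA φ) (hψM : IsMotherWavelet φ ψ)
    (hφ : BoundedGenerator φ A (supNorm φ)) (hψ : BoundedGenerator ψ A (supNorm ψ))
    (hT : 0 < T) (hν : 1 < ν) (hr : 1 ≤ r) (hα : 0 < α) (hn : 0 < n) (hj : 1 ≤ j₀)
    (hε0 : 0 < ε) (hp : 1 ≤ p) (hq : 1 ≤ q) (hs : 1 / p < s) (hε : ε ≤ s) (hL : 0 ≤ L)
    (hLL : L ≤ Lmax) (hf : f ∈ densityClass φ ψ s p q L T)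
    (h1 : 2 * supNorm φ * (2 : ℝ) ^ ((j₀ : ℝ) / 2) ≤ Real.sqrt n)
    (h2 : 10 * (4 * overlap A * supNorm φ) ^ 2 ≤ n) (i : ℤ) :
    ∫⁻ y, (∫⁻ x, ‖∑ k ∈ indexSet A T j₀, meanError (atom φ j₀ k) (coarseScale φ A α j₀) (i, k)
        (waveletCoeff φ f j₀ k) y * atom φ j₀ k x‖ₑ ^ r)
        ∂(Measure.pi fun _ : Fin n => (law f).prod noise) ≤
      ENNReal.ofReal (sumConst A (supNorm φ) r * countConst A T *
        momentConst r (momentBound φ ψ A T Lmax ε) (4 * overlap A * supNorm φ) *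
        ((j₀ : ℝ) ^ ν * ((2 : ℝ) ^ ((j₀ : ℝ) / 2) * noiseLevel α n j₀)) ^ r) := by
  have hA := hφ.width_nonneg
  have hr0 : 0 < r := by linarith
  obtain ⟨hf0, hint, hone, hfs, hbes⟩ := hf
  have := isProbabilityMeasure_law hf0 hint hone
  have hκ := one_le_countConst hA hT
  have hov := one_le_overlap hA
  have hj1 : (1 : ℝ) ≤ j₀ := by exact_mod_cast hj
  have hδ0 : 0 < noiseLevel α n j₀ := noiseLevel_pos hn
  have hb : 0 ≤ supNorm φ := ENNReal.toReal_nonneg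
  set V := momentBound φ ψ A T Lmax ε with hV
  have hV0 : 0 ≤ V := momentBound_nonneg hA hT hε0 (hL.trans hLL)
  set S := 4 * overlap A * supNorm φ with hS
  have hs0 := hφ.sumConst_nonneg r
  have hmC := momentConst_nonneg (V := V) (S := S) hr0.le
  have hbound : ∀ k ∈ indexSet A T j₀,
      ∫⁻ y, ENNReal.ofReal (|meanError (atom φ j₀ k) (coarseScale φ A α j₀) (i, k)
        (waveletCoeff φ f j₀ k) y| ^ r) ∂(Measure.pi fun _ : Fin n => (law f).prod noise) ≤
      ENNReal.ofReal (momentConst r V S * ((j₀ : ℝ) ^ ν * noiseLevel α n j₀) ^ r) := by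
    intro k _
    have hβ : waveletCoeff φ f j₀ k = ∫ x, atom φ j₀ k x ∂(law f) := (integral_law hf0 hint _).symm
    rw [hβ]
    refine lintegral_meanError_rpow_le (b := supNorm φ) (measurable_atom hφ.measurable j₀ k)
      (law_ae ((hφ.ae_abs_atom_le j₀).mono fun x hx => by simpa using hx k)) ?_ hV0 hn hj hν.le hr ?_ ?_
      h1 h2 (i, k)
    · rw [integral_law hf0 hint]
      refine (lintegral_density_mul_atom_sq_le hφM hψM hφ hψ hφ hT hp hq hs hε0 hε hL
        ⟨hf0, hint, hone, hfs, hbes⟩ j₀ k).trans ?_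
      refine mul_le_mul_of_nonneg_right ?_ (by positivity)
      rw [hV, momentBound]
      have hmono := massConst_mono (b := supNorm φ) (ε := ε) hA hT hψ.bound_nonneg hε0 hLL
      have hm0 := massConst_nonneg (ε := ε) (L := Lmax) hA hT hb hψ.bound_nonneg hε0 (hL.trans hLL)
      calc _ ≤ supNorm φ ^ 2 * massConst A (supNorm φ) (supNorm ψ) T Lmax ε := by gcongr
        _ ≤ _ := by
          gcongr
          linarith [sq_nonneg (supNorm ψ)]
    · unfold coarseScale
      positivity
    · have h5 := le_sqrt_mul_noiseLevel (α := α) (j := j₀) hn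
      -- The coarse noise carries no factor `j^ν`; inserting one makes the detail moment bound
      -- applicable at the cost of a logarithm.
      have h6 : 1 ≤ (j₀ : ℝ) ^ ν := Real.one_le_rpow hj1 (by linarith)
      have h7 := one_le_sqrt_mul_noiseLevel (α := α) (j := j₀) hn
      calc coarseScale φ A α j₀ = S * ((2 : ℝ) ^ ((j₀ : ℝ) / 2) / α) := by
            rw [coarseScale, hS]; ring
        _ ≤ S * (Real.sqrt n * noiseLevel α n j₀) := by gcongr
        _ ≤ _ := mul_le_mul_of_nonneg_left (le_mul_of_one_le_left (by linarith) h6) (by positivity)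
  refine (lintegral_lintegral_sum_atom_le hφ hr j₀ (indexSet A T j₀) _
    (fun k => measurable_meanError (measurable_atom hφ.measurable j₀ k) _ _ _)
    (fun _ _ => by positivity) hbound).trans ?_
  apply ENNReal.ofReal_le_ofReal
  rw [Finset.sum_const, nsmul_eq_mul]
  set w := ((j₀ : ℝ) ^ ν * noiseLevel α n j₀) ^ r with hw
  have e : (2 : ℝ) ^ ((j₀ : ℝ) * (r / 2 - 1)) * 2 ^ j₀ * w =
      ((j₀ : ℝ) ^ ν * ((2 : ℝ) ^ ((j₀ : ℝ) / 2) * noiseLevel α n j₀)) ^ r := by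
    have : (j₀ : ℝ) ^ ν * ((2 : ℝ) ^ ((j₀ : ℝ) / 2) * noiseLevel α n j₀) =
      (2 : ℝ) ^ ((j₀ : ℝ) / 2) * ((j₀ : ℝ) ^ ν * noiseLevel α n j₀) := by ring
    rw [this, Real.mul_rpow (by positivity) (by positivity), ← hw, ← Real.rpow_mul (by norm_num),
      ← Real.rpow_natCast, ← Real.rpow_add (by norm_num)]
    ring_nf
  have hcard := card_indexSet_le hA hT j₀
  rw [← e]
  push_cast
  calc sumConst A (supNorm φ) r * ((2 : ℝ) ^ ((j₀ : ℝ) * (r / 2 - 1)) *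
        ((indexSet A T j₀).card * (momentConst r V S * w)))
      ≤ sumConst A (supNorm φ) r * ((2 : ℝ) ^ ((j₀ : ℝ) * (r / 2 - 1)) *
        (countConst A T * 2 ^ j₀ * (momentConst r V S * w))) := by
        gcongr
        exact hcard
    _ = _ := by ring

/-- The risk of the thresholded coefficients at level `j`. -/
lemma detail_risk_le {j : ℕ} {Λ : ℝ} (hφM : GeneratesMRA φ) (hψM : IsMotherWavelet φ ψ)
    (hφ : BoundedGenerator φ A (supNorm φ)) (hψ : BoundedGenerator ψ A (supNorm ψ))
    (hψ0 : 0 < supNorm ψ)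
    (hT : 0 < T) (hν : 1 < ν) (hr : 1 ≤ r) (hγ : 2 * r ≤ γ) (hα : 0 < α) (hn : 0 < n) (hj : 1 ≤ j)
    (hm : 1 ≤ (n : ℝ) * α ^ 2)
    (hε0 : 0 < ε) (hp : 1 ≤ p) (hq : 1 ≤ q) (hs : 1 / p < s) (hε : ε ≤ s) (hL : 0 ≤ L)
    (hLL : L ≤ Lmax) (hf : f ∈ densityClass φ ψ s p q L T)
    (h1 : 2 * supNorm ψ * (2 : ℝ) ^ ((j : ℝ) / 2) ≤ Real.sqrt n)
    (h2 : 10 * noiseConst ψ A ν ^ 2 ≤ n)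
    (h3 : γ / noiseConst ψ A ν * supNorm ψ * (2 : ℝ) ^ ((j : ℝ) / 2) ≤ Real.sqrt n)
    (h4 : 40 * γ ^ 2 * j ≤ n)
    (hΛ1 : 1 ≤ Λ) (hΛL : countConst A T * Lmax ≤ Λ) (hΛj : (j : ℝ) ^ ν ≤ Λ)
    (hΛτ : 4 * (Lmax + noiseConst ψ A ν) * (γ * (j : ℝ) ^ (ν + 1 / 2)) ≤ Λ) :
    ∫⁻ y, (∫⁻ x, ‖∑ k ∈ indexSet A T j, (hardThreshold
          (4 * (Lmax + noiseConst ψ A ν) * thresh γ ν α n j)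
          (meanError (atom ψ j k) (detailScale ψ A ν α j) ((j : ℤ), k) (waveletCoeff ψ f j k) y +
            waveletCoeff ψ f j k) - waveletCoeff ψ f j k) * atom ψ j k x‖ₑ ^ r)
        ∂(Measure.pi fun _ : Fin n => (law f).prod noise) ≤
      ENNReal.ofReal (sumConst A (supNorm ψ) r *
        thresholdConst r (momentBound φ ψ A T Lmax ε) (noiseConst ψ A ν) γ *
        (2 * countConst A T) * (Λ ^ r * baseRate r s p n (n * α ^ 2))) := by
  have hA := hφ.width_nonneg
  have hr0 : 0 < r := by linarith
  have hγ0 : 0 < γ := by linarith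
  obtain ⟨hf0, hint, hone, hfs, hbes⟩ := hf
  have := isProbabilityMeasure_law hf0 hint hone
  have hκ := one_le_countConst hA hT
  have hj1 : (1 : ℝ) ≤ j := by exact_mod_cast hj
  have hn0 : (0 : ℝ) < n := by exact_mod_cast hn
  have hδ0 : 0 < noiseLevel α n j := noiseLevel_pos hn
  set V := momentBound φ ψ A T Lmax ε with hV
  have hV0 : 0 ≤ V := momentBound_nonneg hA hT hε0 (hL.trans hLL)
  set S := noiseConst ψ A ν with hS
  have hS0 : 0 < S := noiseConst_pos hA hν hψ0
  have hLm : 0 ≤ Lmax := hL.trans hLL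
  have hs0 := hψ.sumConst_nonneg r
  have hC := thresholdConst_nonneg (V := V) hr0.le hS0 hγ0
  set τ := 4 * (Lmax + S) * thresh γ ν α n j with hτ
  rw [thresh_eq] at hτ
  have hτ0 : 0 ≤ τ := by rw [hτ]; positivity
  have hbound : ∀ k ∈ indexSet A T j,
      ∫⁻ y, ENNReal.ofReal (|hardThreshold τ (meanError (atom ψ j k) (detailScale ψ A ν α j)
          ((j : ℤ), k) (waveletCoeff ψ f j k) y + waveletCoeff ψ f j k) - waveletCoeff ψ f j k| ^ r)
        ∂(Measure.pi fun _ : Fin n => (law f).prod noise) ≤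
      ENNReal.ofReal (thresholdConst r V S γ * ((min τ |waveletCoeff ψ f j k|) ^ r +
        ((j : ℝ) ^ ν * noiseLevel α n j) ^ r * (2 : ℝ) ^ (-(r * j)))) := by
    intro k _
    have hβ : waveletCoeff ψ f j k = ∫ x, atom ψ j k x ∂(law f) := (integral_law hf0 hint _).symm
    rw [hβ]
    refine lintegral_hardThreshold_le (b := supNorm ψ) (measurable_atom hψ.measurable j k)
      (law_ae ((hψ.ae_abs_atom_le j).mono fun x hx => by simpa using hx k)) hψ0.le ?_ hV0 hn hj hν.le
      hr ?_ hS0 hγ ?_ h1 h2 h3 h4 ?_ ((j : ℤ), k)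
    · rw [integral_law hf0 hint]
      refine (lintegral_density_mul_atom_sq_le hφM hψM hφ hψ hψ hT hp hq hs hε0 hε hL
        ⟨hf0, hint, hone, hfs, hbes⟩ j k).trans ?_
      refine mul_le_mul_of_nonneg_right ?_ (by positivity)
      rw [hV, momentBound]
      have hmono := massConst_mono (b := supNorm φ) (ε := ε) hA hT hψ.bound_nonneg hε0 hLL
      have hm0 := massConst_nonneg (ε := ε) (L := Lmax) hA hT hφ.bound_nonneg hψ.bound_nonneg hε0
        (hL.trans hLL)
      calc _ ≤ supNorm ψ ^ 2 * massConst A (supNorm φ) (supNorm ψ) T Lmax ε := by gcongr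
        _ ≤ _ := by
          gcongr
          linarith [sq_nonneg (supNorm φ)]
    · unfold detailScale
      positivity
    · have h5 := le_sqrt_mul_noiseLevel (α := α) (j := j) hn
      calc detailScale ψ A ν α j = S * ((j : ℝ) ^ ν * ((2 : ℝ) ^ ((j : ℝ) / 2) / α)) := by
            rw [detailScale, ← hS]
            push_cast
            rw [max_eq_left hj1]
            ring
        _ ≤ _ := by gcongr
    · rw [hτ]
      have : S ≤ Lmax + S := by linarith
      calc 4 * S * γ * (j : ℝ) ^ (ν + 1 / 2) * noiseLevel α n j
          = 4 * S * (γ * (j : ℝ) ^ (ν + 1 / 2) * noiseLevel α n j) := by ring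
        _ ≤ _ := by gcongr
  have hmeas : ∀ k : ℤ, Measurable fun y : Fin n → ℝ × (ℤ × ℤ → ℝ) =>
      hardThreshold τ (meanError (atom ψ j k) (detailScale ψ A ν α j)
          ((j : ℤ), k) (waveletCoeff ψ f j k) y + waveletCoeff ψ f j k) - waveletCoeff ψ f j k := by
    intro k
    have hm := (measurable_meanError (n := n) (measurable_atom hψ.measurable j k)
      (detailScale ψ A ν α j) ((j : ℤ), k) (waveletCoeff ψ f j k)).add_const (waveletCoeff ψ f j k)
    exact (Measurable.ite (measurableSet_le measurable_const hm.abs) hm measurable_const).sub_const _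
  have hmin : ∀ k, 0 ≤ min τ |waveletCoeff ψ f j k| := fun k => le_min hτ0 (abs_nonneg _)
  refine (lintegral_lintegral_sum_atom_le hψ hr j (indexSet A T j) _ hmeas
    (fun k _ => by have := hmin k; positivity) hbound).trans ?_
  apply ENNReal.ofReal_le_ofReal
  have hcard := card_indexSet_le hA hT j
  have l1 := level_sum_le (α := α) (n := n) (j := j) (r := r) (s := s) (p := p)
    (κ := countConst A T) (Λ := Λ) (B := countConst A T * L) (τ := τ)
    (a := fun k => |waveletCoeff ψ f j k|) (F := indexSet A T j) (fun _ => abs_nonneg _) hn hα hp hr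
    hs hκ hcard hΛ1 (by positivity) (le_trans (by gcongr) hΛL) hτ0
    (by
      rw [hτ]
      calc 4 * (Lmax + S) * (γ * (j : ℝ) ^ (ν + 1 / 2) * noiseLevel α n j)
          = 4 * (Lmax + S) * (γ * (j : ℝ) ^ (ν + 1 / 2)) * noiseLevel α n j := by ring
        _ ≤ _ := by gcongr)
    (sum_abs_coeff_rpow_min_le hA hT hp hq hL hr hbes j)
  have l2 := level_tail_le (j := j) (r := r) hn hα hm hp hr hs
  rw [← Finset.mul_sum, Finset.sum_add_distrib, Finset.sum_const, nsmul_eq_mul]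
  set R := baseRate r s p n (n * α ^ 2) with hR
  set Q := ∑ k ∈ indexSet A T j, (min τ |waveletCoeff ψ f j k|) ^ r with hQ
  set c := (2 : ℝ) ^ ((j : ℝ) * (r / 2 - 1)) with hc
  have hc0 : 0 < c := by positivity
  have e1 : ((j : ℝ) ^ ν * noiseLevel α n j) ^ r ≤ Λ ^ r * noiseLevel α n j ^ r := by
    rw [← Real.mul_rpow (by linarith) hδ0.le]
    gcongr
  have t2 : c * ((indexSet A T j).card *
      (((j : ℝ) ^ ν * noiseLevel α n j) ^ r * (2 : ℝ) ^ (-(r * j)))) ≤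
      countConst A T * (Λ ^ r * R) := by
    calc _ ≤ c * (countConst A T * 2 ^ j *
          (Λ ^ r * noiseLevel α n j ^ r * (2 : ℝ) ^ (-(r * j)))) := by
          gcongr
          exact hcard
      _ = countConst A T * (Λ ^ r *
          (c * (2 ^ j * (noiseLevel α n j ^ r * (2 : ℝ) ^ (-(r * j)))))) := by ring
      _ ≤ _ := by gcongr
  push_cast
  rw [← hc]
  calc sumConst A (supNorm ψ) r * (c * (thresholdConst r V S γ * (Q + (indexSet A T j).card *
        (((j : ℝ) ^ ν * noiseLevel α n j) ^ r * (2 : ℝ) ^ (-(r * j))))))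
      = sumConst A (supNorm ψ) r * thresholdConst r V S γ * (c * Q + c * ((indexSet A T j).card *
        (((j : ℝ) ^ ν * noiseLevel α n j) ^ r * (2 : ℝ) ^ (-(r * j))))) := by ring
    _ ≤ sumConst A (supNorm ψ) r * thresholdConst r V S γ *
        (countConst A T * Λ ^ r * R + countConst A T * (Λ ^ r * R)) := by gcongr
    _ = _ := by ring

end Risk

/-! ### Decomposition of the risk -/

/-- Convexity is used twice for the three pieces, whence `4^r`, and once across the levels. The
resulting power of the number of levels is a power of `log n` in the application. -/
lemma lintegral_lintegral_add_sum_add_le {Ω ι : Type*} [MeasurableSpace Ω] (P : Measure Ω)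
    [IsProbabilityMeasure P] {r : ℝ} (hr : 1 ≤ r) (F : Finset ι) {a : Ω → ℝ → ℝ}
    {b : ι → Ω → ℝ → ℝ} (c : ℝ → ℝ) (ha : Measurable (Function.uncurry a))
    (hb : ∀ j, Measurable (Function.uncurry (b j))) :
    ∫⁻ y, (∫⁻ x, ‖a y x + ∑ j ∈ F, b j y x + c x‖ₑ ^ r) ∂P ≤
      4 ^ r * ((∫⁻ y, (∫⁻ x, ‖a y x‖ₑ ^ r) ∂P) +
        ((F.card : ℝ≥0∞) ^ (r - 1) * ∑ j ∈ F, ∫⁻ y, (∫⁻ x, ‖b j y x‖ₑ ^ r) ∂P) +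
        ∫⁻ x, ‖c x‖ₑ ^ r) := by
  have hr0 : 0 ≤ r := by linarith
  have hay : ∀ y, Measurable fun x => ‖a y x‖ₑ ^ r := fun y =>
    (ha.comp measurable_prodMk_left).enorm.pow_const r
  have hby : ∀ j y, Measurable fun x => ‖b j y x‖ₑ ^ r := fun j y =>
    ((hb j).comp measurable_prodMk_left).enorm.pow_const r
  have hay' : Measurable fun y => ∫⁻ x, ‖a y x‖ₑ ^ r :=
    Measurable.lintegral_prod_right' (f := fun z => ‖Function.uncurry a z‖ₑ ^ r)
      (ha.enorm.pow_const r)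
  have hby' : ∀ j, Measurable fun y => ∫⁻ x, ‖b j y x‖ₑ ^ r := fun j =>
    Measurable.lintegral_prod_right' (f := fun z => ‖Function.uncurry (b j) z‖ₑ ^ r)
      ((hb j).enorm.pow_const r)
  have h2 : ∀ u v : ℝ≥0∞, (u + v) ^ r ≤ 2 ^ r * (u ^ r + v ^ r) := fun u v =>
    (ENNReal.rpow_add_le_mul_rpow_add_rpow u v hr).trans (by
      gcongr
      · norm_num
      · linarith)
  have h4 : (2 : ℝ≥0∞) ^ r * 2 ^ r = 4 ^ r := by
    rw [← ENNReal.mul_rpow_of_nonneg _ _ hr0]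
    norm_num
  have h1 : (1 : ℝ≥0∞) ≤ 2 ^ r := ENNReal.one_le_rpow (by norm_num) (by linarith)
  have hpt : ∀ y x, ‖a y x + ∑ j ∈ F, b j y x + c x‖ₑ ^ r ≤
      4 ^ r * ((‖a y x‖ₑ ^ r + (F.card : ℝ≥0∞) ^ (r - 1) * ∑ j ∈ F, ‖b j y x‖ₑ ^ r) +
        ‖c x‖ₑ ^ r) := by
    intro y x
    calc ‖a y x + ∑ j ∈ F, b j y x + c x‖ₑ ^ r
        ≤ ((‖a y x‖ₑ + ∑ j ∈ F, ‖b j y x‖ₑ) + ‖c x‖ₑ) ^ r := by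
          gcongr
          refine (enorm_add_le _ _).trans ?_
          gcongr
          refine (enorm_add_le _ _).trans ?_
          gcongr
          exact enorm_sum_le _ _
      _ ≤ 2 ^ r * (2 ^ r * (‖a y x‖ₑ ^ r + (F.card : ℝ≥0∞) ^ (r - 1) * ∑ j ∈ F, ‖b j y x‖ₑ ^ r) +
          2 ^ r * ‖c x‖ₑ ^ r) := by
          refine (h2 _ _).trans ?_
          gcongr
          · refine (h2 _ _).trans ?_
            gcongr
            exact ENNReal.rpow_sum_le_const_mul_sum_rpow _ _ hr
          · exact le_mul_of_one_le_left zero_le h1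
      _ = _ := by rw [← mul_add, ← mul_assoc, h4]
  calc ∫⁻ y, (∫⁻ x, ‖a y x + ∑ j ∈ F, b j y x + c x‖ₑ ^ r) ∂P
      ≤ ∫⁻ y, (4 ^ r * (((∫⁻ x, ‖a y x‖ₑ ^ r) + (F.card : ℝ≥0∞) ^ (r - 1) *
          ∑ j ∈ F, ∫⁻ x, ‖b j y x‖ₑ ^ r) + ∫⁻ x, ‖c x‖ₑ ^ r)) ∂P := by
        refine lintegral_mono fun y => (lintegral_mono fun x => hpt y x).trans (le_of_eq ?_)
        have hs : Measurable fun x => ∑ j ∈ F, ‖b j y x‖ₑ ^ r :=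
          Finset.measurable_fun_sum _ fun j _ => hby j y
        have hs' : Measurable fun x => ‖a y x‖ₑ ^ r +
            (F.card : ℝ≥0∞) ^ (r - 1) * ∑ j ∈ F, ‖b j y x‖ₑ ^ r := (hay y).add (hs.const_mul _)
        rw [lintegral_const_mul' _ _ (by simp),
          lintegral_add_left hs', lintegral_add_left (hay y),
          lintegral_const_mul _ hs, lintegral_finsetSum _ fun j _ => hby j y]
    _ = _ := by
        have hs : Measurable fun y => ∑ j ∈ F, ∫⁻ x, ‖b j y x‖ₑ ^ r :=
          Finset.measurable_fun_sum _ fun j _ => hby' j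
        have hs' : Measurable fun y => (∫⁻ x, ‖a y x‖ₑ ^ r) +
            (F.card : ℝ≥0∞) ^ (r - 1) * ∑ j ∈ F, ∫⁻ x, ‖b j y x‖ₑ ^ r :=
          hay'.add (hs.const_mul _)
        rw [lintegral_const_mul' _ _ (by simp),
          lintegral_add_left hs', lintegral_add_left hay',
          lintegral_const_mul _ hs, lintegral_finsetSum _ fun j _ => hby' j, lintegral_const,
          measure_univ, mul_one]

lemma card_rpow_mul_sum_le {ι : Type*} {r E B : ℝ} (hr : 1 ≤ r) (F : Finset ι)
    {u : ι → ℝ≥0∞} (hu : ∀ j ∈ F, u j ≤ ENNReal.ofReal E)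
    (hB : (F.card : ℝ) ^ (r - 1) * (F.card * E) ≤ B) :
    (F.card : ℝ≥0∞) ^ (r - 1) * ∑ j ∈ F, u j ≤ ENNReal.ofReal B := by
  have e : (F.card : ℝ≥0∞) ^ (r - 1) = ENNReal.ofReal ((F.card : ℝ) ^ (r - 1)) := by
    rw [← ENNReal.ofReal_rpow_of_nonneg (by positivity) (by linarith), ENNReal.ofReal_natCast]
  calc (F.card : ℝ≥0∞) ^ (r - 1) * ∑ j ∈ F, u j
      ≤ (F.card : ℝ≥0∞) ^ (r - 1) * (F.card * ENNReal.ofReal E) := by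
        gcongr
        refine (Finset.sum_le_sum hu).trans ?_
        rw [Finset.sum_const, nsmul_eq_mul]
    _ = ENNReal.ofReal ((F.card : ℝ) ^ (r - 1) * (F.card * E)) := by
        rw [e, ← ENNReal.ofReal_natCast, ← ENNReal.ofReal_mul (by positivity),
          ← ENNReal.ofReal_mul (by positivity)]
    _ ≤ _ := ENNReal.ofReal_le_ofReal hB

lemma four_rpow_mul_add_le {r K₁ K₂ K₃ Y a b c : ℝ} {x y z : ℝ≥0∞} (hK₁ : 0 ≤ K₁) (hK₂ : 0 ≤ K₂)
    (hK₃ : 0 ≤ K₃) (hY : 0 ≤ Y) (ha : 0 ≤ a) (hb : 0 ≤ b) (hc : 0 ≤ c)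
    (hx : x ≤ ENNReal.ofReal (K₁ * (Y * a))) (hy : y ≤ ENNReal.ofReal (K₂ * (Y * b)))
    (hz : z ≤ ENNReal.ofReal (K₃ * (Y * c))) :
    4 ^ r * (x + y + z) ≤
      ENNReal.ofReal (4 ^ r * (K₁ + K₂ + K₃) * Y * (a + b + c)) := by
  have e : (4 : ℝ≥0∞) ^ r = ENNReal.ofReal (4 ^ r) := by
    rw [← ENNReal.ofReal_rpow_of_pos (by norm_num)]
    norm_num
  calc 4 ^ r * (x + y + z) ≤ 4 ^ r * (ENNReal.ofReal (K₁ * (Y * a)) +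
          ENNReal.ofReal (K₂ * (Y * b)) + ENNReal.ofReal (K₃ * (Y * c))) := by gcongr
    _ = ENNReal.ofReal (4 ^ r * (K₁ * (Y * a) + K₂ * (Y * b) + K₃ * (Y * c))) := by
        rw [e, ← ENNReal.ofReal_add (by positivity) (by positivity),
          ← ENNReal.ofReal_add (by positivity) (by positivity),
          ← ENNReal.ofReal_mul (by positivity)]
    _ ≤ _ := by
        apply ENNReal.ofReal_le_ofReal
        have t1 : 0 ≤ K₁ * Y * (b + c) := by positivity
        have t2 : 0 ≤ K₂ * Y * (a + c) := by positivity
        have t3 : 0 ≤ K₃ * Y * (a + b) := by positivity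
        rw [mul_assoc, mul_assoc]
        gcongr
        linarith

section Risk

variable {φ ψ : ℝ → ℝ} {A T ν r γ Lmax α ε s p q L : ℝ} {n j₀ j₁ : ℕ} {f : ℝ → ℝ}

lemma measurable_hardThreshold_meanError {g : ℝ → ℝ} (hg : Measurable g) (c τ β : ℝ)
    (i : ℤ × ℤ) : Measurable fun y : Fin n → ℝ × (ℤ × ℤ → ℝ) =>
      hardThreshold τ (meanError g c i β y + β) - β := by
  have hm := (measurable_meanError (n := n) hg c i β).add_const β
  exact (Measurable.ite (measurableSet_le measurable_const hm.abs) hm measurable_const).sub_const _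

lemma empMean_privateView_coarse {k : ℤ} (hk : k ∈ indexSet A T j₀) (β : ℝ)
    (y : Fin n → ℝ × (ℤ × ℤ → ℝ)) :
    empMean (fun i => privateView φ ψ A T ν α j₀ j₁ (y i).1 (y i).2) ((j₀ : ℤ) - 1) k =
      meanError (atom φ j₀ k) (coarseScale φ A α j₀) ((j₀ : ℤ) - 1, k) β y + β := by
  simp [empMean, meanError, privateView, hk]

lemma empMean_privateView_detail {j : ℕ} {k : ℤ} (hj : j ∈ Finset.Icc j₀ j₁)
    (hk : k ∈ indexSet A T j) (β : ℝ) (y : Fin n → ℝ × (ℤ × ℤ → ℝ)) :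
    empMean (fun i => privateView φ ψ A T ν α j₀ j₁ (y i).1 (y i).2) j k =
      meanError (atom ψ j k) (detailScale ψ A ν α j) ((j : ℤ), k) β y + β := by
  obtain ⟨h1, h2⟩ := Finset.mem_Icc.1 hj
  have h3 : ¬ (j : ℤ) = (j₀ : ℤ) - 1 := by omega
  simp [empMean, meanError, privateView, hk, h1, h2, h3]

/-- The error of the estimator is the sum of the errors at the estimated levels and the bias. -/
lemma ae_estimator_sub_eq (hφM : GeneratesMRA φ) (hψM : IsMotherWavelet φ ψ)
    {b b' : ℝ} (hφ : BoundedGenerator φ A b) (hψ : BoundedGenerator ψ A b')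
    (hint : Integrable f) (hfs : Function.support f ⊆ Set.Icc (-T) T) (τ : ℕ → ℝ) :
    ∀ᵐ x, ∀ y : Fin n → ℝ × (ℤ × ℤ → ℝ),
      estimator φ ψ A T j₀ j₁ τ (fun i => privateView φ ψ A T ν α j₀ j₁ (y i).1 (y i).2) x - f x =
      ∑ k ∈ indexSet A T j₀, meanError (atom φ j₀ k) (coarseScale φ A α j₀) ((j₀ : ℤ) - 1, k)
          (waveletCoeff φ f j₀ k) y * atom φ j₀ k x +
        ∑ j ∈ Finset.Icc j₀ j₁, ∑ k ∈ indexSet A T j, (hardThreshold (τ j)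
          (meanError (atom ψ j k) (detailScale ψ A ν α j) ((j : ℤ), k) (waveletCoeff ψ f j k) y +
            waveletCoeff ψ f j k) - waveletCoeff ψ f j k) * atom ψ j k x +
        (waveletProj φ A T (max j₀ (j₁ + 1) : ℕ) f x - f x) := by
  -- The maximum covers the degenerate case `j₁ < j₀`: no detail is estimated and the bias is that
  -- of level `j₀`.
  have hI : Finset.Ico j₀ (max j₀ (j₁ + 1)) = Finset.Icc j₀ j₁ := by
    ext i
    simp only [Finset.mem_Ico, Finset.mem_Icc]
    omega
  filter_upwards [waveletProj_eq_add_sum hφM hψM hφ hψ hint hfs (le_max_left j₀ (j₁ + 1))]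
    with x hx y
  rw [hx, hI]
  have e1 : ∑ k ∈ indexSet A T j₀,
      empMean (fun i => privateView φ ψ A T ν α j₀ j₁ (y i).1 (y i).2) ((j₀ : ℤ) - 1) k *
        atom φ j₀ k x =
      ∑ k ∈ indexSet A T j₀, meanError (atom φ j₀ k) (coarseScale φ A α j₀) ((j₀ : ℤ) - 1, k)
          (waveletCoeff φ f j₀ k) y * atom φ j₀ k x + waveletProj φ A T j₀ f x := by
    rw [waveletProj, ← Finset.sum_add_distrib]
    refine Finset.sum_congr rfl fun k hk => ?_
    rw [empMean_privateView_coarse hk (waveletCoeff φ f j₀ k), add_mul]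
    rfl
  have e2 : ∑ j ∈ Finset.Icc j₀ j₁, ∑ k ∈ indexSet A T j,
      (if τ j ≤ |empMean (fun i => privateView φ ψ A T ν α j₀ j₁ (y i).1 (y i).2) j k| then
        empMean (fun i => privateView φ ψ A T ν α j₀ j₁ (y i).1 (y i).2) j k else 0) *
        atom ψ j k x =
      ∑ j ∈ Finset.Icc j₀ j₁, ∑ k ∈ indexSet A T j, (hardThreshold (τ j)
          (meanError (atom ψ j k) (detailScale ψ A ν α j) ((j : ℤ), k) (waveletCoeff ψ f j k) y +
            waveletCoeff ψ f j k) - waveletCoeff ψ f j k) * atom ψ j k x +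
        ∑ j ∈ Finset.Icc j₀ j₁, waveletProj ψ A T j f x := by
    rw [← Finset.sum_add_distrib]
    refine Finset.sum_congr rfl fun j hj => ?_
    rw [waveletProj, ← Finset.sum_add_distrib]
    refine Finset.sum_congr rfl fun k hk => ?_
    rw [empMean_privateView_detail hj hk (waveletCoeff ψ f j k), sub_mul, hardThreshold]
    change _ = _ - waveletCoeff ψ f j k * _ + waveletCoeff ψ f j k * _
    ring
  rw [estimator, e1, e2]
  ring

/-- The risk is bounded by the risks of the estimated levels and the bias. -/
lemma risk_le_sum (hφM : GeneratesMRA φ) (hψM : IsMotherWavelet φ ψ)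
    {b b' : ℝ} (hφ : BoundedGenerator φ A b) (hψ : BoundedGenerator ψ A b') (hr : 1 ≤ r)
    (hf : f ∈ densityClass φ ψ s p q L T) (τ : ℕ → ℝ) :
    risk φ ψ A T ν α j₀ j₁ τ n r f ≤
      4 ^ r * (∫⁻ y, (∫⁻ x, ‖∑ k ∈ indexSet A T j₀, meanError (atom φ j₀ k)
            (coarseScale φ A α j₀) ((j₀ : ℤ) - 1, k) (waveletCoeff φ f j₀ k) y *
              atom φ j₀ k x‖ₑ ^ r) ∂(Measure.pi fun _ : Fin n => (law f).prod noise) +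
        (((Finset.Icc j₀ j₁).card : ℝ≥0∞) ^ (r - 1) * ∑ j ∈ Finset.Icc j₀ j₁,
          ∫⁻ y, (∫⁻ x, ‖∑ k ∈ indexSet A T j, (hardThreshold (τ j)
            (meanError (atom ψ j k) (detailScale ψ A ν α j) ((j : ℤ), k) (waveletCoeff ψ f j k) y +
              waveletCoeff ψ f j k) - waveletCoeff ψ f j k) * atom ψ j k x‖ₑ ^ r)
            ∂(Measure.pi fun _ : Fin n => (law f).prod noise)) +
        ∫⁻ x, ‖waveletProj φ A T (max j₀ (j₁ + 1) : ℕ) f x - f x‖ₑ ^ r) := by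
  obtain ⟨hf0, hint, hone, hfs, -⟩ := hf
  have := isProbabilityMeasure_law hf0 hint hone
  have key := lintegral_lintegral_add_sum_add_le
    (Measure.pi fun _ : Fin n => (law f).prod noise) hr (Finset.Icc j₀ j₁)
    (a := fun y x => ∑ k ∈ indexSet A T j₀, meanError (atom φ j₀ k)
      (coarseScale φ A α j₀) ((j₀ : ℤ) - 1, k) (waveletCoeff φ f j₀ k) y * atom φ j₀ k x)
    (b := fun j y x => ∑ k ∈ indexSet A T j, (hardThreshold (τ j)
      (meanError (atom ψ j k) (detailScale ψ A ν α j) ((j : ℤ), k) (waveletCoeff ψ f j k) y +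
        waveletCoeff ψ f j k) - waveletCoeff ψ f j k) * atom ψ j k x)
    (fun x => waveletProj φ A T (max j₀ (j₁ + 1) : ℕ) f x - f x)
    (Finset.measurable_fun_sum _ fun k _ =>
      ((measurable_meanError (measurable_atom hφ.measurable j₀ k) _ _ _).comp measurable_fst).mul
        ((measurable_atom hφ.measurable j₀ k).comp measurable_snd))
    (fun j => Finset.measurable_fun_sum _ fun k _ =>
      ((measurable_hardThreshold_meanError (measurable_atom hψ.measurable j k) _ _ _ _).comp
        measurable_fst).mul ((measurable_atom hψ.measurable j k).comp measurable_snd))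
  refine le_trans (le_of_eq ?_) key
  unfold risk
  refine lintegral_congr fun y => lintegral_congr_ae ?_
  filter_upwards [ae_estimator_sub_eq (n := n) (j₀ := j₀) (j₁ := j₁) (ν := ν) (α := α) hφM hψM hφ hψ
    hint hfs τ] with x hx
  rw [hx y]

set_option maxHeartbeats 1000000 in
/-- A finite sample bound for the risk. -/
lemma exists_risk_le (hφM : GeneratesMRA φ) (hψM : IsMotherWavelet φ ψ)
    (hφ : BoundedGenerator φ A (supNorm φ)) (hψ : BoundedGenerator ψ A (supNorm ψ))
    (hψ0 : 0 < supNorm ψ) (hT : 0 < T) (hν : 1 < ν) (hr : 1 ≤ r) (hγ : 2 * r ≤ γ)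
    (hLm : 0 ≤ Lmax) :
    ∃ Q : ℝ, ∀ ε : ℝ, 0 < ε → ∃ K : ℝ, 0 ≤ K ∧ ∀ (α X s p q L : ℝ) (n j₀ j₁ : ℕ) (f : ℝ → ℝ),
      0 < α → 0 < n → 1 ≤ (n : ℝ) * α ^ 2 → 1 ≤ j₀ → 1 ≤ X → (j₀ : ℝ) ≤ X → (j₁ : ℝ) ≤ X →
      Q * (2 : ℝ) ^ (((max j₀ j₁ : ℕ) : ℝ) / 2) ≤ Real.sqrt n →
      1 ≤ p → 1 ≤ q → 1 / p < s → ε ≤ s → 0 ≤ L → L ≤ Lmax → f ∈ densityClass φ ψ s p q L T →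
      risk φ ψ A T ν α j₀ j₁ (fun j => 4 * (Lmax + noiseConst ψ A ν) * thresh γ ν α n j) n r f ≤
        ENNReal.ofReal (K * X ^ (r * (ν + 3 / 2)) *
          (((2 : ℝ) ^ ((j₀ : ℝ) / 2) * noiseLevel α n j₀) ^ r + baseRate r s p n (n * α ^ 2) +
            (2 : ℝ) ^ (-(((max j₀ (j₁ + 1) : ℕ) : ℝ) * (r * reducedSmoothness s p r))))) := by
  have hA := hφ.width_nonneg
  have hr0 : 0 < r := by linarith
  have hγ0 : 0 < γ := by linarith
  have hS0 : 0 < noiseConst ψ A ν := noiseConst_pos hA hν hψ0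
  have hκ := one_le_countConst hA hT
  have hφ0 : 0 ≤ supNorm φ := ENNReal.toReal_nonneg
  set S := noiseConst ψ A ν with hS
  set S' := 4 * overlap A * supNorm φ with hS'
  set q1 := γ / S * supNorm ψ with hq1
  have hq10 : 0 ≤ q1 := by positivity
  -- A crude common majorant: `Q 2^{J/2} ≤ √n` implies all side conditions of the one-level bounds,
  -- the one linear in `j` through `J + 1 ≤ 2^J`.
  set Q := 1 + 2 * supNorm φ + 2 * supNorm ψ + 10 * S ^ 2 + 10 * S' ^ 2 + q1 + 40 * γ ^ 2 with hQ
  have hp1 : 0 ≤ 10 * S ^ 2 := by positivity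
  have hp2 : 0 ≤ 10 * S' ^ 2 := by positivity
  have hp3 : 0 ≤ 40 * γ ^ 2 := by positivity
  have hQ1 : 1 ≤ Q := by linarith
  have hQφ : 2 * supNorm φ ≤ Q := by linarith
  have hQψ : 2 * supNorm ψ ≤ Q := by linarith
  have hQS : 10 * S ^ 2 ≤ Q := by linarith
  have hQS' : 10 * S' ^ 2 ≤ Q := by linarith
  have hQq : q1 ≤ Q := by linarith
  have hQγ : 40 * γ ^ 2 ≤ Q := by linarith
  clear_value Q
  refine ⟨Q, fun ε hε0 => ?_⟩
  set V := momentBound φ ψ A T Lmax ε with hV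
  set B := 1 + countConst A T * Lmax + 4 * (Lmax + S) * γ with hB
  have hB1 : 1 ≤ B := by
    have h1 : 0 ≤ countConst A T * Lmax := by positivity
    have h2 : 0 ≤ 4 * (Lmax + S) * γ := by positivity
    linarith
  have hBL : countConst A T * Lmax ≤ B := by
    have h2 : 0 ≤ 4 * (Lmax + S) * γ := by positivity
    linarith
  have hBS : 4 * (Lmax + S) * γ ≤ B := by
    have h1 : 0 ≤ countConst A T * Lmax := by positivity
    linarith
  clear_value B
  set σ₀ := min ε (1 / r) with hσ₀
  have hσ₀0 : 0 < σ₀ := lt_min hε0 (by positivity)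
  have h2σ : (2 : ℝ) ^ (-σ₀) < 1 :=
    Real.rpow_lt_one_of_one_lt_of_neg (by norm_num) (by linarith)
  set K1 := sumConst A (supNorm φ) r * countConst A T * momentConst r V S' with hK1
  set K2 := sumConst A (supNorm ψ) r * thresholdConst r V S γ * (2 * countConst A T) *
    (2 * B) ^ r with hK2
  set K3 := (sumConst A (supNorm ψ) r ^ (1 / r) * (countConst A T * Lmax) *
    (1 / (1 - (2 : ℝ) ^ (-σ₀)))) ^ r with hK3
  have hsφ := hφ.sumConst_nonneg r
  have hsψ := hψ.sumConst_nonneg r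
  have hK10 : 0 ≤ K1 := by
    have := momentConst_nonneg (V := V) (S := S') hr0.le
    positivity
  have hK20 : 0 ≤ K2 := by
    have := thresholdConst_nonneg (V := V) hr0.le hS0 hγ0
    positivity
  have h2σ' : 0 < 1 - (2 : ℝ) ^ (-σ₀) := by linarith
  have hK30 : 0 ≤ K3 := by positivity
  refine ⟨4 ^ r * (K1 + K2 + K3), by positivity, ?_⟩
  intro α X s p q L n j₀ j₁ f hα hn hm hj₀ hX hj₀X hj₁X hbig hp hq hs hε hL hLL hf
  have hn0 : (0 : ℝ) < n := by exact_mod_cast hn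
  have hδ0 : 0 < noiseLevel α n j₀ := noiseLevel_pos hn
  have hRpos : 0 < baseRate r s p n (n * α ^ 2) := baseRate_pos hn0
  set R := baseRate r s p n (n * α ^ 2) with hR
  set J := max j₀ j₁ with hJ
  have hbase : ∀ c : ℝ, c ≤ Q → ∀ j : ℕ, j ≤ J → c * (2 : ℝ) ^ ((j : ℝ) / 2) ≤ Real.sqrt n := by
    intro c hc j hj
    refine le_trans ?_ hbig
    have : (j : ℝ) ≤ J := by exact_mod_cast hj
    gcongr
    norm_num
  have hsq : Q * Q * (2 : ℝ) ^ (J : ℝ) ≤ n := by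
    have h := mul_le_mul hbig hbig (by positivity) (Real.sqrt_nonneg _)
    rw [Real.mul_self_sqrt hn0.le] at h
    refine le_trans (le_of_eq ?_) h
    have : (2 : ℝ) ^ (J : ℝ) = (2 : ℝ) ^ ((J : ℝ) / 2) * (2 : ℝ) ^ ((J : ℝ) / 2) := by
      rw [← Real.rpow_add (by norm_num)]
      ring_nf
    rw [this]
    ring
  have hJ2 : (J : ℝ) + 1 ≤ (2 : ℝ) ^ (J : ℝ) := by
    rw [Real.rpow_natCast]
    exact_mod_cast Nat.lt_two_pow_self
  have hQn : Q * ((J : ℝ) + 1) ≤ n := by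
    refine le_trans ?_ hsq
    gcongr
    exact le_mul_of_one_le_left (zero_le_one.trans hQ1) hQ1
  have hQn1 : Q ≤ n :=
    (le_mul_of_one_le_right (zero_le_one.trans hQ1) (le_add_of_nonneg_left J.cast_nonneg)).trans hQn
  have hrν : 0 ≤ r * (ν + 3 / 2) := mul_nonneg hr0.le (by linarith only [hν])
  have hXr : 1 ≤ X ^ (r * (ν + 3 / 2)) := Real.one_le_rpow hX hrν
  set Y := X ^ (r * (ν + 3 / 2)) with hY
  have I1 := coarse_risk_le hφM hψM hφ hψ hT hν hr hα hn hj₀ hε0 hp hq hs hε hL hLL hf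
    (hbase _ hQφ _ (le_max_left _ _)) (hQS'.trans hQn1) ((j₀ : ℤ) - 1)
  have I1' : K1 * ((j₀ : ℝ) ^ ν * ((2 : ℝ) ^ ((j₀ : ℝ) / 2) * noiseLevel α n j₀)) ^ r ≤
      K1 * (Y * ((2 : ℝ) ^ ((j₀ : ℝ) / 2) * noiseLevel α n j₀) ^ r) := by
    refine mul_le_mul_of_nonneg_left ?_ hK10
    rw [Real.mul_rpow (by positivity) (by positivity), ← Real.rpow_mul (by positivity)]
    gcongr
    calc (j₀ : ℝ) ^ (ν * r) ≤ X ^ (ν * r) := by gcongr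
      _ ≤ Y := Real.rpow_le_rpow_of_exponent_le hX (by linarith only [hr0])
  set Λ := B * X ^ (ν + 1 / 2) with hΛ
  have hXν : 1 ≤ X ^ (ν + 1 / 2) := Real.one_le_rpow hX (by linarith)
  have hΛB : B ≤ Λ := le_mul_of_one_le_right (by linarith) hXν
  have I2 : ∀ j ∈ Finset.Icc j₀ j₁, _ := fun j hj => by
    obtain ⟨hj0, hj1⟩ := Finset.mem_Icc.1 hj
    have hjJ : j ≤ J := hj1.trans (le_max_right _ _)
    have hjJ' : (j : ℝ) ≤ J := by exact_mod_cast hjJ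
    have hjX : (j : ℝ) ≤ X := le_trans (by exact_mod_cast hj1) hj₁X
    have hj1' : (1 : ℝ) ≤ j := by exact_mod_cast hj₀.trans hj0
    have hpow : (j : ℝ) ^ (ν + 1 / 2) ≤ X ^ (ν + 1 / 2) := by gcongr
    exact detail_risk_le (Λ := Λ) hφM hψM hφ hψ hψ0 hT hν hr hγ hα hn (hj₀.trans hj0) hm hε0 hp hq
      hs hε hL hLL hf
      (hbase _ hQψ _ hjJ) (hQS.trans hQn1) (hbase _ hQq _ hjJ)
      (by
        refine le_trans ?_ hQn
        exact mul_le_mul hQγ (hjJ'.trans (le_add_of_nonneg_right zero_le_one)) (by positivity)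
          (zero_le_one.trans hQ1))
      (hB1.trans hΛB)
      (hBL.trans hΛB)
      (by
        calc (j : ℝ) ^ ν ≤ (j : ℝ) ^ (ν + 1 / 2) :=
              Real.rpow_le_rpow_of_exponent_le hj1' (by linarith)
          _ ≤ X ^ (ν + 1 / 2) := hpow
          _ ≤ Λ := le_mul_of_one_le_left (by positivity) hB1)
      (by
        calc 4 * (Lmax + S) * (γ * (j : ℝ) ^ (ν + 1 / 2))
            = 4 * (Lmax + S) * γ * (j : ℝ) ^ (ν + 1 / 2) := by ring
          _ ≤ B * X ^ (ν + 1 / 2) := mul_le_mul hBS hpow (by positivity) (by positivity))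
  set E2 := sumConst A (supNorm ψ) r * thresholdConst r V S γ * (2 * countConst A T) *
    (Λ ^ r * R) with hE2
  have hE20 : 0 ≤ E2 := by
    have := thresholdConst_nonneg (V := V) hr0.le hS0 hγ0
    positivity
  have hcard : (((Finset.Icc j₀ j₁).card : ℕ) : ℝ) ≤ 2 * X := by
    rw [Nat.card_Icc]
    have : ((j₁ + 1 - j₀ : ℕ) : ℝ) ≤ ((j₁ + 1 : ℕ) : ℝ) := by exact_mod_cast Nat.sub_le _ _
    push_cast at this
    linarith
  have I2' : (((Finset.Icc j₀ j₁).card : ℝ) ^ (r - 1)) * ((Finset.Icc j₀ j₁).card * E2) ≤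
      K2 * (Y * R) := by
    calc (((Finset.Icc j₀ j₁).card : ℝ) ^ (r - 1)) * ((Finset.Icc j₀ j₁).card * E2)
        ≤ (2 * X) ^ (r - 1) * ((2 * X) * E2) := by gcongr
      _ = ((2 * X) ^ (r - 1) * (2 * X) ^ (1 : ℝ)) * E2 := by rw [Real.rpow_one]; ring
      _ = (2 * X) ^ r * E2 := by rw [← Real.rpow_add (by linarith), sub_add_cancel]
      _ = K2 * (Y * R) := by
          -- The exponent `r (ν + 3/2)` has two sources: `r` from the number of levels and `r (ν +
          -- 1/2)` from the logarithm in the threshold.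
          have e3 : X ^ r * (X ^ (ν + 1 / 2)) ^ r = Y := by
            rw [← Real.rpow_mul (by linarith), ← Real.rpow_add (by linarith), hY]
            ring_nf
          rw [hE2, hK2, hΛ, Real.mul_rpow (by linarith) (by linarith),
            Real.mul_rpow (by linarith) (by linarith), Real.mul_rpow (by norm_num) (by linarith),
            ← e3]
          ring
  have hσ := reducedSmoothness_lower (r := r) hs hε
  have hσ1 : 0 < reducedSmoothness s p r := lt_of_lt_of_le hσ₀0 hσ
  have I3 := lintegral_sub_waveletProj_rpow_le hφM hψM hφ hψ hT hp hq hL hr hσ1 hf.2.1 hf.2.2.2.1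
    hf.2.2.2.2 (max j₀ (j₁ + 1))
  set σ := reducedSmoothness s p r with hσd
  set M := max j₀ (j₁ + 1) with hM
  have hexp : (2 : ℝ) ^ (-σ) ≤ (2 : ℝ) ^ (-σ₀) :=
    Real.rpow_le_rpow_of_exponent_le (by norm_num) (by linarith)
  have I3' : (sumConst A (supNorm ψ) r ^ (1 / r) * (countConst A T * L) *
        ((2 : ℝ) ^ (-((M : ℝ) * σ)) / (1 - (2 : ℝ) ^ (-σ)))) ^ r ≤
      K3 * (Y * (2 : ℝ) ^ (-((M : ℝ) * (r * σ)))) := by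
    have hd : 0 < 1 - (2 : ℝ) ^ (-σ) := by linarith
    have e4 : (2 : ℝ) ^ (-((M : ℝ) * (r * σ))) = ((2 : ℝ) ^ (-((M : ℝ) * σ))) ^ r := by
      rw [← Real.rpow_mul (by norm_num)]
      ring_nf
    calc _ ≤ ((sumConst A (supNorm ψ) r ^ (1 / r) * (countConst A T * Lmax) *
          (1 / (1 - (2 : ℝ) ^ (-σ₀)))) * (2 : ℝ) ^ (-((M : ℝ) * σ))) ^ r := by
          apply Real.rpow_le_rpow (by positivity) _ hr0.le
          calc _ = (sumConst A (supNorm ψ) r ^ (1 / r) * (countConst A T * L) *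
              (1 / (1 - (2 : ℝ) ^ (-σ)))) * (2 : ℝ) ^ (-((M : ℝ) * σ)) := by ring
            _ ≤ _ := by gcongr
      _ = K3 * (2 : ℝ) ^ (-((M : ℝ) * (r * σ))) := by
          rw [Real.mul_rpow (by positivity) (by positivity), ← e4]
      _ ≤ _ := by
          gcongr
          exact le_mul_of_one_le_left (by positivity) hXr
  have J1 := I1.trans (ENNReal.ofReal_le_ofReal I1')
  have J2 := card_rpow_mul_sum_le hr _ I2 I2'
  have J3 := I3.trans (ENNReal.ofReal_le_ofReal I3')
  exact (risk_le_sum hφM hψM hφ hψ hr hf _).trans (four_rpow_mul_add_le hK10 hK20 hK30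
    (zero_le_one.trans hXr) (by positivity) hRpos.le (by positivity) J1 J2 J3)

end Risk

/-! ### The resolution levels -/

lemma le_const_mul_log {c : ℝ} {n j : ℕ} (hc : 1 ≤ c) (hl : 1 ≤ Real.log n)
    (h : (2 : ℝ) ^ j ≤ c * n) : (j : ℝ) ≤ (Real.log c + 1) / Real.log 2 * Real.log n := by
  have hn : (0 : ℝ) < n := by
    by_contra! h0
    have : n = 0 := by exact_mod_cast le_antisymm h0 n.cast_nonneg
    norm_num [this] at hl
  have h2 : 0 < Real.log 2 := Real.log_pos (by norm_num)
  have h1 := Real.log_le_log (by positivity) h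
  rw [Real.log_pow, Real.log_mul (by linarith) hn.ne'] at h1
  rw [div_mul_eq_mul_div, le_div_iff₀ h2]
  nlinarith [Real.log_nonneg hc]

/-- The cut-off produces `log m`, which must be traded for `log n` although `α` may be so large that
`m` is no power of `n`. For `m ≤ n³` one has `log m ≤ 3 log n`. Otherwise `log m ≤ 3 m^{1/3}`, so
`(log m)/m` is at most `3 n^{-2}`. -/
lemma two_rpow_neg_le_max {c : ℝ} {n j : ℕ} {m : ℝ} (hc : 1 ≤ c) (hl : 1 ≤ Real.log n)
    (hm : 1 ≤ m) (hlm : 1 ≤ Real.log m) (h : m / Real.log m ≤ c * (2 : ℝ) ^ (2 * j)) :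
    (2 : ℝ) ^ (-(j : ℝ)) ≤ 3 * c * Real.log n * max ((n : ℝ) ^ (-1 : ℝ)) (m ^ (-(1 / 2) : ℝ)) := by
  have hn : (0 : ℝ) < n := by
    by_contra! h0
    have : n = 0 := by exact_mod_cast le_antisymm h0 n.cast_nonneg
    norm_num [this] at hl
  have hm0 : 0 < m := by linarith
  set l := Real.log n with hldef
  set M := max ((n : ℝ) ^ (-1 : ℝ)) (m ^ (-(1 / 2) : ℝ)) with hM
  have hM0 : 0 < M := lt_max_of_lt_left (by positivity)
  have h1 : (2 : ℝ) ^ (-(j : ℝ)) * (2 : ℝ) ^ (-(j : ℝ)) ≤ c * (Real.log m / m) := by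
    rw [← Real.rpow_add (by norm_num)]
    have e : (2 : ℝ) ^ (2 * j) = ((2 : ℝ) ^ (-(j : ℝ) + -(j : ℝ)))⁻¹ := by
      rw [← Real.rpow_neg (by norm_num), ← Real.rpow_natCast]
      push_cast
      ring_nf
    rw [e, div_le_iff₀ (by linarith)] at h
    have h5 : 0 < (2 : ℝ) ^ (-(j : ℝ) + -(j : ℝ)) := by positivity
    rw [mul_div_assoc', le_div_iff₀ hm0]
    calc _ ≤ (2 : ℝ) ^ (-(j : ℝ) + -(j : ℝ)) *
          (c * ((2 : ℝ) ^ (-(j : ℝ) + -(j : ℝ)))⁻¹ * Real.log m) := by gcongr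
      _ = c * Real.log m * ((2 : ℝ) ^ (-(j : ℝ) + -(j : ℝ)) *
          ((2 : ℝ) ^ (-(j : ℝ) + -(j : ℝ)))⁻¹) := by ring
      _ = _ := by rw [mul_inv_cancel₀ h5.ne', mul_one]
  have h2 : Real.log m / m ≤ 3 * l * (M * M) := by
    rcases le_total m ((n : ℝ) ^ 3) with h3 | h3
    · have h4 : Real.log m ≤ 3 * l := by
        have := Real.log_le_log hm0 h3
        rwa [Real.log_pow] at this
      have h5 : 1 / m ≤ M * M := by
        have e : 1 / m = m ^ (-(1 / 2) : ℝ) * m ^ (-(1 / 2) : ℝ) := by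
          rw [← Real.rpow_add hm0, one_div, ← Real.rpow_neg_one]
          norm_num
        rw [e]
        exact mul_le_mul (le_max_right _ _) (le_max_right _ _) (by positivity) hM0.le
      calc Real.log m / m = Real.log m * (1 / m) := by ring
        _ ≤ _ := by gcongr
    · have h4 : Real.log m ≤ 3 * m ^ (1 / 3 : ℝ) := by
        have := Real.log_le_rpow_div hm0.le (ε := 1 / 3) (by norm_num)
        linarith
      have h5 : m ^ (-(2 / 3) : ℝ) ≤ M * M := by
        have e : m ^ (-(2 / 3) : ℝ) ≤ ((n : ℝ) ^ 3) ^ (-(2 / 3) : ℝ) :=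
          Real.rpow_le_rpow_of_nonpos (by positivity) h3 (by norm_num)
        have e2 : ((n : ℝ) ^ 3) ^ (-(2 / 3) : ℝ) = (n : ℝ) ^ (-1 : ℝ) * (n : ℝ) ^ (-1 : ℝ) := by
          rw [← Real.rpow_natCast, ← Real.rpow_mul hn.le, ← Real.rpow_add hn]
          norm_num
        exact (e.trans e2.le).trans
          (mul_le_mul (le_max_left _ _) (le_max_left _ _) (by positivity) hM0.le)
      have e3 : m ^ (1 / 3 : ℝ) / m = m ^ (-(2 / 3) : ℝ) := by
        rw [← Real.rpow_sub_one hm0.ne']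
        norm_num
      calc Real.log m / m ≤ 3 * m ^ (1 / 3 : ℝ) / m := by gcongr
        _ = 3 * 1 * m ^ (-(2 / 3) : ℝ) := by rw [mul_div_assoc, e3, mul_one]
        _ ≤ _ := by gcongr
  have h6 : 1 ≤ 3 * c * l := by nlinarith
  refine abs_le_of_sq_le_sq' ?_ (by positivity) |>.2
  calc ((2 : ℝ) ^ (-(j : ℝ))) ^ 2 = (2 : ℝ) ^ (-(j : ℝ)) * (2 : ℝ) ^ (-(j : ℝ)) := sq _
    _ ≤ c * (3 * l * (M * M)) := h1.trans (by gcongr)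
    _ = 3 * c * l * (M * M) := by ring
    _ ≤ (3 * c * l) * (3 * c * l) * (M * M) := by
        refine mul_le_mul_of_nonneg_right ?_ (by positivity)
        exact le_mul_of_one_le_left (zero_le_one.trans h6) h6
    _ = _ := by ring

/-- The coarse level balances noise for smoothness `a`: the exponents reduce to `(1/(2a+1) - 1)/2 =
-a/(2a+1)` and `1/(2a+2) - 1/2 = -a/(2a+2)`. -/
lemma coarse_error_le {a c α : ℝ} {n j : ℕ} (ha : 0 < a) (hc : 1 ≤ c) (hn : 0 < n) (hα : 0 < α)
    (h : (2 : ℝ) ^ j ≤ c * min (((n : ℝ) * α ^ 2) ^ (1 / (2 * a + 2)))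
      ((n : ℝ) ^ (1 / (2 * a + 1)))) :
    (2 : ℝ) ^ ((j : ℝ) / 2) * noiseLevel α n j ≤
      c * max ((n : ℝ) ^ (-(a / (2 * a + 1)))) (((n : ℝ) * α ^ 2) ^ (-(a / (2 * a + 2)))) := by
  have hn0 : (0 : ℝ) < n := by exact_mod_cast hn
  have hm0 : 0 < (n : ℝ) * α ^ 2 := by positivity
  set m := (n : ℝ) * α ^ 2
  rw [two_rpow_half_mul_noiseLevel hα, Real.rpow_natCast, mul_max_of_nonneg _ _ (by linarith)]
  have h1 : (2 : ℝ) ^ j ≤ c * (n : ℝ) ^ (1 / (2 * a + 1)) := h.trans (by gcongr; exact min_le_right _ _)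
  have h2 : (2 : ℝ) ^ j ≤ c * m ^ (1 / (2 * a + 2)) := h.trans (by gcongr; exact min_le_left _ _)
  refine max_le_max ?_ ?_
  · have hc2 : c ^ ((1 : ℝ) / 2) ≤ c := by
      calc c ^ ((1 : ℝ) / 2) ≤ c ^ (1 : ℝ) := Real.rpow_le_rpow_of_exponent_le hc (by norm_num)
        _ = c := Real.rpow_one c
    calc ((2 : ℝ) ^ j) ^ ((1 : ℝ) / 2) / (n : ℝ) ^ (1 / 2 : ℝ)
        ≤ (c * (n : ℝ) ^ (1 / (2 * a + 1))) ^ ((1 : ℝ) / 2) / (n : ℝ) ^ (1 / 2 : ℝ) := by gcongr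
      _ = c ^ ((1 : ℝ) / 2) * (n : ℝ) ^ (-(a / (2 * a + 1))) := by
          rw [Real.mul_rpow (by linarith) (by positivity), ← Real.rpow_mul hn0.le, mul_div_assoc,
            ← Real.rpow_sub hn0]
          congr 2
          field_simp
          ring
      _ ≤ _ := by gcongr
  · calc ((2 : ℝ) ^ j) ^ ((2 : ℝ) / 2) / m ^ (1 / 2 : ℝ)
        ≤ (c * m ^ (1 / (2 * a + 2))) / m ^ (1 / 2 : ℝ) := by
          rw [div_self (by norm_num), Real.rpow_one]
          gcongr
      _ = c * m ^ (-(a / (2 * a + 2))) := by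
          rw [mul_div_assoc, ← Real.rpow_sub hm0]
          congr 2
          field_simp
          ring

lemma mul_two_rpow_half_le_sqrt {Q x : ℝ} {j : ℕ} (h : Q ^ 2 * (2 : ℝ) ^ j ≤ x) :
    Q * (2 : ℝ) ^ ((j : ℝ) / 2) ≤ Real.sqrt x := by
  refine Real.le_sqrt_of_sq_le (le_trans (le_of_eq ?_) h)
  rw [mul_pow, ← Real.rpow_natCast ((2 : ℝ) ^ ((j : ℝ) / 2)) 2, ← Real.rpow_mul (by norm_num), ← Real.rpow_natCast _ j]
  norm_num

/-- The properties of the resolution levels that the risk bound requires. -/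
lemma exists_eventually_levels {N : ℕ} {α : ℕ → ℝ} (hα : ∀ n, 0 < α n)
    (hnα : Tendsto (fun n : ℕ => (n : ℝ) * α n ^ 2) atTop atTop)
    {j₀ j₁' j₁'' : ℕ → ℕ}
    (hj₀ : (fun n : ℕ => (2 : ℝ) ^ j₀ n) =Θ[atTop] fun n : ℕ =>
      min (((n : ℝ) * α n ^ 2) ^ (1 / (2 * ((N : ℝ) + 1) + 2)))
        ((n : ℝ) ^ (1 / (2 * ((N : ℝ) + 1) + 1))))
    (hj₁' : (fun n : ℕ => (2 : ℝ) ^ j₁' n) =Θ[atTop] fun n : ℕ => (n : ℝ) / Real.log n)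
    (hj₁'' : (fun n : ℕ => (2 : ℝ) ^ (2 * j₁'' n)) =Θ[atTop] fun n : ℕ =>
      (n : ℝ) * α n ^ 2 / Real.log ((n : ℝ) * α n ^ 2)) (Q : ℝ) :
    ∃ c : ℝ, 1 ≤ c ∧ ∀ᶠ n : ℕ in atTop, 0 < n ∧ 1 ≤ (n : ℝ) * α n ^ 2 ∧ 1 ≤ Real.log n ∧
      1 ≤ Real.log ((n : ℝ) * α n ^ 2) ∧ 1 ≤ j₀ n ∧ (j₀ n : ℝ) ≤ c * Real.log n ∧
      ((min (j₁' n) (j₁'' n) : ℕ) : ℝ) ≤ c * Real.log n ∧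
      Q * (2 : ℝ) ^ (((max (j₀ n) (min (j₁' n) (j₁'' n)) : ℕ) : ℝ) / 2) ≤ Real.sqrt n ∧
      (2 : ℝ) ^ (-((min (j₁' n) (j₁'' n) : ℕ) : ℝ)) ≤ c * Real.log n *
        max ((n : ℝ) ^ (-1 : ℝ)) (((n : ℝ) * α n ^ 2) ^ (-(1 / 2) : ℝ)) ∧
      (2 : ℝ) ^ ((j₀ n : ℝ) / 2) * noiseLevel (α n) n (j₀ n) ≤
        c * max ((n : ℝ) ^ (-(((N : ℝ) + 1) / (2 * ((N : ℝ) + 1) + 1))))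
          (((n : ℝ) * α n ^ 2) ^ (-(((N : ℝ) + 1) / (2 * ((N : ℝ) + 1) + 2)))) := by
  have ha : (0 : ℝ) < (N : ℝ) + 1 := by positivity
  set a := (N : ℝ) + 1 with hadef
  obtain ⟨c1, hc1, h1⟩ := hj₀.1.exists_pos
  obtain ⟨c2, hc2, h2⟩ := hj₀.2.exists_pos
  obtain ⟨c3, hc3, h3⟩ := hj₁'.1.exists_pos
  obtain ⟨c4, hc4, h4⟩ := hj₁'.2.exists_pos
  obtain ⟨c5, hc5, h5⟩ := hj₁''.2.exists_pos
  set d := 1 + c1 + c3 + c4 + c5 with hd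
  have hd1 : 1 ≤ d := by linarith
  have hlogd := Real.log_nonneg hd1
  have h2pos : 0 < Real.log 2 := Real.log_pos (by norm_num)
  set e := (Real.log d + 1) / Real.log 2 with he
  have he0 : 0 ≤ e := by positivity
  refine ⟨3 * d + e, by linarith, ?_⟩
  have hnat := tendsto_natCast_atTop_atTop (R := ℝ)
  have hlog : Tendsto (fun n : ℕ => Real.log n) atTop atTop := Real.tendsto_log_atTop.comp hnat
  have hlogm := Real.tendsto_log_atTop.comp hnα
  have hmin : Tendsto (fun n : ℕ => min (((n : ℝ) * α n ^ 2) ^ (1 / (2 * a + 2)))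
      ((n : ℝ) ^ (1 / (2 * a + 1)))) atTop atTop :=
    tendsto_atTop.2 fun x =>
      ((((tendsto_rpow_atTop (by positivity)).comp hnα).eventually_ge_atTop x).and
        (((tendsto_rpow_atTop (by positivity)).comp hnat).eventually_ge_atTop x)).mono
          fun _ h => le_min h.1 h.2
  have hpow : Tendsto (fun n : ℕ => (n : ℝ) ^ (1 - 1 / (2 * a + 1))) atTop atTop := by
    refine (tendsto_rpow_atTop ?_).comp hnat
    rw [sub_pos, div_lt_one (by positivity)]
    linarith
  filter_upwards [h1.bound, h2.bound, h3.bound, h4.bound, h5.bound, eventually_gt_atTop 0,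
    hnα.eventually_ge_atTop 1, hlog.eventually_ge_atTop 1, hlogm.eventually_ge_atTop 1,
    hmin.eventually_gt_atTop c2, hpow.eventually_ge_atTop (Q ^ 2 * d),
    hlog.eventually_ge_atTop (Q ^ 2 * d)] with n b1 b2 b3 b4 b5 hn hm hl hlm hmin hpow hlogQ
  have hn0 : (0 : ℝ) < n := by exact_mod_cast hn
  have hn1 : (1 : ℝ) ≤ n := by exact_mod_cast hn
  have hm0 : 0 < (n : ℝ) * α n ^ 2 := by linarith
  simp only [Function.comp_apply] at hlm
  set m := (n : ℝ) * α n ^ 2 with hmdef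
  set l := Real.log n with hldef
  have hminpos : 0 < min (m ^ (1 / (2 * a + 2))) ((n : ℝ) ^ (1 / (2 * a + 1))) := hc2.trans hmin
  rw [Real.norm_of_nonneg (by positivity), Real.norm_of_nonneg hminpos.le] at b1
  rw [Real.norm_of_nonneg hminpos.le, Real.norm_of_nonneg (by positivity)] at b2
  rw [Real.norm_of_nonneg (by positivity), Real.norm_of_nonneg (by positivity)] at b3
  rw [Real.norm_of_nonneg (by positivity), Real.norm_of_nonneg (by positivity)] at b4
  rw [Real.norm_of_nonneg (by positivity), Real.norm_of_nonneg (by positivity)] at b5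
  have B1 : (2 : ℝ) ^ j₀ n ≤ d * min (m ^ (1 / (2 * a + 2))) ((n : ℝ) ^ (1 / (2 * a + 1))) :=
    b1.trans (by gcongr; linarith)
  have B1' : (2 : ℝ) ^ j₀ n ≤ d * (n : ℝ) ^ (1 / (2 * a + 1)) :=
    B1.trans (by gcongr; exact min_le_right _ _)
  have B1n : (2 : ℝ) ^ j₀ n ≤ d * n := by
    refine B1'.trans ?_
    gcongr
    have he1 : 1 / (2 * a + 1) ≤ 1 := by
      rw [div_le_one (by positivity)]
      linarith
    exact (Real.rpow_le_rpow_of_exponent_le hn1 he1).trans_eq (Real.rpow_one _)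
  have B3 : (2 : ℝ) ^ j₁' n ≤ d * (n / l) := b3.trans (by gcongr; linarith)
  have B3n : (2 : ℝ) ^ j₁' n ≤ d * n := B3.trans (by gcongr; exact div_le_self hn0.le hl)
  have B4 : n / l ≤ d * (2 : ℝ) ^ j₁' n := b4.trans (by gcongr; linarith)
  have B5 : m / Real.log m ≤ d * (2 : ℝ) ^ (2 * j₁'' n) := b5.trans (by gcongr; linarith)
  have hmax : 0 < max ((n : ℝ) ^ (-1 : ℝ)) (m ^ (-(1 / 2) : ℝ)) :=
    lt_max_of_lt_left (by positivity)
  refine ⟨hn, hm, hl, hlm, ?_, ?_, ?_, ?_, ?_, ?_⟩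
  -- If `j₀ = 0`, the lower half of the relation for `2^{j₀}` would keep the minimum below `c2`, but
  -- it tends to infinity.
  · by_contra! h0
    have : j₀ n = 0 := by omega
    rw [this, pow_zero, mul_one] at b2
    exact absurd hmin (not_lt.2 b2)
  · exact (le_const_mul_log hd1 hl B1n).trans (by gcongr; linarith)
  · refine (le_trans (by exact_mod_cast min_le_left _ _) (le_const_mul_log hd1 hl B3n)).trans ?_
    gcongr
    linarith
  · apply mul_two_rpow_half_le_sqrt
    -- Since `j₁ ≤ j₁'`, only `j₁'` matters besides `j₀`. The logarithm in `2^{j₁'} ≍ n / log n` is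
    -- what beats the constant `Q² d`.
    have hJ : (2 : ℝ) ^ (max (j₀ n) (min (j₁' n) (j₁'' n))) ≤
        max ((2 : ℝ) ^ j₀ n) ((2 : ℝ) ^ j₁' n) := by
      rcases max_cases (j₀ n) (min (j₁' n) (j₁'' n)) with ⟨h, _⟩ | ⟨h, _⟩ <;> rw [h]
      · exact le_max_left _ _
      · exact le_trans (pow_le_pow_right₀ (by norm_num) (min_le_left _ _)) (le_max_right _ _)
    have hQ2 := sq_nonneg Q
    refine (mul_le_mul_of_nonneg_left hJ hQ2).trans ?_
    rw [mul_max_of_nonneg _ _ hQ2]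
    refine max_le ?_ ?_
    · calc Q ^ 2 * (2 : ℝ) ^ j₀ n ≤ Q ^ 2 * (d * (n : ℝ) ^ (1 / (2 * a + 1))) := by gcongr
        _ = Q ^ 2 * d * (n : ℝ) ^ (1 / (2 * a + 1)) := by ring
        _ ≤ (n : ℝ) ^ (1 - 1 / (2 * a + 1)) * (n : ℝ) ^ (1 / (2 * a + 1)) := by gcongr
        _ = n := by rw [← Real.rpow_add hn0, sub_add_cancel, Real.rpow_one]
    · calc Q ^ 2 * (2 : ℝ) ^ j₁' n ≤ Q ^ 2 * (d * (n / l)) := by gcongr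
        _ = Q ^ 2 * d * (n / l) := by ring
        _ ≤ l * (n / l) := by gcongr
        _ = n := mul_div_cancel₀ _ (by linarith)
  · have t1 : (2 : ℝ) ^ (-(j₁' n : ℝ)) ≤
        3 * d * l * max ((n : ℝ) ^ (-1 : ℝ)) (m ^ (-(1 / 2) : ℝ)) := by
      rw [div_le_iff₀ (by linarith)] at B4
      rw [Real.rpow_neg (by norm_num), Real.rpow_natCast]
      calc ((2 : ℝ) ^ j₁' n)⁻¹ ≤ d * l * (n : ℝ) ^ (-1 : ℝ) := by
            rw [Real.rpow_neg_one, ← div_eq_mul_inv, le_div_iff₀ hn0,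
              inv_mul_le_iff₀ (by positivity)]
            linarith
        _ ≤ 3 * d * l * max ((n : ℝ) ^ (-1 : ℝ)) (m ^ (-(1 / 2) : ℝ)) := by
            gcongr
            · linarith
            · exact le_max_left _ _
    have t2 := two_rpow_neg_le_max hd1 hl hm hlm B5
    have t3 : (2 : ℝ) ^ (-((min (j₁' n) (j₁'' n) : ℕ) : ℝ)) ≤
        3 * d * l * max ((n : ℝ) ^ (-1 : ℝ)) (m ^ (-(1 / 2) : ℝ)) := by
      rcases min_cases (j₁' n) (j₁'' n) with ⟨h, _⟩ | ⟨h, _⟩ <;> rw [h] <;> assumption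
    refine t3.trans ?_
    gcongr
    linarith
  · refine (coarse_error_le ha hd1 hn (hα n) B1).trans ?_
    have : 0 < max ((n : ℝ) ^ (-(a / (2 * a + 1)))) (m ^ (-(a / (2 * a + 2)))) :=
      lt_max_of_lt_left (by positivity)
    gcongr
    linarith

/-! ### Comparison with the rate -/

section Rate

variable {r s p n m : ℝ}

/-- The dense conditions for `e = 1` and `e = 2` are `p > r/(2s+1)` and `p > r/(s+1)`; in the middle
regime only the privacy term is sparse. Dividing by a logarithm that is at least `1` enlarges a
negative power. -/
lemma baseRate_le_rate (hp : 1 ≤ p) (hs : 1 / p < s) (hr : 1 ≤ r) (hn : 0 < n) (hm : 0 < m)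
    (hln : 1 ≤ Real.log n) (hlm : 1 ≤ Real.log m) : baseRate r s p n m ≤ rate r s p n m := by
  have hp0 : 0 < p := by linarith
  have hr0 : 0 < r := by linarith
  have hs0 : 0 < s := lt_trans (by positivity) hs
  have hlogdiv : ∀ x y : ℝ, 0 < x → 1 ≤ Real.log x → 0 ≤ y →
      x ^ (-y) ≤ (x / Real.log x) ^ (-y) := fun x y hx hl hy =>
    Real.rpow_le_rpow_of_nonpos (by positivity) (div_le_self hx.le hl) (by linarith)
  have hsp : ∀ e : ℝ, 0 < e → 0 ≤ r * (s - 1 / p + 1 / r) / (2 * (s - 1 / p) + e) := by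
    intro e he
    have h1 : 0 < s - 1 / p := by linarith
    positivity
  have c1 : r / (2 * s + 1) < p ↔ 1 * r < p * (2 * s + 1) := by
    rw [div_lt_iff₀ (by linarith), one_mul]
  have c2 : r / (s + 1) < p ↔ 2 * r < p * (2 * s + 2) := by
    rw [div_lt_iff₀ (by linarith)]
    constructor <;> intro h <;> linarith
  unfold baseRate rate rateExponent
  by_cases h2 : r / (s + 1) < p
  · have h1 : r / (2 * s + 1) < p :=
      lt_of_le_of_lt (div_le_div_of_nonneg_left hr0.le (by linarith) (by linarith)) h2
    rw [if_pos h2, if_pos (c1.1 h1), if_pos (c2.1 h2)]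
  · rw [if_neg h2, if_neg (fun h => h2 (c2.2 h))]
    by_cases h1 : r / (2 * s + 1) < p
    · rw [if_pos h1, if_pos (c1.1 h1)]
      exact max_le_max le_rfl (hlogdiv m _ hm hlm (hsp 2 two_pos))
    · rw [if_neg h1, if_neg (fun h => h1 (c1.2 h))]
      exact max_le_max (hlogdiv n _ hn hln (hsp 1 one_pos)) (hlogdiv m _ hm hlm (hsp 2 two_pos))

/-- The dense exponent increases with the smoothness and dominates the exponent of the rate, so
tuning `j₀` to the largest smoothness `a` is harmless for every `s ≤ a`. -/
lemma coarse_rate_le_baseRate {a : ℝ} (hp : 1 ≤ p) (hs : 1 / p < s) (hsa : s ≤ a) (hr : 1 ≤ r)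
    (hn : 1 ≤ n) (hm : 1 ≤ m) :
    max (n ^ (-(a / (2 * a + 1)))) (m ^ (-(a / (2 * a + 2)))) ^ r ≤ baseRate r s p n m := by
  have hs0 : 0 < s := lt_trans (by positivity) hs
  have hexp : ∀ e : ℝ, 0 < e → rateExponent e s p r ≤ a / (2 * a + e) * r := fun e he =>
    ((rateExponent_le_dense he hp hs hr).trans (dense_mono he hs0 hsa hr)).trans_eq (by ring)
  rw [max_rpow_of_nonneg (by positivity) (by positivity) (by linarith), ← Real.rpow_mul (by linarith),
    ← Real.rpow_mul (by linarith), neg_mul, neg_mul]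
  exact max_le_max
    (Real.rpow_le_rpow_of_exponent_le hn (neg_le_neg (hexp 1 one_pos)))
    (Real.rpow_le_rpow_of_exponent_le hm (neg_le_neg (hexp 2 two_pos)))

lemma bias_rate_le_baseRate (hp : 1 ≤ p) (hs : 1 / p < s) (hr : 1 ≤ r)
    (hσ : 0 < reducedSmoothness s p r) (hn : 1 ≤ n) (hm : 1 ≤ m) :
    max (n ^ (-1 : ℝ)) (m ^ (-(1 / 2) : ℝ)) ^ (r * reducedSmoothness s p r) ≤
      baseRate r s p n m := by
  have h1 := rateExponent_le_reducedSmoothness one_pos hp hs hr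
  have h2 := rateExponent_le_reducedSmoothness two_pos hp hs hr
  rw [max_rpow_of_nonneg (by positivity) (by positivity) (by positivity),
    ← Real.rpow_mul (by linarith), ← Real.rpow_mul (by linarith)]
  exact max_le_max (Real.rpow_le_rpow_of_exponent_le hn (by linarith))
    (Real.rpow_le_rpow_of_exponent_le hm (by linarith))

end Rate

end PrivateWavelet

/-! ### The upper bound, assembled -/

theorem theorem5p1
    (φ ψ : ℝ → ℝ) (N : ℕ) (hN : 0 < N) (A T ν r γ Lmin Lmax : ℝ)
    (hφ : PrivateWavelet.FatherWavelet φ N) (hψ : PrivateWavelet.IsMotherWavelet φ ψ)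
    (hφm : Measurable φ) (hψm : Measurable ψ)
    (hφA : Function.support φ ⊆ Set.Icc (-A) A) (hψA : Function.support ψ ⊆ Set.Icc (-A) A)
    (hT : 0 < T) (hν : 1 < ν) (hr : 1 ≤ r) (hγ : r * (N + 1) ≤ γ)
    (hLmin : 0 < Lmin) (hL : Lmin ≤ Lmax)
    (α : ℕ → ℝ) (hα : ∀ n, 0 < α n)
    (hnα : Tendsto (fun n : ℕ => (n : ℝ) * α n ^ 2) atTop atTop)
    (j₀ j₁' j₁'' : ℕ → ℕ)
    (hj₀ : (fun n : ℕ => (2 : ℝ) ^ j₀ n) =Θ[atTop] fun n : ℕ =>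
      min (((n : ℝ) * α n ^ 2) ^ (1 / (2 * ((N : ℝ) + 1) + 2)))
        ((n : ℝ) ^ (1 / (2 * ((N : ℝ) + 1) + 1))))
    (hj₁' : (fun n : ℕ => (2 : ℝ) ^ j₁' n) =Θ[atTop] fun n : ℕ => (n : ℝ) / Real.log n)
    (hj₁'' : (fun n : ℕ => (2 : ℝ) ^ (2 * j₁'' n)) =Θ[atTop] fun n : ℕ =>
      (n : ℝ) * α n ^ 2 / Real.log ((n : ℝ) * α n ^ 2)) :
    ∃ C : ℝ, ∀ ε : ℝ, 0 < ε → ∃ (C₀ : ℝ) (n₀ : ℕ), ∀ n : ℕ, n₀ ≤ n →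
      ∀ s p q L : ℝ, 1 ≤ p → 1 ≤ q → 1 / p < s → s < N + 1 → ε ≤ s → Lmin ≤ L → L ≤ Lmax →
        ∀ f ∈ PrivateWavelet.densityClass φ ψ s p q L T,
          PrivateWavelet.risk φ ψ A T ν (α n) (j₀ n) (min (j₁' n) (j₁'' n))
            (fun j => 4 * (Lmax + PrivateWavelet.noiseConst ψ A ν) *
              PrivateWavelet.thresh γ ν (α n) n j) n r f
        ≤ ENNReal.ofReal (C₀ * Real.log n ^ C *
            PrivateWavelet.rate r s p n ((n : ℝ) * α n ^ 2)) := by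
  obtain ⟨b, hφb⟩ := hφ.exists_boundedGenerator hφm hφA
  obtain ⟨b', hψb⟩ := hψ.exists_bound hφ.mra.toOrthonormalTranslates hφb hψA
  have hφg := hφb.toSupNorm
  have hψg : PrivateWavelet.BoundedGenerator ψ A (PrivateWavelet.supNorm ψ) :=
    PrivateWavelet.BoundedGenerator.toSupNorm ⟨hψm, hψA, hψb, hφb.width_nonneg⟩
  have hψ0 := PrivateWavelet.supNorm_pos hψ.toOrthonormalTranslates hψb
  have hN1 : (1 : ℝ) ≤ N := by exact_mod_cast hN
  have hr0 : 0 < r := by linarith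
  -- Since `N ≥ 1`, the hypothesis `γ ≥ r (N + 1)` supplies the deviation condition `γ ≥ 2r`.
  have hγ2 : 2 * r ≤ γ := by nlinarith
  obtain ⟨Q, hQ⟩ := PrivateWavelet.exists_risk_le hφ.mra hψ hφg hψg hψ0 hT hν hr hγ2
    (hLmin.le.trans hL)
  obtain ⟨c, hc, hev⟩ := PrivateWavelet.exists_eventually_levels hα hnα hj₀ hj₁' hj₁'' Q
  obtain ⟨n₀, hn₀⟩ := eventually_atTop.1 hev
  -- The first summand comes from the finite sample bound. The second pays for the logarithm in
  -- `2^{-j₁}`, which is raised to `r` times the reduced smoothness, at most `r (N + 1)`. Neither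
  -- depends on `ε`.
  refine ⟨r * (ν + 3 / 2) + r * (N + 1), fun ε hε => ?_⟩
  obtain ⟨K, hK, hrisk⟩ := hQ ε hε
  refine ⟨3 * K * c ^ (r * (ν + 3 / 2) + r * (N + 1)), n₀, ?_⟩
  intro n hn s p q L hp hq hs hsN hεs hL1 hL2 f hf
  obtain ⟨hn0, hm, hl, hlm, hj01, hj0X, hj1X, hbig, hbias, hcoarse⟩ := hn₀ n hn
  have hn1 : (1 : ℝ) ≤ n := by exact_mod_cast hn0
  have hX : 1 ≤ c * Real.log n := one_le_mul_of_one_le_of_one_le hc hl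
  have hσ : 0 < PrivateWavelet.reducedSmoothness s p r :=
    lt_of_lt_of_le (lt_min hε (by positivity)) (PrivateWavelet.reducedSmoothness_lower hs hεs)
  have hσs := PrivateWavelet.reducedSmoothness_le (s := s) hp hr
  refine (hrisk (α n) (c * Real.log n) s p q L n (j₀ n) (min (j₁' n) (j₁'' n)) f (hα n) hn0 hm hj01
    hX hj0X hj1X hbig hp hq hs hεs (hLmin.le.trans hL1) hL2 hf).trans (ENNReal.ofReal_le_ofReal ?_)
  set m := (n : ℝ) * α n ^ 2
  set l := Real.log n
  set R := PrivateWavelet.baseRate r s p n m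
  have hR0 : 0 < R := PrivateWavelet.baseRate_pos (by linarith)
  have hRR : R ≤ PrivateWavelet.rate r s p n m :=
    PrivateWavelet.baseRate_le_rate hp hs hr (by linarith) (by linarith) hl hlm
  have hXp : 1 ≤ (c * l) ^ (r * ((N : ℝ) + 1)) := Real.one_le_rpow hX (by positivity)
  have t1 : ((2 : ℝ) ^ ((j₀ n : ℝ) / 2) * PrivateWavelet.noiseLevel (α n) n (j₀ n)) ^ r ≤
      (c * l) ^ (r * ((N : ℝ) + 1)) * R := by
    have hnl : 0 < PrivateWavelet.noiseLevel (α n) n (j₀ n) := PrivateWavelet.noiseLevel_pos hn0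
    refine (Real.rpow_le_rpow (by positivity) hcoarse hr0.le).trans ?_
    rw [Real.mul_rpow (by linarith) (le_max_of_le_left (by positivity))]
    refine mul_le_mul ?_ (PrivateWavelet.coarse_rate_le_baseRate hp hs hsN.le hr hn1 hm)
      (Real.rpow_nonneg (le_max_of_le_left (by positivity)) _) (by positivity)
    calc c ^ r ≤ (c * l) ^ r :=
          Real.rpow_le_rpow (by linarith) (le_mul_of_one_le_right (by linarith) hl) hr0.le
      _ ≤ _ := Real.rpow_le_rpow_of_exponent_le hX (by nlinarith)
  have t3 : (2 : ℝ) ^ (-(((max (j₀ n) (min (j₁' n) (j₁'' n) + 1) : ℕ) : ℝ) *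
      (r * PrivateWavelet.reducedSmoothness s p r))) ≤ (c * l) ^ (r * ((N : ℝ) + 1)) * R := by
    rw [← neg_mul, Real.rpow_mul (by norm_num)]
    have h1 : (2 : ℝ) ^ (-((max (j₀ n) (min (j₁' n) (j₁'' n) + 1) : ℕ) : ℝ)) ≤
        (2 : ℝ) ^ (-((min (j₁' n) (j₁'' n) : ℕ) : ℝ)) := by
      refine Real.rpow_le_rpow_of_exponent_le (by norm_num) (neg_le_neg ?_)
      exact_mod_cast (Nat.le_succ _).trans (le_max_right _ _)
    refine (Real.rpow_le_rpow (by positivity) (h1.trans hbias) (by positivity)).trans ?_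
    rw [Real.mul_rpow (by linarith) (le_max_of_le_left (by positivity))]
    refine mul_le_mul ?_ (PrivateWavelet.bias_rate_le_baseRate hp hs hr hσ hn1 hm)
      (Real.rpow_nonneg (le_max_of_le_left (by positivity)) _) (by positivity)
    exact Real.rpow_le_rpow_of_exponent_le hX
      (mul_le_mul_of_nonneg_left (by linarith) hr0.le)
  have t2 : R ≤ (c * l) ^ (r * ((N : ℝ) + 1)) * R := le_mul_of_one_le_left hR0.le hXp
  have hX0 : 0 < c * l := by linarith
  calc _ ≤ K * (c * l) ^ (r * (ν + 3 / 2)) * ((c * l) ^ (r * ((N : ℝ) + 1)) * R +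
        (c * l) ^ (r * ((N : ℝ) + 1)) * R + (c * l) ^ (r * ((N : ℝ) + 1)) * R) := by gcongr
    _ = 3 * K * ((c * l) ^ (r * (ν + 3 / 2)) * (c * l) ^ (r * ((N : ℝ) + 1))) * R := by ring
    _ = 3 * K * c ^ (r * (ν + 3 / 2) + r * (N + 1)) * l ^ (r * (ν + 3 / 2) + r * (N + 1)) * R := by
        rw [← Real.rpow_add hX0, Real.mul_rpow (by linarith) (by linarith)]
        ring
    _ ≤ _ := by gcongr
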